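/- Let $\gamma,\tilde\gamma,T_-,T_+>0$ and $\bar\tau_+\in\mathbb R$. For $n\ge1$ let $\mathbb T_n=\{0,\dots,n\}$ and let $(\mathbf r,\mathbf p)=(r_1,\dots,r_n,p_0,\dots,p_n)\in\mathbb R^n\times\mathbb R^{n+1}$ denote a configuration, with the convention $r_0:=0$. On a probability space (which may depend on $n$) with expectation $\mathbb E_n$ and a filtration, let $(\mathbf r(t),\mathbf p(t))_{t\ge0}$ be the open chain of harmonic oscillators of length $n$, i.e. an adapted càdlàg process solving the martingale problem (for $C^2$ test functions with compact support) for the generator $L=n^2(A+\gamma S+\tilde\gamma\tilde S)$, where $$A=\sum_{x=1}^n(p_x-p_{x-1})\partial_{r_x}+\sum_{x=1}^{n-1}(r_{x+1}-r_x)\partial_{p_x}+r_1\partial_{p_0}+(\bar\tau_+-r_n)\partial_{p_n},$$ $$SF(\mathbf r,\mathbf p)=\sum_{x=0}^n\big(F(\mathbf r,\mathbf p^x)-F(\mathbf r,\mathbf p)\big),\qquad \tilde S=\big(T_-\partial_{p_0}^2-p_0\partial_{p_0}\big)+\big(T_+\partial_{p_n}^2-p_n\partial_{p_n}\big),$$ and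 $\mathbf p^x$ is $\mathbf p$ with $p_x$ replaced by $-p_x$. The initial law is arbitrary subject to the assumption below. Write $\bar r^{(n)}_x(t)=\mathbb E_n[r_x(t)]$, $\bar p^{(n)}_x(t)=\mathbb E_n[p_x(t)]$, and $\hat f(k)=\sum_{x=0}^n f_xe^{-2\pi ixk}$ for $k\in\hat{\mathbb T}_n=\{0,\tfrac1{n+1},\dots,\tfrac n{n+1}\}$. Assume $$\sup_{n\ge1}\frac1{n+1}\sum_{x=0}^n\mathbb E_n\Big[\frac{p_x(0)^2+r_x(0)^2}2\Big]<\infty,\qquad \sup_{n\ge1}\Big(\sup_{k\in\hat{\mathbb T}_n}\big|\hat{\bar r}^{(n)}(0,k)\big|+\sup_{k\in\hat{\mathbb T}_n}\big|\hat{\bar p}^{(n)}(0,k)\big|\Big)<\infty.$$ Then all the momenta $p_x(s)$, $x\in\mathbb T_n$, $s\ge0$, are integrable, and for every $t>0$ there is a constant $C>0$, independent of $n$, such that for all $n\ge1$ the function $s\mapsto\sup_{x\in\mathbb T_n}|\bar p^{(n)}_x(s)|^2$ is integrable on $[0,t]$ and $$\int_0^t\sup_{x\in\mathbb T_n}\big|\bar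 p^{(n)}_x(s)\big|^2\,ds\le C\,\frac{\log^2(n+1)}{n^2}.$$ -/

import Mathlib

open MeasureTheory ProbabilityTheory Filter Topology
open scoped NNReal ENNReal

noncomputable section

namespace OpenChain

/-- The configuration space `ℝⁿ × ℝⁿ⁺¹` of the chain with sites `0, …, n`. A configuration is
`ω = (r, p)`: the component `r i`, `i : Fin n`, is the stretch `r_{i+1} = q_{i+1} - q_i`, and
`p x`, `x : Fin (n+1)`, is the momentum at the site `x`. -/
abbrev Config (n : ℕ) : Type := (Fin n → ℝ) × (Fin (n + 1) → ℝ)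

/-- The stretch `r_x` for `x ∈ {0, …, n}`, with the convention `r_0 = 0`. -/
def stretch {n : ℕ} (ω : Config n) : Fin (n + 1) → ℝ :=
  Fin.cons 0 ω.1

/-- The stretch `r_{x+1}` for `x ∈ {0, …, n}`, where for `x = n` the value is the tension `τ`
applied at the right end. -/
def stretchNext {n : ℕ} (τ : ℝ) (ω : Config n) : Fin (n + 1) → ℝ :=
  Fin.snoc ω.1 τ

/-- The energy `p_x² / 2 + r_x² / 2` at the site `x`. -/
def energy {n : ℕ} (ω : Config n) (x : Fin (n + 1)) : ℝ :=
  ω.2 x ^ 2 / 2 + stretch ω x ^ 2 / 2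

/-- The partial derivative `∂F/∂r_{i+1}`. -/
def partialR {n : ℕ} (i : Fin n) (F : Config n → ℝ) (ω : Config n) : ℝ :=
  fderiv ℝ F ω (Pi.single i 1, 0)

/-- The partial derivative `∂F/∂p_x`. -/
def partialP {n : ℕ} (x : Fin (n + 1)) (F : Config n → ℝ) (ω : Config n) : ℝ :=
  fderiv ℝ F ω (0, Pi.single x 1)

/-- The Hamiltonian part
`∑_{x=1}^n (p_x - p_{x-1}) ∂_{r_x} + ∑_{x=1}^{n-1} (r_{x+1} - r_x) ∂_{p_x}
  + r_1 ∂_{p_0} + (τ - r_n) ∂_{p_n}` of the generator (for `n ≥ 1`). -/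
def hamiltonianGen {n : ℕ} (τ : ℝ) (F : Config n → ℝ) (ω : Config n) : ℝ :=
  (∑ i : Fin n, (ω.2 i.succ - ω.2 i.castSucc) * partialR i F ω)
    + ∑ x : Fin (n + 1), (stretchNext τ ω x - stretch ω x) * partialP x F ω

/-- The momentum-flip part `∑_x (F(r, p^x) - F(r, p))`, where `p^x` is `p` with `p_x` replaced
by `-p_x`. -/
def flipGen {n : ℕ} (F : Config n → ℝ) (ω : Config n) : ℝ :=
  ∑ x : Fin (n + 1), (F (ω.1, Function.update ω.2 x (-ω.2 x)) - F ω)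

/-- The Langevin heat bath at temperature `T` acting on the site `x`:
`T ∂²_{p_x} - p_x ∂_{p_x}`. -/
def langevinGen {n : ℕ} (T : ℝ) (x : Fin (n + 1)) (F : Config n → ℝ) (ω : Config n) : ℝ :=
  T * partialP x (partialP x F) ω - ω.2 x * partialP x F ω

/-- The generator of the chain in macroscopic (diffusive) time: flips of rate `γ n²` at each
site, heat baths of strength `γ'` at temperatures `Tm` (left end) and `Tp` (right end), tension
`τ` at the right end. -/
def generator (n : ℕ) (γ γ' Tm Tp τ : ℝ) (F : Config n → ℝ) (ω : Config n) : ℝ :=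
  (n : ℝ) ^ 2 * (hamiltonianGen τ F ω + γ * flipGen F ω
    + γ' * (langevinGen Tm 0 F ω + langevinGen Tp (Fin.last n) F ω))

/-- Every path is right-continuous with left limits. -/
def IsCadlagProcess {Ω E : Type*} [TopologicalSpace E] (X : ℝ≥0 → Ω → E) : Prop :=
  ∀ ω : Ω, ∀ t : ℝ≥0, ContinuousWithinAt (fun s => X s ω) (Set.Ici t) t ∧
    ∃ l : E, Tendsto (fun s => X s ω) (𝓝[<] t) (𝓝 l)

/-- `X` is the dynamics of the open chain of length `n`: an adapted càdlàg process solving the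
martingale problem for the generator `L`, i.e. for each compactly supported test function `F`
of class `C²`, `F(X_t) - F(X_0) - ∫_0^t (L F)(X_s) ds` is a martingale. The law of `X 0`, the
initial distribution, is arbitrary. -/
structure IsChainDynamics {Ω : Type*} {m : MeasurableSpace Ω} (P : Measure Ω)
    (ℱ : Filtration ℝ≥0 m) (n : ℕ) (γ γ' Tm Tp τ : ℝ) (X : ℝ≥0 → Ω → Config n) : Prop where
  adapted : StronglyAdapted ℱ X
  cadlag : IsCadlagProcess X
  martingale : ∀ F : Config n → ℝ, ContDiff ℝ 2 F → HasCompactSupport F →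
    Martingale (fun (t : ℝ≥0) (ω : Ω) => F (X t ω) - F (X 0 ω)
      - ∫ s in (0 : ℝ)..(t : ℝ), generator n γ γ' Tm Tp τ F (X s.toNNReal ω)) ℱ P

/-- The mean momentum `E[p_x(t)]`. -/
def meanMomentum {Ω : Type*} {m : MeasurableSpace Ω} (P : Measure Ω) {n : ℕ}
    (X : ℝ≥0 → Ω → Config n) (t : ℝ≥0) (x : Fin (n + 1)) : ℝ :=
  ∫ ω, (X t ω).2 x ∂P

/-- The mean stretch `E[r_x(t)]`, `x ∈ {0, …, n}`. -/
def meanStretch {Ω : Type*} {m : MeasurableSpace Ω} (P : Measure Ω) {n : ℕ}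
    (X : ℝ≥0 → Ω → Config n) (t : ℝ≥0) (x : Fin (n + 1)) : ℝ :=
  ∫ ω, stretch (X t ω) x ∂P

/-- The mean energy `E[p_x(t)² / 2 + r_x(t)² / 2]`, as a value in `[0, ∞]`. -/
def meanEnergy {Ω : Type*} {m : MeasurableSpace Ω} (P : Measure Ω) {n : ℕ}
    (X : ℝ≥0 → Ω → Config n) (t : ℝ≥0) (x : Fin (n + 1)) : ℝ≥0∞ :=
  ∫⁻ ω, ENNReal.ofReal (energy (X t ω) x) ∂P

/-- The discrete Fourier transform `∑_{x=0}^n f_x e^{-2πi x k}` at the frequency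
`k = j / (n + 1)`, `j ∈ {0, …, n}`. -/
def dft {n : ℕ} (f : Fin (n + 1) → ℝ) (j : Fin (n + 1)) : ℂ :=
  ∑ x : Fin (n + 1), (f x : ℂ) *
    Complex.exp (-2 * Real.pi * Complex.I * ((x : ℕ) : ℂ) * (((j : ℕ) : ℂ) / ((n : ℂ) + 1)))

/-- The assumption on the initial data of the family of chains, `n ≥ 1`: the mean energy per
site is bounded, and the Fourier transforms of the initial mean stretches and momenta are
bounded, uniformly in `n`. -/
structure InitialBounds {Ω : ℕ → Type*} {m : ∀ n, MeasurableSpace (Ω n)}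
    (P : ∀ n, Measure (Ω n)) (X : ∀ n, ℝ≥0 → Ω n → Config n) : Prop where
  energy_bound : ∃ K : ℝ≥0, ∀ n : ℕ, 1 ≤ n →
    ((n : ℝ≥0∞) + 1)⁻¹ * ∑ x : Fin (n + 1), meanEnergy (P n) (X n) 0 x ≤ (K : ℝ≥0∞)
  spectrum_bound : ∃ K : ℝ, ∀ n : ℕ, 1 ≤ n →
    (⨆ j : Fin (n + 1), ‖dft (meanStretch (P n) (X n) 0) j‖)
      + (⨆ j : Fin (n + 1), ‖dft (meanMomentum (P n) (X n) 0) j‖) ≤ K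

end OpenChain

end

/-! The mean configuration solves a closed linear system. In microscopic time (diffusive time
multiplied by `n ^ 2`) it is a damped wave equation `r' = D p`, `p' = τ e_n - D* r - Γ p`. Here `D`
is the discrete gradient and `Γ` is diagonal, between `2γ` (flips) and `2γ + 2γ'` (baths at the
ends). The estimate to prove is that the squared maximum of `|p|`, integrated over microscopic times
up to order `n ^ 2`, grows at most logarithmically in `n`. The change of time then gives the factor
`1 / n ^ 2`.

Initial data. Parseval turns the uniform bound on the `n + 1` Fourier coefficients into a bound on
the `ℓ²` norms of the initial means that does not depend on `n` (`sum_sq_le_of_dft_le`).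

One length scale `L`, one time `T = κ L ^ 2`. The tension is a point force of squared norm `τ ^ 2`,
too strong over such a time. It is spread over a layer of width `L` at the right end (`tension_eq`).
The remaining force has squared norm `O(1/L)`, and the stretches are shifted by a profile of squared
norm `O(L)`. The energy then stays `O(L)` up to time `T`, and damping gives `∫ ‖p‖² = O(L)`. The
time derivative `(D p, p')` solves the same equation without force, so its energy decreases. A cross
term whose derivative is `‖D p‖² - ‖p'‖²` controls the undamped component
(`integral_weight_mul_derivEnergy_le`). Used twice, with the weights `s (T - s)` and its square, it
gives `∫ ‖D p‖² = O(1/L)` over `[T/8, T/2]` (`integral_window_le`).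

Sum over scales. A discrete Agmon inequality bounds `p_x ^ 2` by `(2/L) ‖p‖² + L ‖D p‖²` for `L ≤ n
+ 1`, so every window `[κL²/8, κL²/2]` contributes `O(1)`. Dyadic `L` up to `n + 1` give about `log
n` windows (`IsMeanChain.integral_supSq_le`).

The equation for the means has to be extracted from a martingale problem that only admits compactly
supported test functions. The cut-off `(1 - |ω|²/R)₊³` serves twice. Alone, it gives a concave
truncation of the energy, with a Lyapunov bound uniform in `R`; Grönwall and Fatou then show that
the energy is integrable at all times. Multiplied by a linear function, it gives Dynkin's formula
for that function as `R → ∞` by dominated convergence (`IsChainDynamics.mean_linear`). -/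

namespace OpenChain

/-! ### The cut-off function -/

/-- The positive part of `1 - y / R`. -/
noncomputable def cutBase (R y : ℝ) : ℝ := max 0 (1 - y / R)

lemma hasDerivAt_posPart_pow (k : ℕ) (y : ℝ) :
    HasDerivAt (fun z : ℝ => max 0 z ^ (k + 2)) ((k + 2 : ℝ) * max 0 y ^ (k + 1)) y := by
  rcases lt_trichotomy y 0 with hy | rfl | hy
  · have h0 : (fun z : ℝ => max 0 z ^ (k + 2)) =ᶠ[𝓝 y] fun _ => 0 := by
      filter_upwards [Iio_mem_nhds hy] with z hz
      rw [max_eq_left (le_of_lt hz)]; simp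
    rw [max_eq_left hy.le]
    simpa using (hasDerivAt_const y (0 : ℝ)).congr_of_eventuallyEq h0
  -- At the corner the function is dominated by `|z| ^ (k + 2)`, which is `o(z)` since the exponent
  -- is at least two.
  · have h0 : HasDerivAt (fun z : ℝ => z ^ (k + 2)) 0 0 := by
      simpa using hasDerivAt_pow (k + 2) (0 : ℝ)
    simp only [max_self, ne_eq, Nat.add_eq_zero_iff, one_ne_zero, and_false, not_false_eq_true,
      zero_pow, mul_zero]
    rw [hasDerivAt_iff_isLittleO] at h0 ⊢
    refine Asymptotics.IsBigO.trans_isLittleO ?_ h0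
    refine Asymptotics.IsBigO.of_bound 1 (Eventually.of_forall fun z => ?_)
    simp only [max_self, ne_eq, Nat.add_eq_zero_iff, OfNat.ofNat_ne_zero, and_false,
      not_false_eq_true, zero_pow, sub_zero, smul_zero, norm_pow, Real.norm_eq_abs, one_mul]
    refine pow_le_pow_left₀ (abs_nonneg _) ?_ _
    rw [abs_of_nonneg (le_max_left _ _)]
    exact max_le (abs_nonneg _) (le_abs_self _)
  · have h0 : (fun z : ℝ => max 0 z ^ (k + 2)) =ᶠ[𝓝 y] fun z => z ^ (k + 2) := by
      filter_upwards [Ioi_mem_nhds hy] with z hz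
      rw [max_eq_right (le_of_lt hz)]
    rw [max_eq_right hy.le]
    simpa using (hasDerivAt_pow (k + 2) y).congr_of_eventuallyEq h0

lemma hasDerivAt_cutBase_pow (k : ℕ) (R y : ℝ) :
    HasDerivAt (fun z : ℝ => cutBase R z ^ (k + 2))
      (-((k + 2 : ℝ) / R) * cutBase R y ^ (k + 1)) y := by
  have h1 : HasDerivAt (fun z : ℝ => 1 - z / R) (-(1 / R)) y := by
    simpa using ((hasDerivAt_id y).div_const R).const_sub 1
  refine ((hasDerivAt_posPart_pow k (1 - y / R)).comp y h1).congr_deriv ?_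
  simp only [cutBase]
  ring

/-- Three is the least integer power that works: the second derivative is a multiple of `cutBase`
itself, which is continuous but has a kink. -/
lemma contDiff_cutBase_pow (R : ℝ) : ContDiff ℝ 2 (fun z : ℝ => cutBase R z ^ 3) := by
  have hd : deriv (fun z : ℝ => cutBase R z ^ 3) = fun z => -(3 / R) * cutBase R z ^ 2 := by
    funext z
    have := (hasDerivAt_cutBase_pow 1 R z).deriv
    norm_num at this ⊢
    exact this
  have hd2 : deriv (fun z : ℝ => cutBase R z ^ 2) = fun z => -(2 / R) * cutBase R z := by
    funext z
    have := (hasDerivAt_cutBase_pow 0 R z).deriv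
    norm_num at this ⊢
    exact this
  have h2 : (2 : WithTop ℕ∞) = 1 + 1 := by norm_num
  rw [h2, contDiff_succ_iff_deriv]
  refine ⟨fun z => (hasDerivAt_cutBase_pow 1 R z).differentiableAt, by simp, ?_⟩
  rw [hd]
  refine contDiff_const.mul ?_
  rw [contDiff_one_iff_deriv]
  refine ⟨fun z => (hasDerivAt_cutBase_pow 0 R z).differentiableAt, ?_⟩
  rw [hd2]
  unfold cutBase
  fun_prop

lemma cutBase_nonneg (R y : ℝ) : 0 ≤ cutBase R y := le_max_left _ _

lemma cutBase_le_one {R y : ℝ} (hR : 0 < R) (hy : 0 ≤ y) : cutBase R y ≤ 1 := by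
  refine max_le zero_le_one ?_
  have := div_nonneg hy hR.le
  linarith

lemma cutBase_eq_zero {R y : ℝ} (hR : 0 < R) (hy : R ≤ y) : cutBase R y = 0 := by
  refine max_eq_left ?_
  have : 1 ≤ y / R := by rwa [le_div_iff₀ hR, one_mul]
  linarith

lemma cutBase_eq {R y : ℝ} (hR : 0 < R) (hy : y ≤ R) : cutBase R y = 1 - y / R := by
  refine max_eq_right ?_
  have : y / R ≤ 1 := by rwa [div_le_iff₀ hR, one_mul]
  linarith

lemma continuous_cutBase (R : ℝ) : Continuous (cutBase R) := by
  unfold cutBase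
  fun_prop

/-- One factor of the cut-off absorbs one factor `1 + |ω|²` at the cost of `R`, which the `1/R`
coming from each derivative of the cut-off repays. -/
lemma cutBase_mul_le {R y : ℝ} (hR : 1 ≤ R) (hy : 0 ≤ y) : cutBase R y * (1 + y) ≤ 2 * R := by
  have hR0 : 0 < R := by linarith
  rcases le_total R y with h | h
  · rw [cutBase_eq_zero hR0 h]; linarith
  · have := cutBase_le_one hR0 hy
    nlinarith [cutBase_nonneg R y]

lemma tendsto_cutBase (y : ℝ) : Tendsto (fun R => cutBase R y) atTop (𝓝 1) := by
  have h : Tendsto (fun R : ℝ => max 0 (1 - y / R)) atTop (𝓝 (max 0 (1 - 0))) :=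
    tendsto_const_nhds.max (tendsto_const_nhds.sub (tendsto_const_nhds.div_atTop tendsto_id))
  simpa [cutBase] using h

/-! ### The squared norm of a configuration and the test functions -/

variable {n : ℕ}

/-- The sum of the squares of all stretches and momenta. -/
noncomputable def sqNorm (ω : Config n) : ℝ := ∑ i, ω.1 i ^ 2 + ∑ x, ω.2 x ^ 2

lemma sqNorm_nonneg (ω : Config n) : 0 ≤ sqNorm ω :=
  add_nonneg (Finset.sum_nonneg fun _ _ => sq_nonneg _) (Finset.sum_nonneg fun _ _ => sq_nonneg _)

lemma sq_fst_le (ω : Config n) (i : Fin n) : ω.1 i ^ 2 ≤ sqNorm ω := by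
  have h1 := Finset.single_le_sum (f := fun i => ω.1 i ^ 2) (fun _ _ => sq_nonneg _)
    (Finset.mem_univ i)
  have h2 : 0 ≤ ∑ x, ω.2 x ^ 2 := Finset.sum_nonneg fun _ _ => sq_nonneg _
  simp only [sqNorm]
  linarith

lemma sq_snd_le (ω : Config n) (x : Fin (n + 1)) : ω.2 x ^ 2 ≤ sqNorm ω := by
  have h1 := Finset.single_le_sum (f := fun i => ω.2 i ^ 2) (fun _ _ => sq_nonneg _)
    (Finset.mem_univ x)
  have h2 : 0 ≤ ∑ x, ω.1 x ^ 2 := Finset.sum_nonneg fun _ _ => sq_nonneg _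
  simp only [sqNorm]
  linarith

lemma continuous_sqNorm : Continuous (sqNorm : Config n → ℝ) := by
  unfold sqNorm
  fun_prop

lemma contDiff_sqNorm : ContDiff ℝ 2 (sqNorm : Config n → ℝ) := by
  unfold sqNorm
  fun_prop

/-- The derivative of `sqNorm`. -/
noncomputable def sqNormDeriv (ω : Config n) : Config n →L[ℝ] ℝ :=
  ∑ i, (2 * ω.1 i) • (ContinuousLinearMap.proj i).comp (ContinuousLinearMap.fst ℝ _ _)
    + ∑ x, (2 * ω.2 x) • (ContinuousLinearMap.proj x).comp (ContinuousLinearMap.snd ℝ _ _)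

lemma hasFDerivAt_sqNorm (ω : Config n) : HasFDerivAt sqNorm (sqNormDeriv ω) ω := by
  unfold sqNorm sqNormDeriv
  refine HasFDerivAt.add (HasFDerivAt.fun_sum fun i _ => ?_) (HasFDerivAt.fun_sum fun x _ => ?_)
  · have h : HasFDerivAt (fun ω : Config n => ω.1 i)
        ((ContinuousLinearMap.proj i).comp (ContinuousLinearMap.fst ℝ (Fin n → ℝ) (Fin (n + 1) → ℝ)))
        ω :=
      ((ContinuousLinearMap.proj i).comp (ContinuousLinearMap.fst ℝ (Fin n → ℝ)
        (Fin (n + 1) → ℝ)) : Config n →L[ℝ] ℝ).hasFDerivAt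
    simpa using h.pow 2
  · have h : HasFDerivAt (fun ω : Config n => ω.2 x)
        ((ContinuousLinearMap.proj x).comp (ContinuousLinearMap.snd ℝ (Fin n → ℝ) (Fin (n + 1) → ℝ)))
        ω :=
      ((ContinuousLinearMap.proj x).comp (ContinuousLinearMap.snd ℝ (Fin n → ℝ)
        (Fin (n + 1) → ℝ)) : Config n →L[ℝ] ℝ).hasFDerivAt
    simpa using h.pow 2

lemma sqNormDeriv_single_fst (ω : Config n) (i : Fin n) :
    sqNormDeriv ω (Pi.single i 1, 0) = 2 * ω.1 i := by
  simp [sqNormDeriv, Pi.single_apply]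

lemma sqNormDeriv_single_snd (ω : Config n) (x : Fin (n + 1)) :
    sqNormDeriv ω (0, Pi.single x 1) = 2 * ω.2 x := by
  simp [sqNormDeriv, Pi.single_apply]

lemma hasFDerivAt_mul_comp_sqNorm {A : Config n → ℝ} {A' : Config n →L[ℝ] ℝ} {g : ℝ → ℝ} {g' : ℝ}
    {ω : Config n} (hA : HasFDerivAt A A' ω) (hg : HasDerivAt g g' (sqNorm ω)) :
    HasFDerivAt (fun ω => A ω * g (sqNorm ω))
      (A ω • (g' • sqNormDeriv ω) + g (sqNorm ω) • A') ω :=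
  hA.mul (hg.comp_hasFDerivAt ω (hasFDerivAt_sqNorm ω))

lemma partialR_mul_comp_sqNorm {A : Config n → ℝ} {A' : Config n →L[ℝ] ℝ} {g : ℝ → ℝ} {g' : ℝ}
    {ω : Config n} (hA : HasFDerivAt A A' ω) (hg : HasDerivAt g g' (sqNorm ω)) (i : Fin n) :
    partialR i (fun ω => A ω * g (sqNorm ω)) ω
      = A' (Pi.single i 1, 0) * g (sqNorm ω) + A ω * (g' * (2 * ω.1 i)) := by
  rw [partialR, (hasFDerivAt_mul_comp_sqNorm hA hg).fderiv]
  simp only [_root_.add_apply, _root_.smul_apply, smul_eq_mul,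
    sqNormDeriv_single_fst]
  ring

lemma partialP_mul_comp_sqNorm {A : Config n → ℝ} {A' : Config n →L[ℝ] ℝ} {g : ℝ → ℝ} {g' : ℝ}
    {ω : Config n} (hA : HasFDerivAt A A' ω) (hg : HasDerivAt g g' (sqNorm ω))
    (x : Fin (n + 1)) :
    partialP x (fun ω => A ω * g (sqNorm ω)) ω
      = A' (0, Pi.single x 1) * g (sqNorm ω) + A ω * (g' * (2 * ω.2 x)) := by
  rw [partialP, (hasFDerivAt_mul_comp_sqNorm hA hg).fderiv]
  simp only [_root_.add_apply, _root_.smul_apply, smul_eq_mul,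
    sqNormDeriv_single_snd]
  ring

/-- The test function `(a + ℓ) (1 - |ω|² / R)₊³`. -/
noncomputable def cutTest (a : ℝ) (ℓ : Config n →L[ℝ] ℝ) (R : ℝ) (ω : Config n) : ℝ :=
  (a + ℓ ω) * cutBase R (sqNorm ω) ^ 3

lemma contDiff_cutTest (a : ℝ) (ℓ : Config n →L[ℝ] ℝ) (R : ℝ) : ContDiff ℝ 2 (cutTest a ℓ R) :=
  (contDiff_const.add ℓ.contDiff).mul ((contDiff_cutBase_pow R).comp contDiff_sqNorm)

lemma hasCompactSupport_cutTest (a : ℝ) (ℓ : Config n →L[ℝ] ℝ) {R : ℝ} (hR : 0 < R) :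
    HasCompactSupport (cutTest a ℓ R) := by
  refine HasCompactSupport.intro (isCompact_closedBall (0 : Config n) (Real.sqrt R)) ?_
  intro ω hω
  have : R ≤ sqNorm ω := by
    by_contra! h
    apply hω
    rw [mem_closedBall_zero_iff, Prod.norm_def, max_le_iff]
    constructor
    · rw [pi_norm_le_iff_of_nonneg (Real.sqrt_nonneg _)]
      intro i
      exact Real.abs_le_sqrt ((sq_fst_le ω i).trans h.le)
    · rw [pi_norm_le_iff_of_nonneg (Real.sqrt_nonneg _)]
      intro i
      exact Real.abs_le_sqrt ((sq_snd_le ω i).trans h.le)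
  simp [cutTest, cutBase_eq_zero hR this]

lemma hasFDerivAt_const_add (a : ℝ) (ℓ : Config n →L[ℝ] ℝ) (ω : Config n) :
    HasFDerivAt (fun ω => a + ℓ ω) ℓ ω := ℓ.hasFDerivAt.const_add a

lemma partialR_cutTest (a : ℝ) (ℓ : Config n →L[ℝ] ℝ) (R : ℝ) (i : Fin n) (ω : Config n) :
    partialR i (cutTest a ℓ R) ω = ℓ (Pi.single i 1, 0) * cutBase R (sqNorm ω) ^ 3
      + (a + ℓ ω) * (-(3 / R) * cutBase R (sqNorm ω) ^ 2 * (2 * ω.1 i)) := by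
  have h := partialR_mul_comp_sqNorm (hasFDerivAt_const_add a ℓ ω)
    (hasDerivAt_cutBase_pow 1 R (sqNorm ω)) i
  norm_num at h ⊢
  exact h

lemma partialP_cutTest (a : ℝ) (ℓ : Config n →L[ℝ] ℝ) (R : ℝ) (x : Fin (n + 1)) (ω : Config n) :
    partialP x (cutTest a ℓ R) ω = ℓ (0, Pi.single x 1) * cutBase R (sqNorm ω) ^ 3
      + (a + ℓ ω) * (-(3 / R) * cutBase R (sqNorm ω) ^ 2 * (2 * ω.2 x)) := by
  have h := partialP_mul_comp_sqNorm (hasFDerivAt_const_add a ℓ ω)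
    (hasDerivAt_cutBase_pow 1 R (sqNorm ω)) x
  norm_num at h ⊢
  exact h

lemma partialP_add {F G : Config n → ℝ} {ω : Config n} (hF : DifferentiableAt ℝ F ω)
    (hG : DifferentiableAt ℝ G ω) (x : Fin (n + 1)) :
    partialP x (fun ω => F ω + G ω) ω = partialP x F ω + partialP x G ω := by
  rw [partialP, fderiv_fun_add hF hG]
  rfl

lemma partialP_partialP_cutTest (a : ℝ) (ℓ : Config n →L[ℝ] ℝ) (R : ℝ) (x : Fin (n + 1))
    (ω : Config n) :
    partialP x (partialP x (cutTest a ℓ R)) ω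
      = -(3 / R) * cutBase R (sqNorm ω) ^ 2 * (4 * ω.2 x * ℓ (0, Pi.single x 1) + 2 * (a + ℓ ω))
        + 6 / R ^ 2 * cutBase R (sqNorm ω) * (4 * ω.2 x ^ 2 * (a + ℓ ω)) := by
  have h1 : partialP x (cutTest a ℓ R) = fun ω =>
      ℓ (0, Pi.single x 1) * cutBase R (sqNorm ω) ^ 3
        + ((a + ℓ ω) * ω.2 x * (-(6 / R))) * cutBase R (sqNorm ω) ^ 2 := by
    funext ω
    rw [partialP_cutTest]
    ring
  have hp : HasFDerivAt (fun ω : Config n => ω.2 x)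
      ((ContinuousLinearMap.proj x).comp (ContinuousLinearMap.snd ℝ (Fin n → ℝ)
        (Fin (n + 1) → ℝ))) ω :=
    ((ContinuousLinearMap.proj x).comp (ContinuousLinearMap.snd ℝ (Fin n → ℝ)
      (Fin (n + 1) → ℝ)) : Config n →L[ℝ] ℝ).hasFDerivAt
  have hA : HasFDerivAt (fun ω : Config n => (a + ℓ ω) * ω.2 x * (-(6 / R))) _ ω :=
    ((hasFDerivAt_const_add a ℓ ω).mul hp).mul_const (-(6 / R))
  have hc := hasFDerivAt_const (𝕜 := ℝ) (ℓ (0, Pi.single x 1)) ω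
  have d3 := hasDerivAt_cutBase_pow 1 R (sqNorm ω)
  have d2 := hasDerivAt_cutBase_pow 0 R (sqNorm ω)
  rw [h1]
  refine (partialP_add (hasFDerivAt_mul_comp_sqNorm hc d3).differentiableAt
    (hasFDerivAt_mul_comp_sqNorm hA d2).differentiableAt x).trans ?_
  refine (congrArg₂ (· + ·) (partialP_mul_comp_sqNorm hc d3 x)
    (partialP_mul_comp_sqNorm hA d2 x)).trans ?_
  simp
  ring

/-! ### The generator on the cut-off test functions. -/

lemma sqNorm_update_neg (ω : Config n) (x : Fin (n + 1)) :
    sqNorm (ω.1, Function.update ω.2 x (-ω.2 x)) = sqNorm ω := by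
  simp only [sqNorm]
  congr 1
  refine Finset.sum_congr rfl fun y _ => ?_
  by_cases h : y = x
  · subst h; simp
  · simp [h]

lemma clm_update_neg (ℓ : Config n →L[ℝ] ℝ) (ω : Config n) (x : Fin (n + 1)) :
    ℓ (ω.1, Function.update ω.2 x (-ω.2 x)) = ℓ ω - 2 * ω.2 x * ℓ (0, Pi.single x 1) := by
  have : (ω.1, Function.update ω.2 x (-ω.2 x))
      = ω - (2 * ω.2 x) • ((0, Pi.single x 1) : Config n) := by
    refine Prod.ext ?_ ?_
    · simp
    · funext y
      by_cases h : y = x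
      · subst h; simp; ring
      · simp [h]
  rw [this, map_sub, map_smul, smul_eq_mul]

lemma flipGen_cutTest (a : ℝ) (ℓ : Config n →L[ℝ] ℝ) (R : ℝ) (ω : Config n) :
    flipGen (cutTest a ℓ R) ω
      = (∑ x, -(2 * ω.2 x) * ℓ (0, Pi.single x 1)) * cutBase R (sqNorm ω) ^ 3 := by
  rw [flipGen, Finset.sum_mul]
  refine Finset.sum_congr rfl fun x _ => ?_
  simp only [cutTest, sqNorm_update_neg, clm_update_neg]
  ring

/-- Summation by parts on the chain. -/
lemma sum_snoc_sub_cons_mul (r : Fin n → ℝ) (p : Fin (n + 1) → ℝ) (c : ℝ) :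
    ∑ x : Fin (n + 1), ((Fin.snoc r c : Fin (n + 1) → ℝ) x - (Fin.cons 0 r : Fin (n + 1) → ℝ) x) * p x
      = c * p (Fin.last n) - ∑ i, r i * (p i.succ - p i.castSucc) := by
  simp only [sub_mul, Finset.sum_sub_distrib, mul_sub]
  rw [Fin.sum_univ_castSucc, Fin.sum_univ_succ (fun x => (Fin.cons 0 r : Fin (n + 1) → ℝ) x * p x)]
  simp
  ring

/-- The generator applied to the linear function `ℓ`. -/
noncomputable def linearGen (γ γ' τ : ℝ) (ℓ : Config n →L[ℝ] ℝ) (ω : Config n) : ℝ :=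
  (n : ℝ) ^ 2 * ((∑ i : Fin n, (ω.2 i.succ - ω.2 i.castSucc) * ℓ (Pi.single i 1, 0))
    + (∑ x, (stretchNext τ ω x - stretch ω x) * ℓ (0, Pi.single x 1))
    + γ * (∑ x, -(2 * ω.2 x) * ℓ (0, Pi.single x 1))
    - γ' * (ω.2 0 * ℓ (0, Pi.single 0 1) + ω.2 (Fin.last n) * ℓ (0, Pi.single (Fin.last n) 1)))

/-- The first-order part of the generator applied to `sqNorm`. -/
noncomputable def sqNormDrift (γ' τ : ℝ) (ω : Config n) : ℝ :=
  2 * (n : ℝ) ^ 2 * (τ * ω.2 (Fin.last n) - γ' * (ω.2 0 ^ 2 + ω.2 (Fin.last n) ^ 2))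

/-- The Hamiltonian flow preserves `|ω|²` up to the work of the tension: after summation by parts
only `2 τ p_n` survives where the derivative falls on the cut-off. -/
lemma hamiltonianGen_cutTest (τ a : ℝ) (ℓ : Config n →L[ℝ] ℝ) (R : ℝ) (ω : Config n) :
    hamiltonianGen τ (cutTest a ℓ R) ω
      = cutBase R (sqNorm ω) ^ 3 *
          ((∑ i : Fin n, (ω.2 i.succ - ω.2 i.castSucc) * ℓ (Pi.single i 1, 0))
            + (∑ x, (stretchNext τ ω x - stretch ω x) * ℓ (0, Pi.single x 1)))
        + (-(3 / R) * cutBase R (sqNorm ω) ^ 2 * (a + ℓ ω)) * (2 * (τ * ω.2 (Fin.last n))) := by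
  have hs := sum_snoc_sub_cons_mul ω.1 ω.2 τ
  have hs' : τ * ω.2 (Fin.last n) = (∑ x, (stretchNext τ ω x - stretch ω x) * ω.2 x)
      + ∑ i, (ω.2 i.succ - ω.2 i.castSucc) * ω.1 i := by
    simp only [stretchNext, stretch]
    rw [hs]
    simp only [mul_comm (ω.1 _)]
    ring
  rw [hs', hamiltonianGen]
  simp only [partialR_cutTest, partialP_cutTest, mul_add, Finset.sum_add_distrib, Finset.mul_sum]
  have e : ∀ A B C D A' B' C' D' : ℝ, A = A' → B = D' → C = B' → D = C' →
      (A + B) + (C + D) = A' + B' + (C' + D') := by intros; subst_vars; ring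
  apply e <;> refine Finset.sum_congr rfl fun x _ => ?_ <;> ring

/-- Each derivative of the cut-off brings a factor `1/R` and lowers its power by one, so one main
term and two error terms appear. Flips leave the cut-off alone because `|ω|²` is even in every
momentum. The same formula is used with `a = 0` for linear functions and with `a = 1`, `ℓ = 0` for
the energy. -/
theorem generator_cutTest (γ γ' Tm Tp τ a : ℝ) (ℓ : Config n →L[ℝ] ℝ) (R : ℝ) (ω : Config n) :
    generator n γ γ' Tm Tp τ (cutTest a ℓ R) ω
      = cutBase R (sqNorm ω) ^ 3 * linearGen γ γ' τ ℓ ω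
        - 3 / R * cutBase R (sqNorm ω) ^ 2 *
          ((a + ℓ ω) * (sqNormDrift γ' τ ω + 2 * (n : ℝ) ^ 2 * γ' * (Tm + Tp))
            + 4 * (n : ℝ) ^ 2 * γ' * (Tm * ω.2 0 * ℓ (0, Pi.single 0 1)
              + Tp * ω.2 (Fin.last n) * ℓ (0, Pi.single (Fin.last n) 1)))
        + 6 / R ^ 2 * cutBase R (sqNorm ω) *
          ((a + ℓ ω) * (4 * (n : ℝ) ^ 2 * γ' * (Tm * ω.2 0 ^ 2 + Tp * ω.2 (Fin.last n) ^ 2))) := by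
  rw [generator, hamiltonianGen_cutTest, flipGen_cutTest]
  simp only [langevinGen, partialP_partialP_cutTest, partialP_cutTest, linearGen, sqNormDrift]
  ring

/-! ### Bounds on the generator, uniform in the cut-off -/

section Bounds

variable {n : ℕ}

/-- The coordinate function `r_{i+1}`. -/
noncomputable def coordR (i : Fin n) : Config n →L[ℝ] ℝ :=
  (ContinuousLinearMap.proj i).comp (ContinuousLinearMap.fst ℝ (Fin n → ℝ) (Fin (n + 1) → ℝ))

/-- The coordinate function `p_x`. -/
noncomputable def coordP (x : Fin (n + 1)) : Config n →L[ℝ] ℝ :=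
  (ContinuousLinearMap.proj x).comp (ContinuousLinearMap.snd ℝ (Fin n → ℝ) (Fin (n + 1) → ℝ))

@[simp] lemma coordR_apply (i : Fin n) (ω : Config n) : coordR i ω = ω.1 i := rfl

@[simp] lemma coordP_apply (x : Fin (n + 1)) (ω : Config n) : coordP x ω = ω.2 x := rfl

/-- The linear part of the affine function `linearGen γ γ' τ ℓ`. -/
noncomputable def linearGenCLM (γ γ' : ℝ) (ℓ : Config n →L[ℝ] ℝ) : Config n →L[ℝ] ℝ :=
  (n : ℝ) ^ 2 • ((∑ i : Fin n, ℓ (Pi.single i 1, 0) • (coordP i.succ - coordP i.castSucc))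
    - (∑ i : Fin n, (ℓ (0, Pi.single i.succ 1) - ℓ (0, Pi.single i.castSucc 1)) • coordR i)
    + γ • (∑ x, (-2 * ℓ (0, Pi.single x 1)) • coordP x)
    - γ' • (ℓ (0, Pi.single 0 1) • coordP 0
      + ℓ (0, Pi.single (Fin.last n) 1) • coordP (Fin.last n)))

lemma linearGen_eq (γ γ' τ : ℝ) (ℓ : Config n →L[ℝ] ℝ) (ω : Config n) :
    linearGen γ γ' τ ℓ ω
      = (n : ℝ) ^ 2 * τ * ℓ (0, Pi.single (Fin.last n) 1) + linearGenCLM γ γ' ℓ ω := by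
  rw [linearGen]
  simp only [stretchNext, stretch,
    sum_snoc_sub_cons_mul ω.1 (fun x => ℓ (0, Pi.single x 1)) τ]
  simp only [linearGenCLM, _root_.smul_apply, _root_.sub_apply, _root_.add_apply,
    _root_.sum_apply, smul_eq_mul, coordP_apply, coordR_apply]
  have e1 : ∑ i : Fin n, (ω.2 i.succ - ω.2 i.castSucc) * ℓ (Pi.single i 1, 0)
      = ∑ i : Fin n, ℓ (Pi.single i 1, 0) * (ω.2 i.succ - ω.2 i.castSucc) :=
    Finset.sum_congr rfl fun i _ => mul_comm _ _
  have e2 : ∑ i : Fin n, ω.1 i * (ℓ (0, Pi.single i.succ 1) - ℓ (0, Pi.single i.castSucc 1))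
      = ∑ i : Fin n, (ℓ (0, Pi.single i.succ 1) - ℓ (0, Pi.single i.castSucc 1)) * ω.1 i :=
    Finset.sum_congr rfl fun i _ => mul_comm _ _
  have e3 : ∑ x, -(2 * ω.2 x) * ℓ (0, Pi.single x 1)
      = ∑ x, (-2 * ℓ (0, Pi.single x 1)) * ω.2 x :=
    Finset.sum_congr rfl fun i _ => by ring
  rw [e1, e2, e3]
  ring

lemma continuous_linearGen (γ γ' τ : ℝ) (ℓ : Config n →L[ℝ] ℝ) :
    Continuous (linearGen γ γ' τ ℓ) := by
  have : linearGen γ γ' τ ℓ = fun ω =>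
      (n : ℝ) ^ 2 * τ * ℓ (0, Pi.single (Fin.last n) 1) + linearGenCLM γ γ' ℓ ω :=
    funext (linearGen_eq γ γ' τ ℓ)
  rw [this]
  fun_prop

lemma norm_le_one_add_sqNorm (ω : Config n) : ‖ω‖ ≤ 1 + sqNorm ω := by
  have h0 := sqNorm_nonneg ω
  have key : ∀ y : ℝ, y ^ 2 ≤ sqNorm ω → ‖y‖ ≤ 1 + sqNorm ω := by
    intro y hy
    rw [Real.norm_eq_abs]
    have := sq_abs y
    nlinarith [sq_nonneg (|y| - 1)]
  rw [Prod.norm_def, max_le_iff]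
  constructor
  · rw [pi_norm_le_iff_of_nonneg (by linarith)]
    exact fun i => key _ (sq_fst_le ω i)
  · rw [pi_norm_le_iff_of_nonneg (by linarith)]
    exact fun i => key _ (sq_snd_le ω i)

lemma norm_clm_le (ℓ : Config n →L[ℝ] ℝ) (ω : Config n) : |ℓ ω| ≤ ‖ℓ‖ * (1 + sqNorm ω) :=
  (ℓ.le_opNorm ω).trans (mul_le_mul_of_nonneg_left (norm_le_one_add_sqNorm ω) (norm_nonneg _))

lemma exists_bound_const_add (a : ℝ) (ℓ : Config n →L[ℝ] ℝ) :
    ∃ C : ℝ, 0 ≤ C ∧ ∀ ω : Config n, |a + ℓ ω| ≤ C * (1 + sqNorm ω) := by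
  refine ⟨|a| + ‖ℓ‖, by positivity, fun ω => (abs_add_le _ _).trans ?_⟩
  have := norm_clm_le ℓ ω
  nlinarith [mul_nonneg (abs_nonneg a) (sqNorm_nonneg ω)]

lemma exists_bound_linearGen (γ γ' τ : ℝ) (ℓ : Config n →L[ℝ] ℝ) :
    ∃ C : ℝ, 0 ≤ C ∧ ∀ ω : Config n, |linearGen γ γ' τ ℓ ω| ≤ C * (1 + sqNorm ω) := by
  obtain ⟨C, hC, h⟩ := exists_bound_const_add ((n : ℝ) ^ 2 * τ * ℓ (0, Pi.single (Fin.last n) 1))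
    (linearGenCLM γ γ' ℓ)
  exact ⟨C, hC, fun ω => by rw [linearGen_eq]; exact h ω⟩

lemma exists_bound_quad (a b c d : ℝ) : ∃ C : ℝ, 0 ≤ C ∧ ∀ ω : Config n,
    |a + b * ω.2 (Fin.last n) + c * ω.2 0 ^ 2 + d * ω.2 (Fin.last n) ^ 2|
      ≤ C * (1 + sqNorm ω) := by
  refine ⟨|a| + |b| + |c| + |d|, by positivity, fun ω => ?_⟩
  have h0 := sq_snd_le ω 0
  have h1 := sq_snd_le ω (Fin.last n)
  have h3 : |ω.2 (Fin.last n)| ≤ 1 + sqNorm ω := by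
    have := sq_abs (ω.2 (Fin.last n))
    nlinarith [sq_nonneg (|ω.2 (Fin.last n)| - 1)]
  have hs := sqNorm_nonneg ω
  calc _ ≤ |a| + |b * ω.2 (Fin.last n)| + |c * ω.2 0 ^ 2| + |d * ω.2 (Fin.last n) ^ 2| := by
        refine (abs_add_le _ _).trans (add_le_add_left ((abs_add_le _ _).trans
          (add_le_add_left (abs_add_le _ _) _)) _)
    _ ≤ |a| * (1 + sqNorm ω) + |b| * (1 + sqNorm ω) + |c| * (1 + sqNorm ω)
        + |d| * (1 + sqNorm ω) := by
        simp only [abs_mul, abs_sq]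
        gcongr
        · nlinarith [abs_nonneg a]
        · linarith
        · linarith
    _ = _ := by ring

/-- Every factor is crudely at most a multiple of `N = 1 + |ω|²`. The error terms contain two such
factors, and `cutBase_mul_le` with the prefactor `1/R` or `1/R ^ 2` takes one `N` back. Uniformity
in `R` makes this a dominating function for the limit `R → ∞`. -/
theorem exists_bound_generator_cutTest (γ γ' Tm Tp τ a : ℝ) (ℓ : Config n →L[ℝ] ℝ) :
    ∃ C : ℝ, 0 ≤ C ∧ ∀ R : ℝ, 1 ≤ R → ∀ ω : Config n,
      |generator n γ γ' Tm Tp τ (cutTest a ℓ R) ω| ≤ C * (1 + sqNorm ω) := by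
  obtain ⟨C₁, hC₁, h₁⟩ := exists_bound_linearGen γ γ' τ ℓ
  obtain ⟨C₂, hC₂, h₂⟩ := exists_bound_const_add a ℓ
  obtain ⟨C₃, hC₃, h₃⟩ := exists_bound_quad (n := n) (2 * (n : ℝ) ^ 2 * γ' * (Tm + Tp))
    (2 * (n : ℝ) ^ 2 * τ) (-(2 * (n : ℝ) ^ 2 * γ')) (-(2 * (n : ℝ) ^ 2 * γ'))
  obtain ⟨C₄, hC₄, h₄⟩ := exists_bound_const_add 0
    ((4 * (n : ℝ) ^ 2 * γ') • ((Tm * ℓ (0, Pi.single 0 1)) • coordP 0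
      + (Tp * ℓ (0, Pi.single (Fin.last n) 1)) • coordP (Fin.last n)))
  obtain ⟨C₅, hC₅, h₅⟩ := exists_bound_quad (n := n) 0 0 (4 * (n : ℝ) ^ 2 * γ' * Tm)
    (4 * (n : ℝ) ^ 2 * γ' * Tp)
  refine ⟨C₁ + 6 * (C₂ * C₃ + C₄) + 12 * (C₂ * C₅), by positivity, fun R hR ω => ?_⟩
  have hR0 : 0 < R := by linarith
  have hs := sqNorm_nonneg ω
  set k := cutBase R (sqNorm ω) with hk
  have hk0 : 0 ≤ k := cutBase_nonneg _ _
  have hk1 : k ≤ 1 := cutBase_le_one hR0 hs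
  have hk2 : k * (1 + sqNorm ω) ≤ 2 * R := cutBase_mul_le hR hs
  set N := 1 + sqNorm ω with hN
  have hN1 : 1 ≤ N := by linarith
  rw [generator_cutTest, ← hk]
  have e3 : |sqNormDrift γ' τ ω + 2 * (n : ℝ) ^ 2 * γ' * (Tm + Tp)| ≤ C₃ * N := by
    convert h₃ ω using 2
    simp only [sqNormDrift]
    ring
  have e4 : |4 * (n : ℝ) ^ 2 * γ' * (Tm * ω.2 0 * ℓ (0, Pi.single 0 1)
      + Tp * ω.2 (Fin.last n) * ℓ (0, Pi.single (Fin.last n) 1))| ≤ C₄ * N := by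
    convert h₄ ω using 2
    simp
    ring
  have e5 : |4 * (n : ℝ) ^ 2 * γ' * (Tm * ω.2 0 ^ 2 + Tp * ω.2 (Fin.last n) ^ 2)| ≤ C₅ * N := by
    convert h₅ ω using 2
    ring
  have t1 : |k ^ 3 * linearGen γ γ' τ ℓ ω| ≤ C₁ * N := by
    rw [abs_mul, abs_of_nonneg (by positivity)]
    calc _ ≤ 1 * |linearGen γ γ' τ ℓ ω| := by gcongr; exact pow_le_one₀ hk0 hk1
      _ ≤ _ := by rw [one_mul]; exact h₁ ω
  have f1 : 3 / R * k ^ 2 * N ≤ 6 := by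
    have : k ^ 2 * N ≤ 2 * R := by nlinarith
    calc 3 / R * k ^ 2 * N = 3 / R * (k ^ 2 * N) := by ring
      _ ≤ 3 / R * (2 * R) := by gcongr
      _ = 6 := by field_simp; norm_num
  have f2 : 6 / R ^ 2 * k * N ≤ 12 := by
    calc 6 / R ^ 2 * k * N = 6 / R ^ 2 * (k * N) := by ring
      _ ≤ 6 / R ^ 2 * (2 * R) := by gcongr
      _ = 12 / R := by field_simp; norm_num
      _ ≤ 12 := div_le_self (by norm_num) hR
  have t2 : |3 / R * k ^ 2 * ((a + ℓ ω) * (sqNormDrift γ' τ ω + 2 * (n : ℝ) ^ 2 * γ' * (Tm + Tp))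
      + 4 * (n : ℝ) ^ 2 * γ' * (Tm * ω.2 0 * ℓ (0, Pi.single 0 1)
      + Tp * ω.2 (Fin.last n) * ℓ (0, Pi.single (Fin.last n) 1)))| ≤ 6 * (C₂ * C₃ + C₄) * N := by
    rw [abs_mul, abs_of_nonneg (by positivity : 0 ≤ 3 / R * k ^ 2)]
    calc _ ≤ 3 / R * k ^ 2 * ((C₂ * N) * (C₃ * N) + C₄ * N) := by
          gcongr
          refine (abs_add_le _ _).trans (add_le_add ?_ e4)
          rw [abs_mul]
          exact mul_le_mul (h₂ ω) e3 (abs_nonneg _) (by positivity)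
      _ ≤ 3 / R * k ^ 2 * ((C₂ * N) * (C₃ * N) + C₄ * N * N) := by
          gcongr
          exact le_mul_of_one_le_right (by positivity) hN1
      _ = (3 / R * k ^ 2 * N) * ((C₂ * C₃ + C₄) * N) := by ring
      _ ≤ 6 * ((C₂ * C₃ + C₄) * N) := by gcongr
      _ = _ := by ring
  have t3 : |6 / R ^ 2 * k * ((a + ℓ ω) * (4 * (n : ℝ) ^ 2 * γ' *
      (Tm * ω.2 0 ^ 2 + Tp * ω.2 (Fin.last n) ^ 2)))| ≤ 12 * (C₂ * C₅) * N := by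
    rw [abs_mul, abs_of_nonneg (by positivity : 0 ≤ 6 / R ^ 2 * k), abs_mul]
    calc _ ≤ 6 / R ^ 2 * k * ((C₂ * N) * (C₅ * N)) := by
          gcongr
          exact h₂ ω
      _ = (6 / R ^ 2 * k * N) * ((C₂ * C₅) * N) := by ring
      _ ≤ 12 * ((C₂ * C₅) * N) := by gcongr
      _ = _ := by ring
  calc _ ≤ C₁ * N + 6 * (C₂ * C₃ + C₄) * N + 12 * (C₂ * C₅) * N :=
        (abs_add_le _ _).trans (add_le_add ((abs_sub _ _).trans (add_le_add t1 t2)) t3)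
    _ = _ := by ring

lemma generator_cutTest_eq_zero (γ γ' Tm Tp τ a : ℝ) (ℓ : Config n →L[ℝ] ℝ) {R : ℝ} (hR : 0 < R)
    {ω : Config n} (hω : R ≤ sqNorm ω) : generator n γ γ' Tm Tp τ (cutTest a ℓ R) ω = 0 := by
  simp [generator_cutTest, cutBase_eq_zero hR hω]

lemma exists_const_bound_generator_cutTest (γ γ' Tm Tp τ a : ℝ) (ℓ : Config n →L[ℝ] ℝ) {R : ℝ}
    (hR : 1 ≤ R) : ∃ C : ℝ, ∀ ω : Config n,
      |generator n γ γ' Tm Tp τ (cutTest a ℓ R) ω| ≤ C := by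
  obtain ⟨C, hC, h⟩ := exists_bound_generator_cutTest γ γ' Tm Tp τ a ℓ
  refine ⟨C * (1 + R), fun ω => ?_⟩
  rcases le_total R (sqNorm ω) with h' | h'
  · rw [generator_cutTest_eq_zero _ _ _ _ _ _ _ (by linarith) h', abs_zero]
    have : 0 ≤ R := by linarith
    positivity
  · refine (h R hR ω).trans ?_
    gcongr

lemma exists_const_bound_cutTest (a : ℝ) (ℓ : Config n →L[ℝ] ℝ) {R : ℝ} (hR : 0 < R) :
    ∃ C : ℝ, ∀ ω : Config n, |cutTest a ℓ R ω| ≤ C :=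
  (hasCompactSupport_cutTest a ℓ hR).exists_bound_of_continuous (contDiff_cutTest a ℓ R).continuous

lemma continuous_generator_cutTest (γ γ' Tm Tp τ a : ℝ) (ℓ : Config n →L[ℝ] ℝ) (R : ℝ) :
    Continuous (generator n γ γ' Tm Tp τ (cutTest a ℓ R)) := by
  have : generator n γ γ' Tm Tp τ (cutTest a ℓ R) = _ :=
    funext (generator_cutTest γ γ' Tm Tp τ a ℓ R)
  rw [this]
  have h1 := continuous_linearGen γ γ' τ ℓ
  have h2 : Continuous fun ω : Config n => cutBase R (sqNorm ω) :=
    (continuous_cutBase R).comp continuous_sqNorm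
  unfold sqNormDrift
  fun_prop

lemma tendsto_generator_cutTest (γ γ' Tm Tp τ : ℝ) (ℓ : Config n →L[ℝ] ℝ) (ω : Config n) :
    Tendsto (fun R => generator n γ γ' Tm Tp τ (cutTest 0 ℓ R) ω) atTop
      (𝓝 (linearGen γ γ' τ ℓ ω)) := by
  simp only [generator_cutTest]
  have h1 := tendsto_cutBase (sqNorm ω)
  have h2 : Tendsto (fun R : ℝ => 3 / R) atTop (𝓝 0) := tendsto_const_nhds.div_atTop tendsto_id
  have h3 : Tendsto (fun R : ℝ => 6 / R ^ 2) atTop (𝓝 0) :=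
    tendsto_const_nhds.div_atTop (tendsto_pow_atTop (by norm_num))
  have := (((h1.pow 3).mul_const (linearGen γ γ' τ ℓ ω)).sub
    ((h2.mul (h1.pow 2)).mul_const ((0 + ℓ ω) * (sqNormDrift γ' τ ω
      + 2 * (n : ℝ) ^ 2 * γ' * (Tm + Tp))
            + 4 * (n : ℝ) ^ 2 * γ' * (Tm * ω.2 0 * ℓ (0, Pi.single 0 1)
              + Tp * ω.2 (Fin.last n) * ℓ (0, Pi.single (Fin.last n) 1))))).add
    ((h3.mul h1).mul_const ((0 + ℓ ω) * (4 * (n : ℝ) ^ 2 * γ'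
      * (Tm * ω.2 0 ^ 2 + Tp * ω.2 (Fin.last n) ^ 2))))
  simpa using this

lemma tendsto_cutTest (ℓ : Config n →L[ℝ] ℝ) (ω : Config n) :
    Tendsto (fun R => cutTest 0 ℓ R ω) atTop (𝓝 (ℓ ω)) := by
  have := ((tendsto_cutBase (sqNorm ω)).pow 3).const_mul (0 + ℓ ω)
  simpa [cutTest] using this

lemma abs_cutTest_le (ℓ : Config n →L[ℝ] ℝ) {R : ℝ} (hR : 0 < R) (ω : Config n) :
    |cutTest 0 ℓ R ω| ≤ |ℓ ω| := by
  rw [cutTest, zero_add, abs_mul, abs_of_nonneg (pow_nonneg (cutBase_nonneg _ _) _)]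
  exact mul_le_of_le_one_right (abs_nonneg _)
    (pow_le_one₀ (cutBase_nonneg _ _) (cutBase_le_one hR (sqNorm_nonneg ω)))

/-- A concave truncation of `sqNorm` at level `R`. -/
noncomputable def truncSq (R : ℝ) (ω : Config n) : ℝ := R / 3 * (1 - cutTest 1 0 R ω)

lemma truncSq_eq (R : ℝ) (ω : Config n) :
    truncSq R ω = R / 3 * (1 - cutBase R (sqNorm ω) ^ 3) := by
  simp [truncSq, cutTest]

lemma truncSq_nonneg {R : ℝ} (hR : 0 < R) (ω : Config n) : 0 ≤ truncSq R ω := by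
  rw [truncSq_eq]
  have : cutBase R (sqNorm ω) ^ 3 ≤ 1 :=
    pow_le_one₀ (cutBase_nonneg _ _) (cutBase_le_one hR (sqNorm_nonneg ω))
  have : 0 ≤ 1 - cutBase R (sqNorm ω) ^ 3 := by linarith
  positivity

/-- As a function of `s = |ω|²` the truncation vanishes at `0` and has slope `(1 - s/R)₊²`, at most
one. -/
lemma truncSq_le {R : ℝ} (hR : 0 < R) (ω : Config n) : truncSq R ω ≤ sqNorm ω := by
  rw [truncSq_eq]
  set z := cutBase R (sqNorm ω) with hz
  have h0 : 0 ≤ z := cutBase_nonneg _ _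
  have h1 : 1 - sqNorm ω / R ≤ z := le_max_right _ _
  have h2 : sqNorm ω = R * (sqNorm ω / R) := by field_simp
  rw [h2]
  have h3 : R / 3 * (1 - z ^ 3) ≤ R * (1 - z) := by
    have : 0 ≤ R * ((1 - z) ^ 2 * (z + 2)) := by positivity
    nlinarith
  nlinarith

/-- By concavity the truncation lies above its chord on `[0, R]`, and its value at `R` is `R/3`. -/
lemma le_truncSq {R : ℝ} (hR : 0 < R) {ω : Config n} (hω : sqNorm ω ≤ R) :
    sqNorm ω ≤ 3 * truncSq R ω := by
  rw [truncSq_eq, cutBase_eq hR hω]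
  set s := sqNorm ω / R with hs
  have h2 : sqNorm ω = R * s := by rw [hs]; field_simp
  have h0 : 0 ≤ s := div_nonneg (sqNorm_nonneg ω) hR.le
  have h1 : s ≤ 1 := by rwa [hs, div_le_one hR]
  rw [h2]
  have : 0 ≤ R * ((1 - s) * (s * (2 - s))) := by
    have := sub_nonneg.2 h1
    have : 0 ≤ 2 - s := by linarith
    positivity
  nlinarith

/-- Lyapunov bound for the truncated energy. -/
theorem neg_generator_le_truncSq {γ γ' Tm Tp τ : ℝ} (hγ' : 0 ≤ γ') (hTm : 0 ≤ Tm) (hTp : 0 ≤ Tp)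
    {R : ℝ} (hR : 0 < R) (ω : Config n) :
    -(R / 3) * generator n γ γ' Tm Tp τ (cutTest 1 0 R) ω
      ≤ (n : ℝ) ^ 2 * (τ ^ 2 + 1 + 2 * γ' * (Tm + Tp)) * (1 + truncSq R ω) := by
  have hs := sqNorm_nonneg ω
  have hz0 : 0 ≤ cutBase R (sqNorm ω) := cutBase_nonneg _ _
  have hz1 : cutBase R (sqNorm ω) ≤ 1 := cutBase_le_one hR hs
  -- A concave function vanishing at `0` dominates its slope times its argument; the slope here is
  -- `cutBase ^ 2`.
  have key : cutBase R (sqNorm ω) ^ 2 * sqNorm ω ≤ truncSq R ω := by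
    rcases le_total R (sqNorm ω) with h | h
    · rw [cutBase_eq_zero hR h]
      simpa using truncSq_nonneg hR ω
    · rw [truncSq_eq]
      have e : sqNorm ω = R * (1 - cutBase R (sqNorm ω)) := by
        rw [cutBase_eq hR h]; field_simp; ring
      generalize cutBase R (sqNorm ω) = z at *
      rw [e]
      have : 0 ≤ R * ((1 - z) ^ 2 * (1 + 2 * z)) := by positivity
      nlinarith
  have hlin : linearGen γ γ' τ (0 : Config n →L[ℝ] ℝ) ω = 0 := by simp [linearGen]
  rw [generator_cutTest, hlin]
  simp only [_root_.zero_apply, add_zero, one_mul, mul_zero, zero_sub]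
  set z := cutBase R (sqNorm ω) with hz
  set h := truncSq R ω with hh
  have hl := sq_snd_le ω (Fin.last n)
  set pn := ω.2 (Fin.last n)
  set p0 := ω.2 0
  set H := sqNorm ω
  have e : -(R / 3) * (-(3 / R * z ^ 2 * (sqNormDrift γ' τ ω + 2 * (n : ℝ) ^ 2 * γ' * (Tm + Tp)))
        + 6 / R ^ 2 * z * (4 * (n : ℝ) ^ 2 * γ' * (Tm * p0 ^ 2 + Tp * pn ^ 2)))
      = z ^ 2 * (2 * (n : ℝ) ^ 2 * (τ * pn - γ' * (p0 ^ 2 + pn ^ 2))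
          + 2 * (n : ℝ) ^ 2 * γ' * (Tm + Tp))
        - 2 / R * z * (4 * (n : ℝ) ^ 2 * γ' * (Tm * p0 ^ 2 + Tp * pn ^ 2)) := by
    simp only [sqNormDrift]
    field_simp
    ring
  rw [e]
  -- The second derivative of the truncation contributes with a favourable sign, by concavity, and
  -- is dropped; so is the damping at the ends.
  have h1 : 0 ≤ 2 / R * z * (4 * (n : ℝ) ^ 2 * γ' * (Tm * p0 ^ 2 + Tp * pn ^ 2)) := by positivity
  have h2 : 0 ≤ γ' * (p0 ^ 2 + pn ^ 2) := by positivity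
  have h3 : 2 * τ * pn ≤ τ ^ 2 + H := by nlinarith [sq_nonneg (τ - pn)]
  set K := 2 * γ' * (Tm + Tp) with hK
  have hK0 : 0 ≤ K := by positivity
  have hz2 : z ^ 2 ≤ 1 := pow_le_one₀ hz0 hz1
  calc _ ≤ z ^ 2 * ((n : ℝ) ^ 2 * ((τ ^ 2 + H) + K)) := by
        have : 2 * (n : ℝ) ^ 2 * (τ * pn - γ' * (p0 ^ 2 + pn ^ 2))
          + 2 * (n : ℝ) ^ 2 * γ' * (Tm + Tp) ≤ (n : ℝ) ^ 2 * ((τ ^ 2 + H) + K) := by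
          have : 2 * (n : ℝ) ^ 2 * (τ * pn - γ' * (p0 ^ 2 + pn ^ 2))
            + 2 * (n : ℝ) ^ 2 * γ' * (Tm + Tp)
            = (n : ℝ) ^ 2 * (2 * τ * pn - 2 * (γ' * (p0 ^ 2 + pn ^ 2)) + K) := by rw [hK]; ring
          rw [this]
          gcongr
          linarith
        have := mul_le_mul_of_nonneg_left this (sq_nonneg z)
        linarith
    _ = (n : ℝ) ^ 2 * (z ^ 2 * (τ ^ 2 + K) + z ^ 2 * H) := by ring
    _ ≤ (n : ℝ) ^ 2 * (1 * (τ ^ 2 + K) + h) := by gcongr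
    _ ≤ (n : ℝ) ^ 2 * ((τ ^ 2 + 1 + K) * (1 + h)) := by
        have hh0 : 0 ≤ h := truncSq_nonneg hR ω
        have : 1 * (τ ^ 2 + K) + h ≤ (τ ^ 2 + 1 + K) * (1 + h) := by nlinarith [sq_nonneg τ, mul_nonneg (add_nonneg (sq_nonneg τ) hK0) hh0]
        gcongr
    _ = _ := by ring

end Bounds

/-! ### Joint measurability of right-continuous processes -/

lemma measurable_comp_floor {Ω E T : Type*} [MeasurableSpace Ω] [MeasurableSpace E]
    [MeasurableSpace T] {X : T → Ω → E} (hm : ∀ t, Measurable (X t)) {f : T → ℕ}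
    (hf : Measurable f) (g : ℕ → T) : Measurable (fun z : T × Ω => X (g (f z.1)) z.2) := by
  have h1 : Measurable (fun z : ℕ × Ω => X (g z.1) z.2) :=
    measurable_from_prod_countable_right fun j => hm (g j)
  exact h1.comp ((hf.comp measurable_fst).prodMk measurable_snd)

/-- The path is sampled at the next grid point of mesh `1 / (k + 1)`. Each approximation involves
countably many times, and approach from the right is what right-continuity controls. -/
lemma measurable_uncurry_of_rightContinuous {Ω E : Type*} [MeasurableSpace Ω] [TopologicalSpace E]
    [TopologicalSpace.PseudoMetrizableSpace E] [MeasurableSpace E] [BorelSpace E]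
    {X : ℝ≥0 → Ω → E} (hm : ∀ t, Measurable (X t))
    (hc : ∀ ω t, ContinuousWithinAt (fun s => X s ω) (Set.Ici t) t) :
    Measurable (fun z : ℝ≥0 × Ω => X z.1 z.2) := by
  have happ : ∀ k : ℕ, Measurable (fun z : ℝ≥0 × Ω =>
      X (((⌊z.1 * (k + 1)⌋₊ : ℝ≥0) + 1) / (k + 1)) z.2) := by
    intro k
    exact measurable_comp_floor hm (Nat.measurable_floor.comp (measurable_id.mul_const _))
      (fun j => ((j : ℝ≥0) + 1) / (k + 1))
  refine measurable_of_tendsto_metrizable happ ?_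
  rw [tendsto_pi_nhds]
  rintro ⟨t, ω⟩
  have hle : ∀ k : ℕ, t ≤ ((⌊t * (k + 1)⌋₊ : ℝ≥0) + 1) / (k + 1) := fun k => by
    rw [le_div_iff₀ (by positivity)]
    exact (Nat.lt_floor_add_one _).le
  have hge : ∀ k : ℕ, ((⌊t * (k + 1)⌋₊ : ℝ≥0) + 1) / (k + 1) ≤ t + 1 / ((k : ℝ≥0) + 1) := fun k => by
    rw [div_le_iff₀ (by positivity), add_mul, one_div, inv_mul_cancel₀ (by positivity)]
    gcongr
    exact Nat.floor_le (by positivity)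
  have hlim : Tendsto (fun k : ℕ => ((⌊t * (k + 1)⌋₊ : ℝ≥0) + 1) / ((k : ℝ≥0) + 1)) atTop (𝓝 t) := by
    refine tendsto_of_tendsto_of_tendsto_of_le_of_le tendsto_const_nhds ?_ hle hge
    simpa using (tendsto_one_div_add_atTop_nhds_zero_nat (𝕜 := ℝ≥0)).const_add t
  exact (hc ω t).tendsto.comp (tendsto_nhdsWithin_iff.2 ⟨hlim, Eventually.of_forall hle⟩)

/-- Grönwall's argument: one plus the right side of the hypothesis, times `exp (-c t)`, is
nonincreasing. -/
lemma one_add_le_exp_of_integral_le {Φ : ℝ → ℝ} {A c : ℝ} (hc : 0 ≤ c) (hΦ : Continuous Φ)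
    (h : ∀ t, 0 ≤ t → Φ t ≤ A + ∫ s in (0 : ℝ)..t, c * (1 + Φ s)) {t : ℝ} (ht : 0 ≤ t) :
    Φ t ≤ (1 + A) * Real.exp (c * t) := by
  set Ψ : ℝ → ℝ := fun t => (1 + (A + ∫ s in (0 : ℝ)..t, c * (1 + Φ s))) * Real.exp (-(c * t))
    with hΨ
  have hcont : Continuous fun s => c * (1 + Φ s) := by fun_prop
  have hd : ∀ u, HasDerivAt Ψ
      ((c * (1 + Φ u)) * Real.exp (-(c * u))
        + (1 + (A + ∫ s in (0 : ℝ)..u, c * (1 + Φ s))) * (Real.exp (-(c * u)) * -c)) u := by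
    intro u
    have h1 : HasDerivAt (fun u => ∫ s in (0 : ℝ)..u, c * (1 + Φ s)) (c * (1 + Φ u)) u :=
      intervalIntegral.integral_hasDerivAt_right (hcont.intervalIntegrable _ _)
        (hcont.stronglyMeasurableAtFilter _ _) hcont.continuousAt
    have h2 : HasDerivAt (fun u : ℝ => Real.exp (-(c * u))) (Real.exp (-(c * u)) * -c) u := by
      have := ((hasDerivAt_id u).const_mul c).neg.exp
      simpa using this
    exact ((h1.const_add A).const_add 1).mul h2
  have hanti : AntitoneOn Ψ (Set.Ici 0) := by
    refine antitoneOn_of_deriv_nonpos (convex_Ici 0)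
      (fun u _ => (hd u).continuousAt.continuousWithinAt)
      (fun u _ => (hd u).differentiableAt.differentiableWithinAt) ?_
    intro u hu
    rw [interior_Ici] at hu
    rw [(hd u).deriv]
    have h1 := h u (le_of_lt hu)
    have h2 := Real.exp_pos (-(c * u))
    have : c * Real.exp (-(c * u)) * (Φ u - (A + ∫ s in (0 : ℝ)..u, c * (1 + Φ s))) ≤ 0 :=
      mul_nonpos_of_nonneg_of_nonpos (by positivity) (by linarith)
    linarith
  have h0 := hanti (Set.mem_Ici.2 le_rfl) ht ht
  simp only [hΨ, intervalIntegral.integral_same, mul_zero, neg_zero, Real.exp_zero, mul_one,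
    add_zero] at h0
  rw [Real.exp_neg, ← div_eq_mul_inv, div_le_iff₀ (Real.exp_pos _)] at h0
  linarith [h t ht]

/-! ### Moments of the chain -/

section Moments

variable {Ω : Type*} {m : MeasurableSpace Ω} {P : Measure Ω} {ℱ : Filtration ℝ≥0 m} {n : ℕ}
  {γ γ' Tm Tp τ : ℝ} {X : ℝ≥0 → Ω → Config n}

lemma IsChainDynamics.measurable_apply (hX : IsChainDynamics P ℱ n γ γ' Tm Tp τ X) (t : ℝ≥0) :
    Measurable (X t) := ((hX.adapted t).mono (ℱ.le t)).measurable

lemma IsChainDynamics.measurable_uncurry (hX : IsChainDynamics P ℱ n γ γ' Tm Tp τ X) :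
    Measurable (fun z : ℝ × Ω => X z.1.toNNReal z.2) :=
  (measurable_uncurry_of_rightContinuous hX.measurable_apply fun ω t => (hX.cadlag ω t).1).comp
    ((measurable_real_toNNReal.comp measurable_fst).prodMk measurable_snd)

lemma IsChainDynamics.stronglyMeasurable_mean [SFinite P]
    (hX : IsChainDynamics P ℱ n γ γ' Tm Tp τ X) {f : Config n → ℝ} (hf : Continuous f) :
    StronglyMeasurable (fun s : ℝ => ∫ ω, f (X s.toNNReal ω) ∂P) :=
  StronglyMeasurable.integral_prod_right' (f := fun z : ℝ × Ω => f (X z.1.toNNReal z.2))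
    (hf.measurable.comp hX.measurable_uncurry).stronglyMeasurable

lemma IsChainDynamics.integrable_of_bound [IsFiniteMeasure P]
    (hX : IsChainDynamics P ℱ n γ γ' Tm Tp τ X) {f : Config n → ℝ} (hf : Continuous f) {C : ℝ}
    (hC : ∀ ω, |f ω| ≤ C) (t : ℝ≥0) : Integrable (fun ω => f (X t ω)) P :=
  Integrable.of_bound (hf.measurable.comp (hX.measurable_apply t)).aestronglyMeasurable C
    (Eventually.of_forall fun _ => hC _)

lemma intervalIntegrable_of_abs_le {f g : ℝ → ℝ} (hf : StronglyMeasurable f) (hg : Continuous g)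
    (h : ∀ s, |f s| ≤ g s) (a b : ℝ) : IntervalIntegrable f volume a b :=
  (hg.intervalIntegrable a b).mono_fun' hf.aestronglyMeasurable
    (Eventually.of_forall fun s => h s)

lemma IsChainDynamics.abs_mean_le [IsProbabilityMeasure P] {f : Config n → ℝ} {C : ℝ}
    (hC : ∀ ω, |f ω| ≤ C) (t : ℝ≥0) : |∫ ω, f (X t ω) ∂P| ≤ C := by
  have := norm_integral_le_of_norm_le_const (μ := P) (f := fun ω => f (X t ω))
    (Eventually.of_forall fun ω => hC (X t ω))
  simpa using this

/-- Dynkin's formula for the cut-off linear functions. -/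
theorem IsChainDynamics.dynkin [IsProbabilityMeasure P]
    (hX : IsChainDynamics P ℱ n γ γ' Tm Tp τ X) (a : ℝ) (ℓ : Config n →L[ℝ] ℝ) {R : ℝ}
    (hR : 1 ≤ R) {t : ℝ} (ht : 0 ≤ t) :
    ∫ ω, cutTest a ℓ R (X t.toNNReal ω) ∂P = ∫ ω, cutTest a ℓ R (X 0 ω) ∂P
      + ∫ s in (0 : ℝ)..t, ∫ ω, generator n γ γ' Tm Tp τ (cutTest a ℓ R) (X s.toNNReal ω) ∂P := by
  have hR0 : 0 < R := by linarith
  have hM := hX.martingale _ (contDiff_cutTest a ℓ R) (hasCompactSupport_cutTest a ℓ hR0)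
  obtain ⟨C, hC⟩ := exists_const_bound_generator_cutTest γ γ' Tm Tp τ a ℓ hR
  obtain ⟨C', hC'⟩ := exists_const_bound_cutTest a ℓ hR0
  have hFi := fun t => hX.integrable_of_bound (contDiff_cutTest a ℓ R).continuous hC' t
  have hfin : IsFiniteMeasure (volume.restrict (Set.uIoc 0 t)) := by
    rw [Set.uIoc_of_le ht]
    infer_instance
  have hprod : Integrable (Function.uncurry fun (s : ℝ) (ω : Ω) =>
      generator n γ γ' Tm Tp τ (cutTest a ℓ R) (X s.toNNReal ω))
      ((volume.restrict (Set.uIoc 0 t)).prod P) := by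
    refine Integrable.of_bound (C := C) ?_ (Eventually.of_forall fun z => hC _)
    exact ((continuous_generator_cutTest γ γ' Tm Tp τ a ℓ R).measurable.comp
      hX.measurable_uncurry).aestronglyMeasurable
  have hswap := intervalIntegral_integral_swap hprod
  -- A martingale has constant mean, and this one starts from zero.
  have h1 := hM.setIntegral_eq (zero_le (a := t.toNNReal)) MeasurableSet.univ
  simp only [Measure.restrict_univ, Real.coe_toNNReal t ht] at h1
  simp only [NNReal.coe_zero, intervalIntegral.integral_same, sub_self, integral_zero] at h1
  have hI : Integrable (fun ω => ∫ s in (0 : ℝ)..t,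
      generator n γ γ' Tm Tp τ (cutTest a ℓ R) (X s.toNNReal ω)) P := by
    simp only [intervalIntegral.integral_of_le ht]
    rw [Set.uIoc_of_le ht] at hprod
    exact hprod.integral_prod_right
  have hD : Integrable (fun ω => cutTest a ℓ R (X t.toNNReal ω) - cutTest a ℓ R (X 0 ω)) P :=
    (hFi _).sub (hFi _)
  rw [integral_sub hD hI, integral_sub (hFi _) (hFi _)] at h1
  rw [hswap]
  linarith

/-- The mean truncated energy grows at most exponentially, uniformly in the truncation. -/
theorem IsChainDynamics.mean_truncSq_le [IsProbabilityMeasure P]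
    (hX : IsChainDynamics P ℱ n γ γ' Tm Tp τ X) (hγ' : 0 ≤ γ') (hTm : 0 ≤ Tm) (hTp : 0 ≤ Tp)
    (h0 : Integrable (fun ω => sqNorm (X 0 ω)) P) {R : ℝ} (hR : 1 ≤ R) {t : ℝ} (ht : 0 ≤ t) :
    ∫ ω, truncSq R (X t.toNNReal ω) ∂P ≤ (1 + ∫ ω, sqNorm (X 0 ω) ∂P)
      * Real.exp ((n : ℝ) ^ 2 * (τ ^ 2 + 1 + 2 * γ' * (Tm + Tp)) * t) := by
  have hR0 : 0 < R := by linarith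
  set c := (n : ℝ) ^ 2 * (τ ^ 2 + 1 + 2 * γ' * (Tm + Tp)) with hc
  have hc0 : 0 ≤ c := by positivity
  obtain ⟨C, hC⟩ := exists_const_bound_generator_cutTest γ γ' Tm Tp τ 1 (0 : Config n →L[ℝ] ℝ) hR
  obtain ⟨C', hC'⟩ := exists_const_bound_cutTest 1 (0 : Config n →L[ℝ] ℝ) hR0
  have hcF := (contDiff_cutTest 1 (0 : Config n →L[ℝ] ℝ) R).continuous
  have hcL := continuous_generator_cutTest γ γ' Tm Tp τ 1 (0 : Config n →L[ℝ] ℝ) R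
  have hFi := fun t => hX.integrable_of_bound hcF hC' t
  have hLi := fun t => hX.integrable_of_bound hcL hC t
  have hTi : ∀ t, Integrable (fun ω => truncSq R (X t ω)) P := fun t =>
    ((integrable_const 1).sub (hFi t)).const_mul (R / 3)
  have hmean : ∀ t, ∫ ω, truncSq R (X t ω) ∂P
      = R / 3 * (1 - ∫ ω, cutTest 1 (0 : Config n →L[ℝ] ℝ) R (X t ω) ∂P) := fun t => by
    simp only [truncSq]
    rw [integral_const_mul, integral_sub (integrable_const 1) (hFi t)]
    simp
  have hgi : ∀ a b, IntervalIntegrable (fun s : ℝ => ∫ ω, generator n γ γ' Tm Tp τ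
      (cutTest 1 (0 : Config n →L[ℝ] ℝ) R) (X s.toNNReal ω) ∂P) volume a b := fun a b =>
    intervalIntegrable_of_abs_le (hX.stronglyMeasurable_mean hcL) (continuous_const (y := C))
      (fun s => IsChainDynamics.abs_mean_le hC _) a b
  set A := ∫ ω, truncSq R (X 0 ω) ∂P with hA
  -- By Dynkin's formula this is the mean truncated energy for `t ≥ 0`. Written as a primitive it is
  -- continuous on the whole line, as the Grönwall lemma demands.
  set Φ : ℝ → ℝ := fun t => A - R / 3 * ∫ s in (0 : ℝ)..t, ∫ ω, generator n γ γ' Tm Tp τ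
      (cutTest 1 (0 : Config n →L[ℝ] ℝ) R) (X s.toNNReal ω) ∂P with hΦ
  have hΦc : Continuous Φ :=
    continuous_const.sub (continuous_const.mul (intervalIntegral.continuous_primitive hgi 0))
  have hΦeq : ∀ t, 0 ≤ t → ∫ ω, truncSq R (X t.toNNReal ω) ∂P = Φ t := fun t ht => by
    simp only [hΦ]
    rw [hA, hmean, hmean, hX.dynkin 1 0 hR ht]
    ring
  have hgron : ∀ t, 0 ≤ t → Φ t ≤ A + ∫ s in (0 : ℝ)..t, c * (1 + Φ s) := by
    intro t ht
    have hint : ∫ s in (0 : ℝ)..t, -(R / 3) * ∫ ω, generator n γ γ' Tm Tp τ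
        (cutTest 1 (0 : Config n →L[ℝ] ℝ) R) (X s.toNNReal ω) ∂P
        ≤ ∫ s in (0 : ℝ)..t, c * (1 + Φ s) := by
      refine intervalIntegral.integral_mono_on ht ((hgi 0 t).const_mul _)
        (Continuous.intervalIntegrable (by fun_prop) _ _) ?_
      intro s hs
      rw [← hΦeq s hs.1, ← integral_const_mul]
      have : c * (1 + ∫ ω, truncSq R (X s.toNNReal ω) ∂P)
          = ∫ ω, c * (1 + truncSq R (X s.toNNReal ω)) ∂P := by
        rw [integral_const_mul, integral_add (integrable_const 1) (hTi _)]
        simp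
      rw [this]
      refine integral_mono ((hLi _).const_mul _)
        (((integrable_const 1).add (hTi _)).const_mul c) fun ω => ?_
      exact neg_generator_le_truncSq hγ' hTm hTp hR0 _
    rw [intervalIntegral.integral_const_mul] at hint
    simp only [hΦ]
    simp only [hΦ] at hint
    linarith
  rw [hΦeq t ht]
  refine (one_add_le_exp_of_integral_le hc0 hΦc hgron ht).trans ?_
  gcongr
  exact integral_mono (hTi 0) h0 fun ω => truncSq_le hR0 _

/-- The mean energy grows at most exponentially. -/
theorem IsChainDynamics.integrable_sqNorm [IsProbabilityMeasure P]
    (hX : IsChainDynamics P ℱ n γ γ' Tm Tp τ X) (hγ' : 0 ≤ γ') (hTm : 0 ≤ Tm) (hTp : 0 ≤ Tp)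
    (h0 : Integrable (fun ω => sqNorm (X 0 ω)) P) {t : ℝ} (ht : 0 ≤ t) :
    Integrable (fun ω => sqNorm (X t.toNNReal ω)) P ∧
      ∫ ω, sqNorm (X t.toNNReal ω) ∂P ≤ 3 * ((1 + ∫ ω, sqNorm (X 0 ω) ∂P)
        * Real.exp ((n : ℝ) ^ 2 * (τ ^ 2 + 1 + 2 * γ' * (Tm + Tp)) * t)) := by
  set B := (1 + ∫ ω, sqNorm (X 0 ω) ∂P)
        * Real.exp ((n : ℝ) ^ 2 * (τ ^ 2 + 1 + 2 * γ' * (Tm + Tp)) * t) with hB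
  have hB0 : 0 ≤ B := by
    have : 0 ≤ ∫ ω, sqNorm (X 0 ω) ∂P := integral_nonneg fun _ => sqNorm_nonneg _
    positivity
  have hmeas : Measurable fun ω => sqNorm (X t.toNNReal ω) :=
    continuous_sqNorm.measurable.comp (hX.measurable_apply _)
  -- Fatou's lemma along `R = k + 1`: as soon as `R` exceeds `|X_t|²`, the factor 3 makes the
  -- truncation dominate it.
  set f : ℕ → Ω → ℝ≥0∞ := fun k ω =>
    ENNReal.ofReal (3 * truncSq ((k : ℝ) + 1) (X t.toNNReal ω)) with hf
  have hcF : ∀ k : ℕ, Continuous (truncSq (n := n) ((k : ℝ) + 1)) := fun k =>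
    continuous_const.mul (continuous_const.sub (contDiff_cutTest 1 0 _).continuous)
  have hfm : ∀ k, Measurable (f k) := fun k =>
    ENNReal.measurable_ofReal.comp
      (((hcF k).measurable.comp (hX.measurable_apply _)).const_mul 3)
  have hTi : ∀ k : ℕ, Integrable (fun ω => truncSq ((k : ℝ) + 1) (X t.toNNReal ω)) P := fun k => by
    obtain ⟨C', hC'⟩ := exists_const_bound_cutTest 1 (0 : Config n →L[ℝ] ℝ)
      (by positivity : (0 : ℝ) < (k : ℝ) + 1)
    exact ((integrable_const 1).sub (hX.integrable_of_bound (contDiff_cutTest 1 0 _).continuous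
      hC' _)).const_mul _
  have hfi : ∀ k, ∫⁻ ω, f k ω ∂P ≤ ENNReal.ofReal (3 * B) := by
    intro k
    rw [hf, ← ofReal_integral_eq_lintegral_ofReal ((hTi k).const_mul 3)
      (Eventually.of_forall fun ω => mul_nonneg (by norm_num) (truncSq_nonneg (by positivity) _)),
      integral_const_mul]
    refine ENNReal.ofReal_le_ofReal ?_
    gcongr
    exact hX.mean_truncSq_le hγ' hTm hTp h0 (by simp) ht
  have hle : ∀ ω, ENNReal.ofReal (sqNorm (X t.toNNReal ω)) ≤ liminf (fun k => f k ω) atTop := by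
    intro ω
    refine le_liminf_of_le (by isBoundedDefault) ?_
    obtain ⟨K, hK⟩ := exists_nat_ge (sqNorm (X t.toNNReal ω))
    filter_upwards [eventually_ge_atTop K] with k hk
    refine ENNReal.ofReal_le_ofReal (le_truncSq (by positivity) ?_)
    have : (K : ℝ) ≤ k := by exact_mod_cast hk
    linarith
  have hlint : ∫⁻ ω, ENNReal.ofReal (sqNorm (X t.toNNReal ω)) ∂P ≤ ENNReal.ofReal (3 * B) := by
    refine (lintegral_mono hle).trans ((lintegral_liminf_le hfm).trans ?_)
    exact liminf_le_of_le (by isBoundedDefault) fun b hb => by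
      obtain ⟨k, hk⟩ := hb.exists
      exact hk.trans (hfi k)
  have hint : Integrable (fun ω => sqNorm (X t.toNNReal ω)) P :=
    ⟨hmeas.aestronglyMeasurable, (hasFiniteIntegral_iff_ofReal
      (Eventually.of_forall fun _ => sqNorm_nonneg _)).2 (hlint.trans_lt ENNReal.ofReal_lt_top)⟩
  refine ⟨hint, ?_⟩
  rw [← ofReal_integral_eq_lintegral_ofReal hint
    (Eventually.of_forall fun _ => sqNorm_nonneg _)] at hlint
  exact (ENNReal.ofReal_le_ofReal_iff (by positivity)).1 hlint

end Moments

/-! ### The evolution of the means -/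

section Means

variable {Ω : Type*} {m : MeasurableSpace Ω} {P : Measure Ω} {ℱ : Filtration ℝ≥0 m} {n : ℕ}
  {γ γ' Tm Tp τ : ℝ} {X : ℝ≥0 → Ω → Config n}

/-- The mean configuration at the real time `s` (at time `0` for negative `s`). -/
noncomputable def meanConfig (P : Measure Ω) (X : ℝ≥0 → Ω → Config n) (s : ℝ) : Config n :=
  ∫ ω, X s.toNNReal ω ∂P

lemma IsChainDynamics.integrable_config [IsProbabilityMeasure P]
    (hX : IsChainDynamics P ℱ n γ γ' Tm Tp τ X) {t : ℝ≥0}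
    (h : Integrable (fun ω => sqNorm (X t ω)) P) : Integrable (X t) P :=
  ((integrable_const 1).add h).mono' (hX.measurable_apply t).aestronglyMeasurable
    (Eventually.of_forall fun _ => norm_le_one_add_sqNorm _)

lemma clm_meanConfig (ℓ : Config n →L[ℝ] ℝ) {s : ℝ} (h : Integrable (X s.toNNReal) P) :
    ℓ (meanConfig P X s) = ∫ ω, ℓ (X s.toNNReal ω) ∂P :=
  (ℓ.integral_comp_comm h).symm

lemma linearGen_meanConfig [IsProbabilityMeasure P] (γ γ' τ : ℝ) (ℓ : Config n →L[ℝ] ℝ) {s : ℝ}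
    (h : Integrable (X s.toNNReal) P) :
    linearGen γ γ' τ ℓ (meanConfig P X s) = ∫ ω, linearGen γ γ' τ ℓ (X s.toNNReal ω) ∂P := by
  simp only [linearGen_eq]
  rw [integral_add (integrable_const _) ((linearGenCLM γ γ' ℓ).integrable_comp h), clm_meanConfig _ h]
  simp

lemma abs_integral_le_of_abs_le [IsProbabilityMeasure P] {f : Config n → ℝ} {C B : ℝ} (hC : 0 ≤ C)
    (hf : ∀ ω, |f ω| ≤ C * (1 + sqNorm ω)) {t : ℝ≥0}
    (h : Integrable (fun ω => sqNorm (X t ω)) P) (hB : ∫ ω, sqNorm (X t ω) ∂P ≤ B) :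
    |∫ ω, f (X t ω) ∂P| ≤ C * (1 + B) := by
  have h1 : Integrable (fun ω => C * (1 + sqNorm (X t ω))) P :=
    ((integrable_const 1).add h).const_mul C
  have h2 : ‖∫ ω, f (X t ω) ∂P‖ ≤ ∫ ω, C * (1 + sqNorm (X t ω)) ∂P :=
    norm_integral_le_of_norm_le h1 (Eventually.of_forall fun ω => hf _)
  rw [integral_const_mul, integral_add (integrable_const 1) h] at h2
  simp only [integral_const, probReal_univ, smul_eq_mul, mul_one] at h2
  refine h2.trans ?_
  gcongr

/-- The integrated evolution equation of the mean of a linear function. -/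
theorem IsChainDynamics.mean_linear [IsProbabilityMeasure P]
    (hX : IsChainDynamics P ℱ n γ γ' Tm Tp τ X) (hγ' : 0 ≤ γ') (hTm : 0 ≤ Tm) (hTp : 0 ≤ Tp)
    (h0 : Integrable (fun ω => sqNorm (X 0 ω)) P) (ℓ : Config n →L[ℝ] ℝ) {t : ℝ} (ht : 0 ≤ t) :
    ∫ ω, ℓ (X t.toNNReal ω) ∂P = ∫ ω, ℓ (X 0 ω) ∂P
      + ∫ s in (0 : ℝ)..t, ∫ ω, linearGen γ γ' τ ℓ (X s.toNNReal ω) ∂P := by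
  have hsq := fun {t : ℝ} (ht : 0 ≤ t) => hX.integrable_sqNorm hγ' hTm hTp h0 ht
  obtain ⟨C, hC0, hC⟩ := exists_bound_generator_cutTest γ γ' Tm Tp τ 0 ℓ
  have hmeas : ∀ {f : Config n → ℝ} (_ : Continuous f) (t : ℝ≥0),
      AEStronglyMeasurable (fun ω => f (X t ω)) P := fun hf t =>
    (hf.measurable.comp (hX.measurable_apply t)).aestronglyMeasurable
  have hlimF : ∀ t : ℝ, 0 ≤ t → Tendsto (fun R => ∫ ω, cutTest 0 ℓ R (X t.toNNReal ω) ∂P) atTop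
      (𝓝 (∫ ω, ℓ (X t.toNNReal ω) ∂P)) := by
    intro t ht
    refine tendsto_integral_filter_of_dominated_convergence
      (fun ω => ‖ℓ‖ * (1 + sqNorm (X t.toNNReal ω)))
      (Eventually.of_forall fun R => hmeas (contDiff_cutTest 0 ℓ R).continuous _) ?_
      (((integrable_const 1).add (hsq ht).1).const_mul _)
      (Eventually.of_forall fun ω => tendsto_cutTest ℓ _)
    filter_upwards [eventually_gt_atTop 0] with R hR
    exact Eventually.of_forall fun ω => (abs_cutTest_le ℓ hR _).trans (norm_clm_le ℓ _)
  have hlimL : ∀ t : ℝ, 0 ≤ t → Tendsto (fun R => ∫ ω, generator n γ γ' Tm Tp τ (cutTest 0 ℓ R)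
      (X t.toNNReal ω) ∂P) atTop (𝓝 (∫ ω, linearGen γ γ' τ ℓ (X t.toNNReal ω) ∂P)) := by
    intro t ht
    refine tendsto_integral_filter_of_dominated_convergence
      (fun ω => C * (1 + sqNorm (X t.toNNReal ω)))
      (Eventually.of_forall fun R => hmeas (continuous_generator_cutTest _ _ _ _ _ _ ℓ R) _) ?_
      (((integrable_const 1).add (hsq ht).1).const_mul _)
      (Eventually.of_forall fun ω => tendsto_generator_cutTest _ _ _ _ _ ℓ _)
    filter_upwards [eventually_ge_atTop 1] with R hR
    exact Eventually.of_forall fun ω => hC R hR _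
  -- The exponential bound on the mean energy dominates the integrand in time, uniformly in `R`.
  have hlimI : Tendsto (fun R => ∫ s in (0 : ℝ)..t, ∫ ω, generator n γ γ' Tm Tp τ (cutTest 0 ℓ R)
      (X s.toNNReal ω) ∂P) atTop
      (𝓝 (∫ s in (0 : ℝ)..t, ∫ ω, linearGen γ γ' τ ℓ (X s.toNNReal ω) ∂P)) := by
    refine intervalIntegral.tendsto_integral_filter_of_dominated_convergence
      (fun s => C * (1 + 3 * ((1 + ∫ ω, sqNorm (X 0 ω) ∂P)
        * Real.exp ((n : ℝ) ^ 2 * (τ ^ 2 + 1 + 2 * γ' * (Tm + Tp)) * s))))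
      (Eventually.of_forall fun R => (hX.stronglyMeasurable_mean
        (continuous_generator_cutTest _ _ _ _ _ _ ℓ R)).aestronglyMeasurable) ?_
      (Continuous.intervalIntegrable (by fun_prop) _ _) ?_
    · filter_upwards [eventually_ge_atTop 1] with R hR
      refine Eventually.of_forall fun s hs => ?_
      rw [Set.uIoc_of_le ht] at hs
      exact abs_integral_le_of_abs_le hC0 (hC R hR) (hsq hs.1.le).1 (hsq hs.1.le).2
    · refine Eventually.of_forall fun s hs => ?_
      rw [Set.uIoc_of_le ht] at hs
      exact hlimL s hs.1.le
  refine tendsto_nhds_unique (hlimF t ht) ?_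
  have h00 := hlimF 0 le_rfl
  simp only [Real.toNNReal_zero] at h00
  refine (h00.add hlimI).congr' ?_
  filter_upwards [eventually_ge_atTop 1] with R hR
  exact (hX.dynkin 0 ℓ hR ht).symm

lemma IsChainDynamics.intervalIntegrable_mean_linearGen [IsProbabilityMeasure P]
    (hX : IsChainDynamics P ℱ n γ γ' Tm Tp τ X) (hγ' : 0 ≤ γ') (hTm : 0 ≤ Tm) (hTp : 0 ≤ Tp)
    (h0 : Integrable (fun ω => sqNorm (X 0 ω)) P) (ℓ : Config n →L[ℝ] ℝ) (a b : ℝ) :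
    IntervalIntegrable (fun s : ℝ => ∫ ω, linearGen γ γ' τ ℓ (X s.toNNReal ω) ∂P) volume a b := by
  obtain ⟨C, hC0, hC⟩ := exists_bound_linearGen (n := n) γ γ' τ ℓ
  refine intervalIntegrable_of_abs_le (hX.stronglyMeasurable_mean (continuous_linearGen _ _ _ ℓ))
    (g := fun s => C * (1 + 3 * ((1 + ∫ ω, sqNorm (X 0 ω) ∂P)
        * Real.exp ((n : ℝ) ^ 2 * (τ ^ 2 + 1 + 2 * γ' * (Tm + Tp)) * max s 0))))
    (by fun_prop) (fun s => ?_) a b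
  -- For negative `s` the process is frozen at time `0`, hence `max s 0`.
  have hs := hX.integrable_sqNorm hγ' hTm hTp h0 (le_max_right s 0)
  have e : (max s 0).toNNReal = s.toNNReal := by
    rcases le_total s 0 with h | h
    · simp [h, Real.toNNReal_of_nonpos h]
    · simp [h]
  rw [e] at hs
  exact abs_integral_le_of_abs_le hC0 hC hs.1 hs.2

theorem IsChainDynamics.clm_meanConfig_eq [IsProbabilityMeasure P]
    (hX : IsChainDynamics P ℱ n γ γ' Tm Tp τ X) (hγ' : 0 ≤ γ') (hTm : 0 ≤ Tm) (hTp : 0 ≤ Tp)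
    (h0 : Integrable (fun ω => sqNorm (X 0 ω)) P) (ℓ : Config n →L[ℝ] ℝ) {t : ℝ} (ht : 0 ≤ t) :
    ℓ (meanConfig P X t) = ℓ (meanConfig P X 0)
      + ∫ s in (0 : ℝ)..t, ∫ ω, linearGen γ γ' τ ℓ (X s.toNNReal ω) ∂P := by
  have hi := fun {t : ℝ} (ht : 0 ≤ t) =>
    hX.integrable_config (hX.integrable_sqNorm hγ' hTm hTp h0 ht).1
  rw [clm_meanConfig ℓ (hi ht), clm_meanConfig ℓ (hi le_rfl), hX.mean_linear hγ' hTm hTp h0 ℓ ht]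
  simp

theorem IsChainDynamics.continuousOn_clm_meanConfig [IsProbabilityMeasure P]
    (hX : IsChainDynamics P ℱ n γ γ' Tm Tp τ X) (hγ' : 0 ≤ γ') (hTm : 0 ≤ Tm) (hTp : 0 ≤ Tp)
    (h0 : Integrable (fun ω => sqNorm (X 0 ω)) P) (ℓ : Config n →L[ℝ] ℝ) :
    ContinuousOn (fun s => ℓ (meanConfig P X s)) (Set.Ici 0) := by
  refine ContinuousOn.congr (Continuous.continuousOn ?_)
    (fun t ht => hX.clm_meanConfig_eq hγ' hTm hTp h0 ℓ ht)
  exact continuous_const.add (intervalIntegral.continuous_primitive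
    (hX.intervalIntegrable_mean_linearGen hγ' hTm hTp h0 ℓ) 0)

/-- The means of linear functions solve the linear evolution equation of the chain. -/
theorem IsChainDynamics.hasDerivAt_clm_meanConfig [IsProbabilityMeasure P]
    (hX : IsChainDynamics P ℱ n γ γ' Tm Tp τ X) (hγ' : 0 ≤ γ') (hTm : 0 ≤ Tm) (hTp : 0 ≤ Tp)
    (h0 : Integrable (fun ω => sqNorm (X 0 ω)) P) (ℓ : Config n →L[ℝ] ℝ) {t : ℝ} (ht : 0 < t) :
    HasDerivAt (fun s => ℓ (meanConfig P X s)) (linearGen γ γ' τ ℓ (meanConfig P X t)) t := by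
  have hi := fun {t : ℝ} (ht : 0 ≤ t) =>
    hX.integrable_config (hX.integrable_sqNorm hγ' hTm hTp h0 ht).1
  have hint := hX.intervalIntegrable_mean_linearGen hγ' hTm hTp h0 ℓ
  -- The generator maps a linear function to an affine one, so the integrand is again the mean of a
  -- linear function plus a constant. It is therefore continuous, and the fundamental theorem of
  -- calculus applies.
  have hcont : ContinuousAt (fun s : ℝ => ∫ ω, linearGen γ γ' τ ℓ (X s.toNNReal ω) ∂P) t := by
    have h1 := (hX.continuousOn_clm_meanConfig hγ' hTm hTp h0 (linearGenCLM γ γ' ℓ)).continuousAt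
      (Ici_mem_nhds ht)
    refine (h1.const_add ((n : ℝ) ^ 2 * τ * ℓ (0, Pi.single (Fin.last n) 1))).congr ?_
    filter_upwards [Ioi_mem_nhds ht] with s hs
    rw [← linearGen_meanConfig γ γ' τ ℓ (hi (le_of_lt hs)), linearGen_eq]
  have hd := intervalIntegral.integral_hasDerivAt_right (hint 0 t)
    ((hX.stronglyMeasurable_mean (continuous_linearGen γ γ' τ ℓ)).stronglyMeasurableAtFilter)
    hcont
  rw [linearGen_meanConfig γ γ' τ ℓ (hi ht.le)]
  refine (hd.const_add (ℓ (meanConfig P X 0))).congr_of_eventuallyEq ?_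
  filter_upwards [Ioi_mem_nhds ht] with s hs
  exact hX.clm_meanConfig_eq hγ' hTm hTp h0 ℓ (le_of_lt hs)

end Means

/-! ### Decay estimates for damped linear waves -/

section DampedWave

variable {E F : Type*} [NormedAddCommGroup E] [InnerProductSpace ℝ E]
  [NormedAddCommGroup F] [InnerProductSpace ℝ F]

/-- `(q, p)` solves `q' = D p`, `p' = f - D* q - Γ p` on `(0, ∞)`, with `Γ` symmetric and
`δ ≤ Γ ≤ M`. -/
structure IsDampedWave (D : F →L[ℝ] E) (Ds : E →L[ℝ] F) (Γ : F →L[ℝ] F) (δ M : ℝ) (f : F)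
    (q : ℝ → E) (p : ℝ → F) : Prop where
  adjoint : ∀ x y, inner ℝ (Ds x) y = inner ℝ x (D y)
  symm : ∀ x y, inner ℝ (Γ x) y = inner ℝ x (Γ y)
  pos : 0 < δ
  lower : ∀ x, δ * ‖x‖ ^ 2 ≤ inner ℝ (Γ x) x
  upper : ∀ x, inner ℝ (Γ x) x ≤ M * ‖x‖ ^ 2
  upper_nonneg : 0 ≤ M
  cont_q : ContinuousOn q (Set.Ici 0)
  cont_p : ContinuousOn p (Set.Ici 0)
  deriv_q : ∀ s, 0 < s → HasDerivAt q (D (p s)) s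
  deriv_p : ∀ s, 0 < s → HasDerivAt p (f - Ds (q s) - Γ (p s)) s

variable {D : F →L[ℝ] E} {Ds : E →L[ℝ] F} {Γ : F →L[ℝ] F} {δ M : ℝ} {f : F}
  {q : ℝ → E} {p : ℝ → F}

/-- The energy of the time derivative. -/
noncomputable def derivEnergy (D : F →L[ℝ] E) (Ds : E →L[ℝ] F) (Γ : F →L[ℝ] F) (f : F)
    (q : ℝ → E) (p : ℝ → F) (s : ℝ) : ℝ :=
  ‖D (p s)‖ ^ 2 + ‖f - Ds (q s) - Γ (p s)‖ ^ 2

/-- The function whose time derivative is the difference of the two parts of `derivEnergy`. -/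
noncomputable def crossTerm (D : F →L[ℝ] E) (Γ : F →L[ℝ] F) (f : F)
    (q : ℝ → E) (p : ℝ → F) (s : ℝ) : ℝ :=
  inner ℝ (q s) (D (p s)) - inner ℝ f (p s) + 1 / 2 * inner ℝ (Γ (p s)) (p s)

lemma derivEnergy_nonneg (s : ℝ) : 0 ≤ derivEnergy D Ds Γ f q p s := by
  unfold derivEnergy
  positivity

namespace IsDampedWave

lemma continuousOn_derivEnergy (h : IsDampedWave D Ds Γ δ M f q p) :
    ContinuousOn (derivEnergy D Ds Γ f q p) (Set.Ici 0) := by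
  have h1 := h.cont_q
  have h2 := h.cont_p
  unfold derivEnergy
  fun_prop

lemma continuousOn_crossTerm (h : IsDampedWave D Ds Γ δ M f q p) :
    ContinuousOn (crossTerm D Γ f q p) (Set.Ici 0) := by
  have h1 := h.cont_q
  have h2 := h.cont_p
  unfold crossTerm
  fun_prop

/-- With `v = p'`, the terms in `f` and `Γ` complete `⟨q, D p⟩` so that `v` is paired with `D* q - f
+ Γ p`, which is `-v`. -/
lemma hasDerivAt_crossTerm (h : IsDampedWave D Ds Γ δ M f q p) {s : ℝ} (hs : 0 < s) :
    HasDerivAt (crossTerm D Γ f q p)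
      (‖D (p s)‖ ^ 2 - ‖f - Ds (q s) - Γ (p s)‖ ^ 2) s := by
  have hq := h.deriv_q s hs
  have hp := h.deriv_p s hs
  set v := f - Ds (q s) - Γ (p s) with hv
  have hD : HasDerivAt (fun s => D (p s)) (D v) s := D.hasFDerivAt.comp_hasDerivAt s hp
  have hΓ : HasDerivAt (fun s => Γ (p s)) (Γ v) s := Γ.hasFDerivAt.comp_hasDerivAt s hp
  have h1 := ((hq.inner ℝ hD).sub ((hasDerivAt_const s f).inner ℝ hp)).add
    ((hΓ.inner ℝ hp).const_mul (1 / 2))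
  refine h1.congr_deriv ?_
  have e1 : ‖v‖ ^ 2 = inner ℝ f v - inner ℝ (q s) (D v) - inner ℝ (Γ (p s)) v := by
    rw [← real_inner_self_eq_norm_sq]
    nth_rw 1 [hv]
    rw [inner_sub_left, inner_sub_left, h.adjoint]
  have e2 : inner ℝ (Γ v) (p s) = inner ℝ (Γ (p s)) v := by
    rw [h.symm, real_inner_comm]
  rw [e1, e2, inner_zero_left, real_inner_self_eq_norm_sq]
  ring

/-- The pair `(D p, p')` solves the same equation with the constant force removed, so its energy
changes only through the damping. -/
lemma hasDerivAt_derivEnergy (h : IsDampedWave D Ds Γ δ M f q p) {s : ℝ} (hs : 0 < s) :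
    HasDerivAt (derivEnergy D Ds Γ f q p)
      (-2 * inner ℝ (Γ (f - Ds (q s) - Γ (p s))) (f - Ds (q s) - Γ (p s))) s := by
  have hq := h.deriv_q s hs
  have hp := h.deriv_p s hs
  have hD : HasDerivAt (fun s => D (p s)) (D (f - Ds (q s) - Γ (p s))) s :=
    D.hasFDerivAt.comp_hasDerivAt s hp
  have hΓ : HasDerivAt (fun s => Γ (p s)) (Γ (f - Ds (q s) - Γ (p s))) s :=
    Γ.hasFDerivAt.comp_hasDerivAt s hp
  have hDs : HasDerivAt (fun s => Ds (q s)) (Ds (D (p s))) s := Ds.hasFDerivAt.comp_hasDerivAt s hq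
  have hv := (hDs.const_sub f).sub hΓ
  refine (hD.norm_sq.add hv.norm_sq).congr_deriv ?_
  simp only [Pi.sub_apply]
  generalize f - Ds (q s) - Γ (p s) = v
  rw [inner_sub_right, inner_neg_right, real_inner_comm (Ds (D (p s))) v, h.adjoint,
    real_inner_comm (Γ v) v]
  ring

lemma derivEnergy_le (h : IsDampedWave D Ds Γ δ M f q p) {s : ℝ} (hs : 0 ≤ s) :
    derivEnergy D Ds Γ f q p s ≤ derivEnergy D Ds Γ f q p 0 := by
  have hanti : AntitoneOn (derivEnergy D Ds Γ f q p) (Set.Ici 0) := by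
    refine antitoneOn_of_deriv_nonpos (convex_Ici 0) h.continuousOn_derivEnergy ?_ ?_
    · intro u hu
      rw [interior_Ici] at hu
      exact (h.hasDerivAt_derivEnergy hu).differentiableAt.differentiableWithinAt
    · intro u hu
      rw [interior_Ici] at hu
      rw [(h.hasDerivAt_derivEnergy hu).deriv]
      have h1 := h.lower (f - Ds (q u) - Γ (p u))
      have h2 : 0 ≤ δ * ‖f - Ds (q u) - Γ (p u)‖ ^ 2 := by have := h.pos; positivity
      linarith
  exact hanti (Set.mem_Ici.2 le_rfl) hs hs

/-- The energy inequality. -/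
lemma energy_le (h : IsDampedWave D Ds Γ δ M f q p) {s : ℝ} (hs : 0 ≤ s) :
    ‖q s‖ ^ 2 + ‖p s‖ ^ 2 + δ * ∫ u in (0 : ℝ)..s, ‖p u‖ ^ 2
      ≤ ‖q 0‖ ^ 2 + ‖p 0‖ ^ 2 + s * (‖f‖ ^ 2 / δ) := by
  have hδ := h.pos
  have hsub : Set.Icc 0 s ⊆ Set.Ici (0 : ℝ) := Set.Icc_subset_Ici_self
  have hcp : ContinuousOn p (Set.uIcc 0 s) := by rw [Set.uIcc_of_le hs]; exact h.cont_p.mono hsub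
  have hcq : ContinuousOn q (Set.uIcc 0 s) := by rw [Set.uIcc_of_le hs]; exact h.cont_q.mono hsub
  have hcW : ContinuousOn (fun u => 2 * inner ℝ f (p u) - 2 * inner ℝ (Γ (p u)) (p u))
      (Set.uIcc 0 s) := by fun_prop
  have hderiv : ∀ u ∈ Set.Ioo 0 s, HasDerivAt (fun u => ‖q u‖ ^ 2 + ‖p u‖ ^ 2)
      (2 * inner ℝ f (p u) - 2 * inner ℝ (Γ (p u)) (p u)) u := by
    intro u hu
    refine ((h.deriv_q u hu.1).norm_sq.add (h.deriv_p u hu.1).norm_sq).congr_deriv ?_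
    rw [inner_sub_right, inner_sub_right, real_inner_comm (Ds (q u)), h.adjoint,
      real_inner_comm f, real_inner_comm (Γ (p u))]
    ring
  have hftc := intervalIntegral.integral_eq_sub_of_hasDerivAt_of_le hs
    (f := fun u => ‖q u‖ ^ 2 + ‖p u‖ ^ 2)
    (by rw [← Set.uIcc_of_le hs]; fun_prop) hderiv hcW.intervalIntegrable
  have hcp2 : ContinuousOn (fun u => ‖p u‖ ^ 2) (Set.uIcc 0 s) := by fun_prop
  have hmono : ∫ u in (0 : ℝ)..s, (2 * inner ℝ f (p u) - 2 * inner ℝ (Γ (p u)) (p u))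
      ≤ ∫ u in (0 : ℝ)..s, (‖f‖ ^ 2 / δ - δ * ‖p u‖ ^ 2) := by
    refine intervalIntegral.integral_mono_on hs hcW.intervalIntegrable
      (ContinuousOn.intervalIntegrable (by fun_prop)) fun u _ => ?_
    have h1 := h.lower (p u)
    have h2 := real_inner_le_norm f (p u)
    -- The damping provides `2 δ ‖p‖²`; one half pays for the force, the other stays on the left of
    -- the energy inequality.
    have h3 : 2 * (‖f‖ * ‖p u‖) ≤ ‖f‖ ^ 2 / δ + δ * ‖p u‖ ^ 2 := by
      have : 0 ≤ (‖f‖ - δ * ‖p u‖) ^ 2 / δ := by positivity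
      have e : (‖f‖ - δ * ‖p u‖) ^ 2 / δ = ‖f‖ ^ 2 / δ + δ * ‖p u‖ ^ 2 - 2 * (‖f‖ * ‖p u‖) := by
        field_simp; ring
      linarith
    linarith
  rw [hftc, intervalIntegral.integral_sub intervalIntegrable_const
    (hcp2.intervalIntegrable.const_mul δ), intervalIntegral.integral_const,
    intervalIntegral.integral_const_mul] at hmono
  simp only [sub_zero, smul_eq_mul] at hmono
  linarith

/-- The weighted estimate: a weight vanishing at both ends moves the energy of the time
derivative onto the derivative of the weight. -/
lemma integral_weight_mul_derivEnergy_le (h : IsDampedWave D Ds Γ δ M f q p) {T : ℝ} (hT : 0 ≤ T)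
    {φ φ' H : ℝ → ℝ} (hφ : ∀ s, HasDerivAt φ (φ' s) s) (hφ' : Continuous φ')
    (hφ0 : φ 0 = 0) (hφT : φ T = 0) (hpos : ∀ s ∈ Set.Icc 0 T, 0 ≤ φ s)
    (hH : ContinuousOn H (Set.Icc 0 T))
    (hle : ∀ s ∈ Set.Icc 0 T, |φ' s| * (|crossTerm D Γ f q p s|
      + derivEnergy D Ds Γ f q p s / δ) ≤ H s) :
    ∫ s in (0 : ℝ)..T, φ s * derivEnergy D Ds Γ f q p s ≤ ∫ s in (0 : ℝ)..T, H s := by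
  have hδ := h.pos
  have hsub : Set.uIcc 0 T ⊆ Set.Ici (0 : ℝ) := by
    rw [Set.uIcc_of_le hT]; exact Set.Icc_subset_Ici_self
  have hcφ : Continuous φ := continuous_iff_continuousAt.2 fun s => (hφ s).continuousAt
  have hcG := h.continuousOn_crossTerm.mono hsub
  have hcE := h.continuousOn_derivEnergy.mono hsub
  have hcp := h.cont_p.mono hsub
  have hcq := h.cont_q.mono hsub
  have hφ'c : ContinuousOn φ' (Set.uIcc 0 T) := hφ'.continuousOn
  have hφc : ContinuousOn φ (Set.uIcc 0 T) := hcφ.continuousOn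
  rw [← Set.uIcc_of_le hT] at hH
  -- This is the derivative of `φ (G - E/δ)`, with `G` the cross term and `E` the energy of the time
  -- derivative. Since `G' = ‖D p‖² - ‖p'‖²` and `-E'/δ ≥ 2 ‖p'‖²`, one has `(G - E/δ)' ≥ E`.
  set W' : ℝ → ℝ := fun s => φ' s * (crossTerm D Γ f q p s - derivEnergy D Ds Γ f q p s / δ)
    + φ s * ((‖D (p s)‖ ^ 2 - ‖f - Ds (q s) - Γ (p s)‖ ^ 2)
      - (-2 * inner ℝ (Γ (f - Ds (q s) - Γ (p s))) (f - Ds (q s) - Γ (p s))) / δ) with hW'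
  have hcW' : ContinuousOn W' (Set.uIcc 0 T) := by
    simp only [hW']
    fun_prop
  have hftc := intervalIntegral.integral_eq_sub_of_hasDerivAt_of_le hT (f' := W')
    (f := fun s => φ s * (crossTerm D Γ f q p s - derivEnergy D Ds Γ f q p s / δ))
    (by rw [← Set.uIcc_of_le hT]; fun_prop)
    (fun s hs => (hφ s).mul ((h.hasDerivAt_crossTerm hs.1).sub
      ((h.hasDerivAt_derivEnergy hs.1).div_const δ))) hcW'.intervalIntegrable
  rw [hφ0, hφT, zero_mul, zero_mul, sub_zero] at hftc
  have hcφE : ContinuousOn (fun s => φ s * derivEnergy D Ds Γ f q p s) (Set.uIcc 0 T) := by fun_prop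
  have hmono : ∫ s in (0 : ℝ)..T, (φ s * derivEnergy D Ds Γ f q p s - H s)
      ≤ ∫ s in (0 : ℝ)..T, W' s := by
    refine intervalIntegral.integral_mono_on hT
      (ContinuousOn.intervalIntegrable (by fun_prop)) hcW'.intervalIntegrable fun s hs => ?_
    have h1 := hle s hs
    have h2 := hpos s hs
    have h3 : -(|φ' s| * (|crossTerm D Γ f q p s| + derivEnergy D Ds Γ f q p s / δ))
        ≤ φ' s * (crossTerm D Γ f q p s - derivEnergy D Ds Γ f q p s / δ) := by
      refine le_trans (neg_le_neg ?_) (neg_abs_le _)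
      rw [abs_mul]
      gcongr
      refine (abs_sub _ _).trans ?_
      rw [abs_of_nonneg (div_nonneg (derivEnergy_nonneg s) hδ.le)]
    have h4 : φ s * derivEnergy D Ds Γ f q p s ≤ φ s * ((‖D (p s)‖ ^ 2
        - ‖f - Ds (q s) - Γ (p s)‖ ^ 2)
        - (-2 * inner ℝ (Γ (f - Ds (q s) - Γ (p s))) (f - Ds (q s) - Γ (p s))) / δ) := by
      refine mul_le_mul_of_nonneg_left ?_ h2
      have h5 : ‖f - Ds (q s) - Γ (p s)‖ ^ 2
          ≤ inner ℝ (Γ (f - Ds (q s) - Γ (p s))) (f - Ds (q s) - Γ (p s)) / δ := by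
        rw [le_div_iff₀ hδ, mul_comm]
        exact h.lower _
      simp only [derivEnergy]
      rw [mul_div_assoc]
      linarith
    simp only [hW']
    linarith
  rw [hftc, intervalIntegral.integral_sub hcφE.intervalIntegrable hH.intervalIntegrable] at hmono
  linarith

end IsDampedWave

end DampedWave

/-! ### Weighted estimates at length scale `L` and time scale `κ L²`. -/

section Window

variable {E F : Type*} [NormedAddCommGroup E] [InnerProductSpace ℝ E]
  [NormedAddCommGroup F] [InnerProductSpace ℝ F]
  {D : F →L[ℝ] E} {Ds : E →L[ℝ] F} {Γ : F →L[ℝ] F} {δ M : ℝ} {f : F}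
  {q : ℝ → E} {p : ℝ → F}

/-- The constant in the bound of the energy at scale `L`. -/
noncomputable def energyConst (δ κ a b : ℝ) : ℝ := a + κ * b / δ

/-- The constant in the bound of the cross term and the derivative energy at scale `L`. -/
noncomputable def crossConst (δ M κ a b K : ℝ) : ℝ :=
  (1 + M) * energyConst δ κ a b + K + b + K / δ

/-- The constant in the bound of the energy of the time derivative at scale `L`. -/
noncomputable def derivConst (δ M κ a b K : ℝ) : ℝ :=
  4 * energyConst δ κ a b + (κ * b + (1 + M) * energyConst δ κ a b / δ) / 2
    + 4 * crossConst δ M κ a b K / δ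

variable {L T κ a b K : ℝ}

namespace IsDampedWave

/-- Over the time `κ L²` a force of squared norm `b/L` feeds in at most `κ b L / δ`, the same order
`L` as the initial energy. -/
lemma energy_le_scale (h : IsDampedWave D Ds Γ δ M f q p) (hL : 1 ≤ L) (hT : T = κ * L ^ 2)
    (hE0 : ‖q 0‖ ^ 2 + ‖p 0‖ ^ 2 ≤ a * L)
    (hf : ‖f‖ ^ 2 ≤ b / L) {s : ℝ} (hs : s ∈ Set.Icc 0 T) :
    ‖q s‖ ^ 2 + ‖p s‖ ^ 2 + δ * ∫ u in (0 : ℝ)..s, ‖p u‖ ^ 2 ≤ energyConst δ κ a b * L := by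
  have hδ := h.pos
  have hL0 : 0 < L := by linarith
  refine (h.energy_le hs.1).trans ?_
  have h1 : s * (‖f‖ ^ 2 / δ) ≤ κ * b / δ * L := by
    calc s * (‖f‖ ^ 2 / δ) ≤ T * (b / L / δ) := by
          have hsT := hs.2
          have hT0 : 0 ≤ T := hs.1.trans hs.2
          gcongr
      _ = κ * b / δ * L := by rw [hT]; field_simp
  rw [energyConst]
  linarith

lemma abs_crossTerm_add_le (h : IsDampedWave D Ds Γ δ M f q p) (hL : 1 ≤ L) (hT : T = κ * L ^ 2)
    (hE0 : ‖q 0‖ ^ 2 + ‖p 0‖ ^ 2 ≤ a * L) (hf : ‖f‖ ^ 2 ≤ b / L) (hb : 0 ≤ b) (hK0 : 0 ≤ K)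
    (hK : derivEnergy D Ds Γ f q p 0 ≤ K) {s : ℝ} (hs : s ∈ Set.Icc 0 T) :
    |crossTerm D Γ f q p s| + derivEnergy D Ds Γ f q p s / δ ≤ crossConst δ M κ a b K * L := by
  have hδ := h.pos
  have hM := h.upper_nonneg
  have hL0 : 0 < L := by linarith
  have hE := h.energy_le_scale hL hT hE0 hf hs
  have hint : 0 ≤ δ * ∫ u in (0 : ℝ)..s, ‖p u‖ ^ 2 :=
    mul_nonneg hδ.le (intervalIntegral.integral_nonneg hs.1 fun u _ => sq_nonneg _)
  have hD := (h.derivEnergy_le hs.1).trans hK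
  have hu : ‖D (p s)‖ ^ 2 ≤ K := le_trans (by unfold derivEnergy; nlinarith [sq_nonneg ‖f - Ds (q s) - Γ (p s)‖]) hD
  have hf1 : ‖f‖ ^ 2 ≤ b := hf.trans (div_le_self hb hL)
  have h1 : |inner ℝ (q s) (D (p s))| ≤ 1 / 2 * (‖q s‖ ^ 2 + ‖D (p s)‖ ^ 2) := by
    refine (abs_real_inner_le_norm _ _).trans ?_
    nlinarith [sq_nonneg (‖q s‖ - ‖D (p s)‖)]
  have h2 : |inner ℝ f (p s)| ≤ 1 / 2 * (‖f‖ ^ 2 + ‖p s‖ ^ 2) := by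
    refine (abs_real_inner_le_norm _ _).trans ?_
    nlinarith [sq_nonneg (‖f‖ - ‖p s‖)]
  have h3 : |1 / 2 * inner ℝ (Γ (p s)) (p s)| ≤ 1 / 2 * (M * ‖p s‖ ^ 2) := by
    rw [abs_mul, abs_of_nonneg (by norm_num : (0 : ℝ) ≤ 1 / 2), abs_of_nonneg]
    · have := h.upper (p s)
      gcongr
    · exact le_trans (by positivity) (h.lower (p s))
  have h4 : |crossTerm D Γ f q p s| ≤ 1 / 2 * (‖q s‖ ^ 2 + ‖D (p s)‖ ^ 2)
      + 1 / 2 * (‖f‖ ^ 2 + ‖p s‖ ^ 2) + 1 / 2 * (M * ‖p s‖ ^ 2) := by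
    unfold crossTerm
    exact (abs_add_le _ _).trans (add_le_add ((abs_sub _ _).trans (add_le_add h1 h2)) h3)
  set c := energyConst δ κ a b with hc
  have hp : ‖p s‖ ^ 2 ≤ c * L := by nlinarith [sq_nonneg ‖q s‖]
  have hMp : M * ‖p s‖ ^ 2 ≤ M * (c * L) := by gcongr
  have hcL : 0 ≤ c * L := le_trans (sq_nonneg _) hp
  have hdiv : derivEnergy D Ds Γ f q p s / δ ≤ K / δ := by gcongr
  have hKL : K ≤ K * L := le_mul_of_one_le_right hK0 hL
  have hbL : b ≤ b * L := le_mul_of_one_le_right hb hL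
  have hKδ : K / δ ≤ K / δ * L := le_mul_of_one_le_right (by positivity) hL
  have hMc : 0 ≤ M * (c * L) := by positivity
  rw [crossConst, ← hc]
  nlinarith

/-- Crude first round: the slope of `s (T - s)` is at most `T`, and the cross term is bounded
pointwise by order `L`. -/
lemma integral_weight_le (h : IsDampedWave D Ds Γ δ M f q p) (hL : 1 ≤ L) (hκ : 0 ≤ κ)
    (hT : T = κ * L ^ 2) (hE0 : ‖q 0‖ ^ 2 + ‖p 0‖ ^ 2 ≤ a * L) (hf : ‖f‖ ^ 2 ≤ b / L)
    (hb : 0 ≤ b) (hK0 : 0 ≤ K) (hK : derivEnergy D Ds Γ f q p 0 ≤ K) :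
    ∫ s in (0 : ℝ)..T, (s * (T - s)) * derivEnergy D Ds Γ f q p s
      ≤ T ^ 2 * (crossConst δ M κ a b K * L) := by
  have hT0 : 0 ≤ T := by rw [hT]; positivity
  have hd : ∀ s : ℝ, HasDerivAt (fun s => s * (T - s)) (T - 2 * s) s := fun s => by
    refine ((hasDerivAt_id s).mul ((hasDerivAt_id s).const_sub T)).congr_deriv ?_
    simp only [id]
    ring
  have := h.integral_weight_mul_derivEnergy_le hT0 (H := fun _ => T * (crossConst δ M κ a b K * L))
    hd (by fun_prop) (by simp) (by simp)
    (fun s hs => mul_nonneg hs.1 (sub_nonneg.2 hs.2)) continuousOn_const fun s hs => ?_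
  · refine this.trans_eq ?_
    rw [intervalIntegral.integral_const, smul_eq_mul]
    ring
  · refine mul_le_mul ?_ (h.abs_crossTerm_add_le hL hT hE0 hf hb hK0 hK hs) ?_ hT0
    · rw [abs_le]
      constructor <;> linarith [hs.1, hs.2]
    · exact add_nonneg (abs_nonneg _) (div_nonneg (derivEnergy_nonneg s) h.pos.le)

/-- Second round. With `ψ = s (T - s)` the slope of `ψ²` is at most `2 T ψ`, and the spare `ψ` is
what helps. Young's inequality hides `⟨q, D p⟩` in half of the left side, at the cost of `2 T²
‖q‖²`. The terms in `‖p‖²` use its time integral, of order `L`, instead of a pointwise bound. The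
term `E/δ`, `E` being `derivEnergy`, is left to the first round. -/
lemma integral_sq_weight_le (h : IsDampedWave D Ds Γ δ M f q p) (hL : 1 ≤ L) (hκ : 0 ≤ κ)
    (hT : T = κ * L ^ 2) (hE0 : ‖q 0‖ ^ 2 + ‖p 0‖ ^ 2 ≤ a * L) (hf : ‖f‖ ^ 2 ≤ b / L)
    (hb : 0 ≤ b) (hK0 : 0 ≤ K) (hK : derivEnergy D Ds Γ f q p 0 ≤ K) :
    ∫ s in (0 : ℝ)..T, (s * (T - s)) ^ 2 * derivEnergy D Ds Γ f q p s
      ≤ T ^ 3 * (derivConst δ M κ a b K * L) := by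
  have hδ := h.pos
  have hM := h.upper_nonneg
  have hL0 : 0 < L := by linarith
  have hT0 : 0 ≤ T := by rw [hT]; positivity
  have hsub : Set.uIcc 0 T ⊆ Set.Ici (0 : ℝ) := by
    rw [Set.uIcc_of_le hT0]; exact Set.Icc_subset_Ici_self
  have hcE := h.continuousOn_derivEnergy.mono hsub
  have hcp := h.cont_p.mono hsub
  set c := energyConst δ κ a b with hc
  set e := crossConst δ M κ a b K with he
  have hd : ∀ s : ℝ, HasDerivAt (fun s => (s * (T - s)) ^ 2) (2 * (s * (T - s)) * (T - 2 * s)) s :=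
    fun s => by
      have : HasDerivAt (fun s => s * (T - s)) (T - 2 * s) s := by
        refine ((hasDerivAt_id s).mul ((hasDerivAt_id s).const_sub T)).congr_deriv ?_
        simp only [id]
        ring
      simpa using this.fun_pow 2
  have main := h.integral_weight_mul_derivEnergy_le hT0
    (H := fun s => 1 / 2 * ((s * (T - s)) ^ 2 * derivEnergy D Ds Γ f q p s)
      + (2 * T ^ 2 * (c * L) + T ^ 3 / 4 * (b / L)) + T ^ 3 / 4 * (1 + M) * ‖p s‖ ^ 2
      + 2 * T / δ * ((s * (T - s)) * derivEnergy D Ds Γ f q p s))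
    hd (by fun_prop) (by simp) (by simp) (fun s _ => sq_nonneg _)
    (by rw [← Set.uIcc_of_le hT0]; fun_prop) fun s hs => ?_
  · have i1 : ContinuousOn (fun s => (s * (T - s)) ^ 2 * derivEnergy D Ds Γ f q p s)
        (Set.uIcc 0 T) := by fun_prop
    have i2 : ContinuousOn (fun s => ‖p s‖ ^ 2) (Set.uIcc 0 T) := by fun_prop
    have i3 : ContinuousOn (fun s => (s * (T - s)) * derivEnergy D Ds Γ f q p s)
        (Set.uIcc 0 T) := by fun_prop
    have i1' := i1.intervalIntegrable (μ := volume)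
    have i2' := i2.intervalIntegrable (μ := volume)
    have i3' := i3.intervalIntegrable (μ := volume)
    rw [intervalIntegral.integral_add (((i1'.const_mul _).add intervalIntegrable_const).add
        (i2'.const_mul _)) (i3'.const_mul _),
      intervalIntegral.integral_add ((i1'.const_mul _).add intervalIntegrable_const)
        (i2'.const_mul _),
      intervalIntegral.integral_add (i1'.const_mul _) intervalIntegrable_const,
      intervalIntegral.integral_const, intervalIntegral.integral_const_mul,
      intervalIntegral.integral_const_mul, intervalIntegral.integral_const_mul] at main
    have h1 := h.integral_weight_le hL hκ hT hE0 hf hb hK0 hK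
    rw [← he] at h1
    have h2 : ∫ u in (0 : ℝ)..T, ‖p u‖ ^ 2 ≤ c * L / δ := by
      rw [le_div_iff₀ hδ, mul_comm]
      have := h.energy_le_scale hL hT hE0 hf (Set.right_mem_Icc.2 hT0)
      nlinarith [sq_nonneg ‖q T‖, sq_nonneg ‖p T‖]
    have h3 : T ^ 3 / 4 * (1 + M) * ∫ u in (0 : ℝ)..T, ‖p u‖ ^ 2
        ≤ T ^ 3 / 4 * (1 + M) * (c * L / δ) := by gcongr
    have h4 : 2 * T / δ * ∫ s in (0 : ℝ)..T, (s * (T - s)) * derivEnergy D Ds Γ f q p s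
        ≤ 2 * T / δ * (T ^ 2 * (e * L)) := by gcongr
    have h5 : T * (b / L) = κ * b * L := by rw [hT]; field_simp
    rw [sub_zero, smul_eq_mul] at main
    have h6 : T * (2 * T ^ 2 * (c * L) + T ^ 3 / 4 * (b / L))
        = T ^ 3 * (2 * c + κ * b / 4) * L := by
      calc _ = 2 * T ^ 3 * (c * L) + T ^ 3 / 4 * (T * (b / L)) := by ring
        _ = _ := by rw [h5]; ring
    rw [h6] at main
    have h7 : T ^ 3 * (derivConst δ M κ a b K * L) = 2 * (T ^ 3 * (2 * c + κ * b / 4) * L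
        + T ^ 3 / 4 * (1 + M) * (c * L / δ) + 2 * T / δ * (T ^ 2 * (e * L))) := by
      rw [derivConst, ← hc, ← he]
      field_simp
      ring
    rw [h7]
    linarith
  · set ψ := s * (T - s) with hψ
    have hψ0 : 0 ≤ ψ := mul_nonneg hs.1 (sub_nonneg.2 hs.2)
    have hψT : ψ ≤ T ^ 2 / 4 := by rw [hψ]; nlinarith [sq_nonneg (T - 2 * s)]
    have hE := h.energy_le_scale hL hT hE0 hf hs
    rw [← hc] at hE
    have hint : 0 ≤ δ * ∫ u in (0 : ℝ)..s, ‖p u‖ ^ 2 :=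
      mul_nonneg hδ.le (intervalIntegral.integral_nonneg hs.1 fun u _ => sq_nonneg _)
    have hq : ‖q s‖ ^ 2 ≤ c * L := by nlinarith [sq_nonneg ‖p s‖]
    have habs : |2 * ψ * (T - 2 * s)| ≤ 2 * T * ψ := by
      rw [abs_mul, abs_of_nonneg (by positivity)]
      have : |T - 2 * s| ≤ T := by rw [abs_le]; constructor <;> linarith [hs.1, hs.2]
      nlinarith
    have h1 : 2 * T * ψ * |inner ℝ (q s) (D (p s))|
        ≤ 1 / 2 * (ψ ^ 2 * derivEnergy D Ds Γ f q p s) + 2 * T ^ 2 * (c * L) := by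
      calc 2 * T * ψ * |inner ℝ (q s) (D (p s))| ≤ 2 * T * ψ * (‖q s‖ * ‖D (p s)‖) := by
            gcongr
            exact abs_real_inner_le_norm _ _
        _ ≤ 1 / 2 * (ψ ^ 2 * ‖D (p s)‖ ^ 2) + 2 * T ^ 2 * ‖q s‖ ^ 2 := by
            nlinarith [sq_nonneg (ψ * ‖D (p s)‖ - 2 * T * ‖q s‖)]
        _ ≤ _ := by
            gcongr
            unfold derivEnergy
            nlinarith [sq_nonneg ‖f - Ds (q s) - Γ (p s)‖]
    have h2 : |inner ℝ f (p s)| ≤ 1 / 2 * (b / L) + 1 / 2 * ‖p s‖ ^ 2 := by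
      refine (abs_real_inner_le_norm _ _).trans ?_
      nlinarith [sq_nonneg (‖f‖ - ‖p s‖)]
    have h3 : |1 / 2 * inner ℝ (Γ (p s)) (p s)| ≤ 1 / 2 * (M * ‖p s‖ ^ 2) := by
      rw [abs_mul, abs_of_nonneg (by norm_num : (0 : ℝ) ≤ 1 / 2), abs_of_nonneg]
      · have := h.upper (p s)
        gcongr
      · exact le_trans (by positivity) (h.lower (p s))
    have h4 : |crossTerm D Γ f q p s| ≤ |inner ℝ (q s) (D (p s))| + |inner ℝ f (p s)|
        + |1 / 2 * inner ℝ (Γ (p s)) (p s)| := by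
      unfold crossTerm
      exact (abs_add_le _ _).trans (add_le_add_left (abs_sub _ _) _)
    have hbL : 0 ≤ b / L := by positivity
    have h5 : 2 * T * ψ * (|inner ℝ f (p s)| + |1 / 2 * inner ℝ (Γ (p s)) (p s)|)
        ≤ T ^ 3 / 4 * (b / L) + T ^ 3 / 4 * (1 + M) * ‖p s‖ ^ 2 := by
      calc _ ≤ 2 * T * (T ^ 2 / 4) * ((1 / 2 * (b / L) + 1 / 2 * ‖p s‖ ^ 2)
            + 1 / 2 * (M * ‖p s‖ ^ 2)) := by gcongr
        _ = _ := by ring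
    calc |2 * ψ * (T - 2 * s)| * (|crossTerm D Γ f q p s| + derivEnergy D Ds Γ f q p s / δ)
        ≤ 2 * T * ψ * ((|inner ℝ (q s) (D (p s))| + |inner ℝ f (p s)|
        + |1 / 2 * inner ℝ (Γ (p s)) (p s)|) + derivEnergy D Ds Γ f q p s / δ) := by
          have : 0 ≤ derivEnergy D Ds Γ f q p s / δ := div_nonneg (derivEnergy_nonneg s) hδ.le
          gcongr
      _ = 2 * T * ψ * |inner ℝ (q s) (D (p s))|
          + 2 * T * ψ * (|inner ℝ f (p s)| + |1 / 2 * inner ℝ (Γ (p s)) (p s)|)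
          + 2 * T / δ * (ψ * derivEnergy D Ds Γ f q p s) := by ring
      _ ≤ _ := by linarith

/-- On the time window `[T/8, T/2]`, `T = κ L²`, the quantities `‖p‖² / L` and `L ‖D p‖²` have
integrals bounded independently of `L`. -/
theorem integral_window_le (h : IsDampedWave D Ds Γ δ M f q p) (hL : 1 ≤ L) (hκ : 0 < κ)
    (hT : T = κ * L ^ 2) (hE0 : ‖q 0‖ ^ 2 + ‖p 0‖ ^ 2 ≤ a * L) (hf : ‖f‖ ^ 2 ≤ b / L)
    (hb : 0 ≤ b) (hK0 : 0 ≤ K) (hK : derivEnergy D Ds Γ f q p 0 ≤ K) :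
    ∫ s in (T / 8)..(T / 2), (2 / L * ‖p s‖ ^ 2 + L * ‖D (p s)‖ ^ 2)
      ≤ 2 * energyConst δ κ a b / δ + 256 * derivConst δ M κ a b K / κ := by
  have hδ := h.pos
  have hL0 : 0 < L := by linarith
  have hT0 : 0 < T := by rw [hT]; positivity
  have hsub : Set.uIcc 0 T ⊆ Set.Ici (0 : ℝ) := by
    rw [Set.uIcc_of_le hT0.le]; exact Set.Icc_subset_Ici_self
  have hcE := h.continuousOn_derivEnergy.mono hsub
  have hcp := h.cont_p.mono hsub
  have h1 := h.integral_sq_weight_le hL hκ.le hT hE0 hf hb hK0 hK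
  have h2 : ∫ u in (0 : ℝ)..T, ‖p u‖ ^ 2 ≤ energyConst δ κ a b * L / δ := by
    rw [le_div_iff₀ hδ, mul_comm]
    have := h.energy_le_scale hL hT hE0 hf (Set.right_mem_Icc.2 hT0.le)
    nlinarith [sq_nonneg ‖q T‖, sq_nonneg ‖p T‖]
  have i1 : ContinuousOn (fun s => (s * (T - s)) ^ 2 * derivEnergy D Ds Γ f q p s)
      (Set.uIcc 0 T) := by fun_prop
  have i2 : ContinuousOn (fun s => ‖p s‖ ^ 2) (Set.uIcc 0 T) := by fun_prop
  have i1' := i1.intervalIntegrable (μ := volume)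
  have i2' := i2.intervalIntegrable (μ := volume)
  have hsub2 : Set.uIcc (T / 8) (T / 2) ⊆ Set.uIcc 0 T := by
    rw [Set.uIcc_of_le (by linarith), Set.uIcc_of_le hT0.le]
    exact Set.Icc_subset_Icc (by linarith) (by linarith)
  have hmono : ∫ s in (T / 8)..(T / 2), (2 / L * ‖p s‖ ^ 2 + L * ‖D (p s)‖ ^ 2)
      ≤ ∫ s in (T / 8)..(T / 2), (2 / L * ‖p s‖ ^ 2
        + 256 * L / T ^ 4 * ((s * (T - s)) ^ 2 * derivEnergy D Ds Γ f q p s)) := by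
    have hcp' := hcp.mono hsub2
    have hcE' := hcE.mono hsub2
    refine intervalIntegral.integral_mono_on (by linarith)
      (ContinuousOn.intervalIntegrable (by fun_prop))
      (ContinuousOn.intervalIntegrable (by fun_prop)) fun s hs => ?_
    -- On the window `s ≥ T/8` and `T - s ≥ T/2`; the factor 256 is the square of 16.
    have hψ : T ^ 2 / 16 ≤ s * (T - s) := by nlinarith [hs.1, hs.2]
    have hψ2 : (T ^ 2 / 16) ^ 2 ≤ (s * (T - s)) ^ 2 := by gcongr
    have hDE : ‖D (p s)‖ ^ 2 ≤ derivEnergy D Ds Γ f q p s := by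
      unfold derivEnergy
      nlinarith [sq_nonneg ‖f - Ds (q s) - Γ (p s)‖]
    have : L * ‖D (p s)‖ ^ 2
        ≤ 256 * L / T ^ 4 * ((s * (T - s)) ^ 2 * derivEnergy D Ds Γ f q p s) := by
      calc L * ‖D (p s)‖ ^ 2 = 256 * L / T ^ 4 * ((T ^ 2 / 16) ^ 2 * ‖D (p s)‖ ^ 2) := by
            field_simp; norm_num
        _ ≤ _ := by gcongr
    linarith
  have hext : ∫ s in (T / 8)..(T / 2), (2 / L * ‖p s‖ ^ 2
        + 256 * L / T ^ 4 * ((s * (T - s)) ^ 2 * derivEnergy D Ds Γ f q p s))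
      ≤ ∫ s in (0 : ℝ)..T, (2 / L * ‖p s‖ ^ 2
        + 256 * L / T ^ 4 * ((s * (T - s)) ^ 2 * derivEnergy D Ds Γ f q p s)) := by
    refine intervalIntegral.integral_mono_interval (by linarith) (by linarith) (by linarith)
      (Eventually.of_forall fun s => ?_) ((i2'.const_mul _).add (i1'.const_mul _))
    have := derivEnergy_nonneg (D := D) (Ds := Ds) (Γ := Γ) (f := f) (q := q) (p := p) s
    simp only [Pi.zero_apply]
    positivity
  refine (hmono.trans hext).trans ?_
  rw [intervalIntegral.integral_add (i2'.const_mul _) (i1'.const_mul _),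
    intervalIntegral.integral_const_mul, intervalIntegral.integral_const_mul]
  have h3 : 2 / L * ∫ u in (0 : ℝ)..T, ‖p u‖ ^ 2 ≤ 2 / L * (energyConst δ κ a b * L / δ) := by
    gcongr
  have h4 : 256 * L / T ^ 4 * ∫ s in (0 : ℝ)..T, (s * (T - s)) ^ 2 * derivEnergy D Ds Γ f q p s
      ≤ 256 * L / T ^ 4 * (T ^ 3 * (derivConst δ M κ a b K * L)) := by gcongr
  refine (add_le_add h3 h4).trans_eq ?_
  congr 1
  · field_simp
  · rw [hT]
    field_simp

end IsDampedWave

end Window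

/-! ### The operators of the chain -/

section Discrete

variable {n : ℕ}

/-- The discrete gradient `(D p)_{i+1} = p_{i+1} - p_i`. -/
noncomputable def grad (n : ℕ) :
    EuclideanSpace ℝ (Fin (n + 1)) →L[ℝ] EuclideanSpace ℝ (Fin n) :=
  LinearMap.toContinuousLinearMap
    { toFun := fun p => WithLp.toLp 2 fun i => p i.succ - p i.castSucc
      map_add' := fun p q => by ext i; simp; ring
      map_smul' := fun c p => by ext i; simp; ring }

/-- The adjoint of the discrete gradient. -/
noncomputable def gradAdj (n : ℕ) :
    EuclideanSpace ℝ (Fin n) →L[ℝ] EuclideanSpace ℝ (Fin (n + 1)) :=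
  LinearMap.toContinuousLinearMap
    { toFun := fun r => WithLp.toLp 2 fun x =>
        (Fin.cons 0 (r : Fin n → ℝ) : Fin (n + 1) → ℝ) x
          - (Fin.snoc (r : Fin n → ℝ) 0 : Fin (n + 1) → ℝ) x
      map_add' := fun p q => by
        ext x
        have h1 : (Fin.cons 0 ((p + q : EuclideanSpace ℝ (Fin n)) : Fin n → ℝ) : Fin (n + 1) → ℝ) x
            = (Fin.cons 0 (p : Fin n → ℝ) : Fin (n + 1) → ℝ) x
              + (Fin.cons 0 (q : Fin n → ℝ) : Fin (n + 1) → ℝ) x := by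
          cases x using Fin.cases <;> simp
        have h2 : (Fin.snoc ((p + q : EuclideanSpace ℝ (Fin n)) : Fin n → ℝ) 0 : Fin (n + 1) → ℝ) x
            = (Fin.snoc (p : Fin n → ℝ) 0 : Fin (n + 1) → ℝ) x
              + (Fin.snoc (q : Fin n → ℝ) 0 : Fin (n + 1) → ℝ) x := by
          cases x using Fin.lastCases <;> simp
        simp only [h1, h2, PiLp.add_apply]
        ring
      map_smul' := fun c p => by
        ext x
        have h1 : (Fin.cons 0 ((c • p : EuclideanSpace ℝ (Fin n)) : Fin n → ℝ) : Fin (n + 1) → ℝ) x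
            = c * (Fin.cons 0 (p : Fin n → ℝ) : Fin (n + 1) → ℝ) x := by
          cases x using Fin.cases <;> simp
        have h2 : (Fin.snoc ((c • p : EuclideanSpace ℝ (Fin n)) : Fin n → ℝ) 0 : Fin (n + 1) → ℝ) x
            = c * (Fin.snoc (p : Fin n → ℝ) 0 : Fin (n + 1) → ℝ) x := by
          cases x using Fin.lastCases <;> simp
        simp only [h1, h2, PiLp.smul_apply, smul_eq_mul, RingHom.id_apply]
        ring }

/-- The damping coefficient at the site `x`. -/
noncomputable def dampCoeff (n : ℕ) (γ γ' : ℝ) (x : Fin (n + 1)) : ℝ :=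
  2 * γ + γ' * ((if x = 0 then 1 else 0) + if x = Fin.last n then 1 else 0)

/-- The damping operator: flips at all sites and heat baths at the ends. -/
noncomputable def damp (n : ℕ) (γ γ' : ℝ) :
    EuclideanSpace ℝ (Fin (n + 1)) →L[ℝ] EuclideanSpace ℝ (Fin (n + 1)) :=
  LinearMap.toContinuousLinearMap
    { toFun := fun p => WithLp.toLp 2 fun x => dampCoeff n γ γ' x * p x
      map_add' := fun p q => by ext i; simp; ring
      map_smul' := fun c p => by ext i; simp; ring }

@[simp] lemma grad_apply (p : EuclideanSpace ℝ (Fin (n + 1))) (i : Fin n) :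
    grad n p i = p i.succ - p i.castSucc := rfl

@[simp] lemma gradAdj_apply (r : EuclideanSpace ℝ (Fin n)) (x : Fin (n + 1)) :
    gradAdj n r x = (Fin.cons 0 (r : Fin n → ℝ) : Fin (n + 1) → ℝ) x
      - (Fin.snoc (r : Fin n → ℝ) 0 : Fin (n + 1) → ℝ) x := rfl

@[simp] lemma damp_apply (γ γ' : ℝ) (p : EuclideanSpace ℝ (Fin (n + 1))) (x : Fin (n + 1)) :
    damp n γ γ' p x = dampCoeff n γ γ' x * p x := rfl

lemma euclidean_inner_eq {ι : Type*} [Fintype ι] (x y : EuclideanSpace ℝ ι) :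
    inner ℝ x y = ∑ i, x i * y i := by
  simp [PiLp.inner_apply, mul_comm]

lemma inner_gradAdj (r : EuclideanSpace ℝ (Fin n)) (p : EuclideanSpace ℝ (Fin (n + 1))) :
    inner ℝ (gradAdj n r) p = inner ℝ r (grad n p) := by
  have h := sum_snoc_sub_cons_mul (r : Fin n → ℝ) (p : Fin (n + 1) → ℝ) 0
  simp only [euclidean_inner_eq, gradAdj_apply, grad_apply]
  rw [← neg_inj, ← Finset.sum_neg_distrib]
  simp only [zero_mul, zero_sub] at h
  rw [← h]
  exact Finset.sum_congr rfl fun x _ => by ring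

lemma inner_damp (γ γ' : ℝ) (p q : EuclideanSpace ℝ (Fin (n + 1))) :
    inner ℝ (damp n γ γ' p) q = inner ℝ p (damp n γ γ' q) := by
  simp only [euclidean_inner_eq, damp_apply]
  exact Finset.sum_congr rfl fun x _ => by ring

lemma le_dampCoeff {γ γ' : ℝ} (hγ' : 0 ≤ γ') (x : Fin (n + 1)) : 2 * γ ≤ dampCoeff n γ γ' x := by
  unfold dampCoeff
  split_ifs <;> nlinarith

lemma dampCoeff_le {γ γ' : ℝ} (hγ' : 0 ≤ γ') (x : Fin (n + 1)) :
    dampCoeff n γ γ' x ≤ 2 * γ + 2 * γ' := by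
  unfold dampCoeff
  split_ifs <;> nlinarith

lemma le_inner_damp {γ γ' : ℝ} (hγ' : 0 ≤ γ') (p : EuclideanSpace ℝ (Fin (n + 1))) :
    2 * γ * ‖p‖ ^ 2 ≤ inner ℝ (damp n γ γ' p) p := by
  rw [EuclideanSpace.real_norm_sq_eq, euclidean_inner_eq, Finset.mul_sum]
  refine Finset.sum_le_sum fun x _ => ?_
  rw [damp_apply, mul_assoc (dampCoeff n γ γ' x), ← sq]
  exact mul_le_mul_of_nonneg_right (le_dampCoeff hγ' x) (sq_nonneg _)

lemma inner_damp_le {γ γ' : ℝ} (hγ' : 0 ≤ γ') (p : EuclideanSpace ℝ (Fin (n + 1))) :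
    inner ℝ (damp n γ γ' p) p ≤ (2 * γ + 2 * γ') * ‖p‖ ^ 2 := by
  rw [EuclideanSpace.real_norm_sq_eq, euclidean_inner_eq, Finset.mul_sum]
  refine Finset.sum_le_sum fun x _ => ?_
  rw [damp_apply, mul_assoc (dampCoeff n γ γ' x), ← sq]
  exact mul_le_mul_of_nonneg_right (dampCoeff_le hγ' x) (sq_nonneg _)

lemma norm_sq_damp_le {γ γ' : ℝ} (hγ : 0 ≤ γ) (hγ' : 0 ≤ γ')
    (p : EuclideanSpace ℝ (Fin (n + 1))) :
    ‖damp n γ γ' p‖ ^ 2 ≤ (2 * γ + 2 * γ') ^ 2 * ‖p‖ ^ 2 := by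
  rw [EuclideanSpace.real_norm_sq_eq, EuclideanSpace.real_norm_sq_eq, Finset.mul_sum]
  refine Finset.sum_le_sum fun x _ => ?_
  rw [damp_apply, mul_pow]
  have h1 := le_dampCoeff (γ := γ) hγ' x
  have h2 := dampCoeff_le (γ := γ) hγ' x
  have h3 : 0 ≤ dampCoeff n γ γ' x := le_trans (by positivity) h1
  gcongr

lemma sum_sq_succ_le (p : EuclideanSpace ℝ (Fin (n + 1))) :
    ∑ i : Fin n, p i.succ ^ 2 ≤ ‖p‖ ^ 2 := by
  rw [EuclideanSpace.real_norm_sq_eq, Fin.sum_univ_succ]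
  linarith [sq_nonneg (p 0)]

lemma sum_sq_castSucc_le (p : EuclideanSpace ℝ (Fin (n + 1))) :
    ∑ i : Fin n, p i.castSucc ^ 2 ≤ ‖p‖ ^ 2 := by
  rw [EuclideanSpace.real_norm_sq_eq, Fin.sum_univ_castSucc]
  linarith [sq_nonneg (p (Fin.last n))]

lemma norm_sq_grad_le (p : EuclideanSpace ℝ (Fin (n + 1))) : ‖grad n p‖ ^ 2 ≤ 4 * ‖p‖ ^ 2 := by
  have h1 := sum_sq_succ_le p
  have h2 := sum_sq_castSucc_le p
  have h3 : ‖grad n p‖ ^ 2 ≤ ∑ i : Fin n, (2 * p i.succ ^ 2 + 2 * p i.castSucc ^ 2) := by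
    rw [EuclideanSpace.real_norm_sq_eq]
    refine Finset.sum_le_sum fun i _ => ?_
    rw [grad_apply]
    nlinarith [sq_nonneg (p i.succ + p i.castSucc)]
  rw [Finset.sum_add_distrib, ← Finset.mul_sum, ← Finset.mul_sum] at h3
  linarith

lemma norm_sq_gradAdj_le (r : EuclideanSpace ℝ (Fin n)) : ‖gradAdj n r‖ ^ 2 ≤ 4 * ‖r‖ ^ 2 := by
  have h1 : ‖gradAdj n r‖ ^ 2 ≤ ‖r‖ * ‖grad n (gradAdj n r)‖ := by
    rw [← real_inner_self_eq_norm_sq, inner_gradAdj]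
    exact real_inner_le_norm _ _
  have h2 := norm_sq_grad_le (gradAdj n r)
  nlinarith [sq_nonneg (2 * ‖r‖ - 1 / 2 * ‖grad n (gradAdj n r)‖)]

/-- A discrete Agmon inequality. -/
theorem sq_apply_le (p : EuclideanSpace ℝ (Fin (n + 1))) (x : Fin (n + 1)) :
    p x ^ 2 ≤ ‖p‖ ^ 2 / ((n : ℝ) + 1) + 2 * (‖p‖ * ‖grad n p‖) := by
  -- The total variation of `p²`; factoring the difference of squares and Cauchy-Schwarz bound it by
  -- `2 ‖p‖ ‖D p‖`.
  set V := ∑ i : Fin n, |p i.succ ^ 2 - p i.castSucc ^ 2| with hV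
  have hVle : V ≤ 2 * (‖p‖ * ‖grad n p‖) := by
    have e1 : V = ∑ i : Fin n, |p i.succ + p i.castSucc| * |grad n p i| := by
      refine Finset.sum_congr rfl fun i _ => ?_
      rw [← abs_mul, grad_apply]
      congr 1
      ring
    have e2 := Finset.sum_mul_sq_le_sq_mul_sq Finset.univ
      (fun i : Fin n => |p i.succ + p i.castSucc|) (fun i => |grad n p i|)
    simp only [sq_abs] at e2
    rw [← e1, ← EuclideanSpace.real_norm_sq_eq] at e2
    have e3 : ∑ i : Fin n, (p i.succ + p i.castSucc) ^ 2 ≤ 4 * ‖p‖ ^ 2 := by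
      have h1 := sum_sq_succ_le p
      have h2 := sum_sq_castSucc_le p
      have h3 : ∑ i : Fin n, (p i.succ + p i.castSucc) ^ 2
          ≤ ∑ i : Fin n, (2 * p i.succ ^ 2 + 2 * p i.castSucc ^ 2) :=
        Finset.sum_le_sum fun i _ => by nlinarith [sq_nonneg (p i.succ - p i.castSucc)]
      rw [Finset.sum_add_distrib, ← Finset.mul_sum, ← Finset.mul_sum] at h3
      linarith
    refine abs_le_of_sq_le_sq' ?_ (by positivity) |>.2
    calc V ^ 2 ≤ _ := e2
      _ ≤ 4 * ‖p‖ ^ 2 * ‖grad n p‖ ^ 2 := by gcongr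
      _ = _ := by ring
  have hstep : ∀ k : ℕ, ∀ a : Fin (n + 1), ∀ b : Fin (n + 1), (b : ℕ) = a + k →
      |p b ^ 2 - p a ^ 2| ≤ ∑ i : Fin n, if (a : ℕ) ≤ i ∧ (i : ℕ) < b then
        |p i.succ ^ 2 - p i.castSucc ^ 2| else 0 := by
    intro k
    induction k with
    | zero =>
      intro a b hab
      have : b = a := Fin.ext (by simpa using hab)
      subst this
      rw [sub_self, abs_zero]
      exact Finset.sum_nonneg fun i _ => by split_ifs <;> positivity
    | succ k ih =>
      intro a b hab
      obtain ⟨j, rfl⟩ : ∃ j : Fin n, b = j.succ := by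
        refine ⟨⟨a + k, by have := b.2; omega⟩, Fin.ext ?_⟩
        simp [hab]; ring
      have hj : (j : ℕ) = a + k := by simp at hab; omega
      have h1 := ih a j.castSucc (by simpa using hj)
      have h2 : ∑ i : Fin n, (if (a : ℕ) ≤ i ∧ (i : ℕ) < j.succ then
          |p i.succ ^ 2 - p i.castSucc ^ 2| else 0)
          = (∑ i : Fin n, if (a : ℕ) ≤ i ∧ (i : ℕ) < j.castSucc then
            |p i.succ ^ 2 - p i.castSucc ^ 2| else 0) + |p j.succ ^ 2 - p j.castSucc ^ 2| := by
        have : |p j.succ ^ 2 - p j.castSucc ^ 2|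
            = ∑ i : Fin n, if i = j then |p i.succ ^ 2 - p i.castSucc ^ 2| else 0 := by simp
        rw [this, ← Finset.sum_add_distrib]
        refine Finset.sum_congr rfl fun i _ => ?_
        by_cases hij : i = j
        · subst hij
          simp [hj]
        · have : (i : ℕ) ≠ j := fun h => hij (Fin.ext h)
          have e : ((a : ℕ) ≤ i ∧ (i : ℕ) < (j.succ : Fin (n + 1)))
              ↔ ((a : ℕ) ≤ i ∧ (i : ℕ) < (j.castSucc : Fin (n + 1))) := by
            simp; omega
          simp only [e, hij, if_false, add_zero]
      rw [h2]
      calc |p j.succ ^ 2 - p a ^ 2|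
          = |(p j.castSucc ^ 2 - p a ^ 2) + (p j.succ ^ 2 - p j.castSucc ^ 2)| := by ring_nf
        _ ≤ _ := (abs_add_le _ _).trans (add_le_add_left h1 _)
  have hab : ∀ a b : Fin (n + 1), a ≤ b → |p b ^ 2 - p a ^ 2| ≤ V := by
    intro a b hab
    refine (hstep (b - a) a b (by have : (a : ℕ) ≤ b := hab; omega)).trans ?_
    refine Finset.sum_le_sum fun i _ => ?_
    split_ifs
    · exact le_rfl
    · exact abs_nonneg _
  have hdiff : ∀ y, p x ^ 2 ≤ p y ^ 2 + V := by
    intro y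
    rcases le_total x y with h | h
    · have := neg_le_of_abs_le (hab x y h)
      linarith
    · have := le_of_abs_le (hab y x h)
      linarith
  -- Averaging over the reference site `y` replaces `p_y ^ 2` by `‖p‖² / (n + 1)`.
  have hsum := Finset.sum_le_sum (s := Finset.univ) fun y _ => hdiff y
  rw [Finset.sum_add_distrib, ← EuclideanSpace.real_norm_sq_eq] at hsum
  simp only [Finset.sum_const, Finset.card_univ, Fintype.card_fin, nsmul_eq_mul] at hsum
  push_cast at hsum
  have hn : (0 : ℝ) < (n : ℝ) + 1 := by positivity
  have : p x ^ 2 ≤ ‖p‖ ^ 2 / ((n : ℝ) + 1) + V := by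
    have e : ‖p‖ ^ 2 / ((n : ℝ) + 1) + V = (‖p‖ ^ 2 + ((n : ℝ) + 1) * V) / ((n : ℝ) + 1) := by
      field_simp
    rw [e, le_div_iff₀ hn]
    linarith
  linarith

/-- Young's inequality with weight `L`; the average term is absorbed because the scale does not
exceed the length of the chain. -/
lemma sq_apply_le_scale (p : EuclideanSpace ℝ (Fin (n + 1))) (x : Fin (n + 1)) {L : ℝ}
    (hL : 0 < L) (hLn : L ≤ (n : ℝ) + 1) :
    p x ^ 2 ≤ 2 / L * ‖p‖ ^ 2 + L * ‖grad n p‖ ^ 2 := by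
  have h1 := sq_apply_le p x
  have h2 : ‖p‖ ^ 2 / ((n : ℝ) + 1) ≤ ‖p‖ ^ 2 / L := by gcongr
  have h3 : 2 * (‖p‖ * ‖grad n p‖) ≤ ‖p‖ ^ 2 / L + L * ‖grad n p‖ ^ 2 := by
    have : 0 ≤ (‖p‖ - L * ‖grad n p‖) ^ 2 / L := by positivity
    have e : (‖p‖ - L * ‖grad n p‖) ^ 2 / L
        = ‖p‖ ^ 2 / L + L * ‖grad n p‖ ^ 2 - 2 * (‖p‖ * ‖grad n p‖) := by
      field_simp; ring
    linarith
  calc _ ≤ _ := h1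
    _ ≤ ‖p‖ ^ 2 / L + (‖p‖ ^ 2 / L + L * ‖grad n p‖ ^ 2) := add_le_add h2 h3
    _ = _ := by ring

/-! ### The tension spread over a boundary layer -/

/-- The ramp which vanishes up to distance `L` from the right end. -/
noncomputable def ramp (n : ℕ) (L : ℝ) (j : ℕ) : ℝ := max 0 (1 - ((n : ℝ) + 1 - j) / L)

lemma ramp_nonneg (L : ℝ) (j : ℕ) : 0 ≤ ramp n L j := le_max_left _ _

lemma ramp_zero {L : ℝ} (hL : 0 < L) (hLn : L ≤ (n : ℝ) + 1) : ramp n L 0 = 0 := by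
  refine max_eq_left ?_
  have : 1 ≤ ((n : ℝ) + 1 - (0 : ℕ)) / L := by rw [le_div_iff₀ hL]; simpa using hLn
  linarith

lemma ramp_last (L : ℝ) : ramp n L (n + 1) = 1 := by simp [ramp]

lemma ramp_le_one {L : ℝ} (hL : 0 < L) {j : ℕ} (hj : j ≤ n + 1) : ramp n L j ≤ 1 := by
  refine max_le zero_le_one ?_
  have : (j : ℝ) ≤ n + 1 := by exact_mod_cast hj
  have : 0 ≤ ((n : ℝ) + 1 - j) / L := div_nonneg (by linarith) hL.le
  linarith

lemma ramp_succ_sub_nonneg {L : ℝ} (hL : 0 < L) (j : ℕ) : 0 ≤ ramp n L (j + 1) - ramp n L j := by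
  rw [sub_nonneg, ramp, ramp]
  gcongr
  simp

lemma ramp_succ_sub_le {L : ℝ} (hL : 0 < L) (j : ℕ) :
    ramp n L (j + 1) - ramp n L j ≤ 1 / L := by
  rw [sub_le_iff_le_add, ramp]
  refine max_le (add_nonneg (by positivity) (ramp_nonneg L j)) ?_
  have : 1 - ((n : ℝ) + 1 - j) / L ≤ ramp n L j := le_max_right _ _
  have e : 1 - ((n : ℝ) + 1 - ((j + 1 : ℕ) : ℝ)) / L = 1 / L + (1 - ((n : ℝ) + 1 - j) / L) := by
    push_cast; field_simp; ring
  linarith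

/-- A discrete form of `ρ² ≤ 2ρ = L (ρ²)'` for `0 ≤ ρ ≤ 1` with slope `1/L`. It makes the sum of
squares telescope, so the sites of the layer need not be counted. -/
lemma ramp_sq_le {L : ℝ} (hL : 0 < L) {j : ℕ} (hj : j ≤ n + 1) :
    ramp n L j ^ 2 ≤ L * (ramp n L (j + 1) ^ 2 - ramp n L j ^ 2) := by
  have h1 := ramp_succ_sub_nonneg (n := n) hL j
  have h0 := ramp_nonneg (n := n) L j
  have h2 := ramp_le_one (n := n) hL hj
  rcases eq_or_lt_of_le h0 with h | h
  · rw [← h]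
    have := sq_nonneg (ramp n L (j + 1))
    simp only [ne_eq, OfNat.ofNat_ne_zero, not_false_eq_true, zero_pow, sub_zero]
    positivity
  · have e : ramp n L j = 1 - ((n : ℝ) + 1 - j) / L := by
      refine max_eq_right ?_
      by_contra! hc
      rw [ramp, max_eq_left hc.le] at h
      exact lt_irrefl _ h
    have h3 : ramp n L j + 1 / L ≤ ramp n L (j + 1) := by
      refine le_trans (le_of_eq ?_) (le_max_right _ _)
      rw [e]
      push_cast
      field_simp
      ring
    have h4 : (ramp n L j + 1 / L) ^ 2 ≤ ramp n L (j + 1) ^ 2 := by gcongr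
    have h5 : L * ((ramp n L j + 1 / L) ^ 2 - ramp n L j ^ 2) = 2 * ramp n L j + 1 / L := by
      field_simp; ring
    have h6 : 0 ≤ 1 / L := by positivity
    calc ramp n L j ^ 2 ≤ 2 * ramp n L j + 1 / L := by nlinarith
      _ = L * ((ramp n L j + 1 / L) ^ 2 - ramp n L j ^ 2) := h5.symm
      _ ≤ _ := by gcongr

/-- The stretch profile of the boundary layer. -/
noncomputable def layer (n : ℕ) (τ L : ℝ) : EuclideanSpace ℝ (Fin n) :=
  WithLp.toLp 2 fun i => τ * ramp n L (i + 1)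

/-- The force left over by the boundary layer. -/
noncomputable def layerForce (n : ℕ) (τ L : ℝ) : EuclideanSpace ℝ (Fin (n + 1)) :=
  WithLp.toLp 2 fun x => τ * (ramp n L (x + 1) - ramp n L x)

lemma norm_sq_layer_le (τ : ℝ) {L : ℝ} (hL : 0 < L) : ‖layer n τ L‖ ^ 2 ≤ τ ^ 2 * L := by
  rw [EuclideanSpace.real_norm_sq_eq]
  have h1 : ∑ i : Fin n, (layer n τ L) i ^ 2 = τ ^ 2 * ∑ j ∈ Finset.range n, ramp n L (j + 1) ^ 2 := by
    rw [Finset.mul_sum, ← Fin.sum_univ_eq_sum_range (fun j => τ ^ 2 * ramp n L (j + 1) ^ 2) n]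
    exact Finset.sum_congr rfl fun i _ => by simp [layer, mul_pow]
  rw [h1]
  gcongr
  calc ∑ j ∈ Finset.range n, ramp n L (j + 1) ^ 2
      ≤ ∑ j ∈ Finset.range n, L * (ramp n L (j + 1 + 1) ^ 2 - ramp n L (j + 1) ^ 2) :=
        Finset.sum_le_sum fun j hj => ramp_sq_le hL (by have := Finset.mem_range.1 hj; omega)
    _ = L * (ramp n L (n + 1) ^ 2 - ramp n L 1 ^ 2) := by
        rw [← Finset.mul_sum, Finset.sum_range_sub (fun j => ramp n L (j + 1) ^ 2)]
    _ ≤ L * 1 := by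
        rw [ramp_last]
        gcongr
        nlinarith [sq_nonneg (ramp n L 1)]
    _ = L := mul_one L

lemma norm_sq_layerForce_le (τ : ℝ) {L : ℝ} (hL : 0 < L) :
    ‖layerForce n τ L‖ ^ 2 ≤ τ ^ 2 / L := by
  rw [EuclideanSpace.real_norm_sq_eq]
  have h1 : ∑ x : Fin (n + 1), (layerForce n τ L) x ^ 2
      = τ ^ 2 * ∑ j ∈ Finset.range (n + 1), (ramp n L (j + 1) - ramp n L j) ^ 2 := by
    rw [Finset.mul_sum, ← Fin.sum_univ_eq_sum_range
      (fun j => τ ^ 2 * (ramp n L (j + 1) - ramp n L j) ^ 2) (n + 1)]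
    exact Finset.sum_congr rfl fun i _ => by simp [layerForce, mul_pow]
  rw [h1, div_eq_mul_inv]
  gcongr
  calc ∑ j ∈ Finset.range (n + 1), (ramp n L (j + 1) - ramp n L j) ^ 2
      ≤ ∑ j ∈ Finset.range (n + 1), 1 / L * (ramp n L (j + 1) - ramp n L j) := by
        refine Finset.sum_le_sum fun j _ => ?_
        rw [sq]
        exact mul_le_mul_of_nonneg_right (ramp_succ_sub_le hL j) (ramp_succ_sub_nonneg hL j)
    _ = 1 / L * (ramp n L (n + 1) - ramp n L 0) := by
        rw [← Finset.mul_sum, Finset.sum_range_sub (fun j => ramp n L j)]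
    _ ≤ 1 / L * 1 := by
        rw [ramp_last]
        gcongr
        linarith [ramp_nonneg (n := n) L 0]
    _ = L⁻¹ := by rw [mul_one, one_div]

/-- The tension as a force acting at the right end. -/
noncomputable def tension (n : ℕ) (τ : ℝ) : EuclideanSpace ℝ (Fin (n + 1)) :=
  EuclideanSpace.single (Fin.last n) τ

/-- The point force, of squared norm `τ²`, is traded for one of squared norm at most `τ²/L`, at the
price of shifting the stretches by a profile of squared norm at most `τ² L`. The ramp is `1` just
beyond the right end, where the tension acts, and the condition `L ≤ n + 1` makes it vanish at the
left end, where `r_0 = 0`. -/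
lemma tension_eq (τ : ℝ) {L : ℝ} (hL : 0 < L) (hLn : L ≤ (n : ℝ) + 1) :
    tension n τ = layerForce n τ L + gradAdj n (layer n τ L) := by
  ext x
  have hcons : (Fin.cons 0 (layer n τ L : Fin n → ℝ) : Fin (n + 1) → ℝ) x = τ * ramp n L x := by
    cases x using Fin.cases with
    | zero => simp [ramp_zero hL hLn]
    | succ i => simp [layer]
  have hsnoc : (Fin.snoc (layer n τ L : Fin n → ℝ) 0 : Fin (n + 1) → ℝ) x
      = τ * ramp n L (x + 1) - tension n τ x := by
    cases x using Fin.lastCases with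
    | last => simp [tension, ramp_last]
    | cast i => simp [layer, tension, Fin.castSucc_ne_last]
  rw [PiLp.add_apply, gradAdj_apply, hcons, hsnoc]
  simp only [layerForce]
  ring

end Discrete

/-! ### The deterministic chain -/

section Chain

variable {n : ℕ}

/-- `(r, p)` solves the equations of the chain of means in microscopic time. -/
structure IsMeanChain (n : ℕ) (γ γ' τ : ℝ) (r : ℝ → EuclideanSpace ℝ (Fin n))
    (p : ℝ → EuclideanSpace ℝ (Fin (n + 1))) : Prop where
  cont_r : ContinuousOn r (Set.Ici 0)
  cont_p : ContinuousOn p (Set.Ici 0)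
  deriv_r : ∀ s, 0 < s → HasDerivAt r (grad n (p s)) s
  deriv_p : ∀ s, 0 < s →
    HasDerivAt p (tension n τ - gradAdj n (r s) - damp n γ γ' (p s)) s

variable {γ γ' τ κ K₀ : ℝ} {r : ℝ → EuclideanSpace ℝ (Fin n)}
  {p : ℝ → EuclideanSpace ℝ (Fin (n + 1))}

lemma IsMeanChain.isDampedWave (h : IsMeanChain n γ γ' τ r p) (hγ : 0 < γ) (hγ' : 0 < γ') {L : ℝ}
    (hL : 0 < L) (hLn : L ≤ (n : ℝ) + 1) :
    IsDampedWave (grad n) (gradAdj n) (damp n γ γ') (2 * γ) (2 * γ + 2 * γ') (layerForce n τ L)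
      (fun s => r s - layer n τ L) p where
  adjoint := inner_gradAdj
  symm := inner_damp γ γ'
  pos := by positivity
  lower := le_inner_damp hγ'.le
  upper := inner_damp_le hγ'.le
  upper_nonneg := by positivity
  cont_q := h.cont_r.sub continuousOn_const
  cont_p := h.cont_p
  deriv_q := fun s hs => (h.deriv_r s hs).sub_const _
  deriv_p := fun s hs => by
    refine (h.deriv_p s hs).congr_deriv ?_
    rw [tension_eq τ hL hLn, map_sub]
    abel

/-- Bound of the initial energy of the time derivative. -/
noncomputable def initDerivConst (γ γ' τ K₀ : ℝ) : ℝ :=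
  4 * K₀ + 3 * (τ ^ 2 + 4 * K₀ + (2 * γ + 2 * γ') ^ 2 * K₀)

/-- The constant shift by the layer does not alter the time derivatives, so the bound is free of
`L`. -/
lemma IsMeanChain.derivEnergy_zero_le (hγ : 0 < γ) (hγ' : 0 < γ') {L : ℝ}
    (hL : 0 < L) (hLn : L ≤ (n : ℝ) + 1) (h0 : ‖r 0‖ ^ 2 + ‖p 0‖ ^ 2 ≤ K₀) :
    derivEnergy (grad n) (gradAdj n) (damp n γ γ') (layerForce n τ L)
      (fun s => r s - layer n τ L) p 0 ≤ initDerivConst γ γ' τ K₀ := by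
  have e : layerForce n τ L - gradAdj n (r 0 - layer n τ L) - damp n γ γ' (p 0)
      = tension n τ - gradAdj n (r 0) - damp n γ γ' (p 0) := by
    rw [tension_eq τ hL hLn, map_sub]
    abel
  simp only [derivEnergy, e]
  have h1 := norm_sq_grad_le (p 0)
  have h2 := norm_sq_gradAdj_le (r 0)
  have h3 := norm_sq_damp_le hγ.le hγ'.le (p 0)
  have h4 : ‖tension n τ‖ ^ 2 = τ ^ 2 := by simp [tension]
  have h5 : ‖tension n τ - gradAdj n (r 0) - damp n γ γ' (p 0)‖
      ≤ ‖tension n τ‖ + ‖gradAdj n (r 0)‖ + ‖damp n γ γ' (p 0)‖ :=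
    (norm_sub_le _ _).trans (add_le_add_left (norm_sub_le _ _) _)
  have h6 : ‖tension n τ - gradAdj n (r 0) - damp n γ γ' (p 0)‖ ^ 2
      ≤ 3 * (‖tension n τ‖ ^ 2 + ‖gradAdj n (r 0)‖ ^ 2 + ‖damp n γ γ' (p 0)‖ ^ 2) := by
    calc _ ≤ (‖tension n τ‖ + ‖gradAdj n (r 0)‖ + ‖damp n γ γ' (p 0)‖) ^ 2 := by gcongr
      _ ≤ _ := by
        nlinarith [sq_nonneg (‖tension n τ‖ - ‖gradAdj n (r 0)‖),
          sq_nonneg (‖tension n τ‖ - ‖damp n γ γ' (p 0)‖),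
          sq_nonneg (‖gradAdj n (r 0)‖ - ‖damp n γ γ' (p 0)‖)]
  have h7 : (2 * γ + 2 * γ') ^ 2 * ‖p 0‖ ^ 2 ≤ (2 * γ + 2 * γ') ^ 2 * K₀ := by
    gcongr
    linarith [sq_nonneg ‖r 0‖]
  rw [initDerivConst]
  linarith [sq_nonneg ‖r 0‖, sq_nonneg ‖p 0‖]

/-- The largest squared momentum. -/
noncomputable def supSq (v : EuclideanSpace ℝ (Fin (n + 1))) : ℝ := ⨆ x, |v x| ^ 2

lemma supSq_le {v : EuclideanSpace ℝ (Fin (n + 1))} {C : ℝ} (h : ∀ x, v x ^ 2 ≤ C) :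
    supSq v ≤ C := ciSup_le fun x => by rw [sq_abs]; exact h x

lemma supSq_nonneg (v : EuclideanSpace ℝ (Fin (n + 1))) : 0 ≤ supSq v :=
  Real.iSup_nonneg fun _ => by positivity

lemma supSq_le_norm_sq (v : EuclideanSpace ℝ (Fin (n + 1))) : supSq v ≤ ‖v‖ ^ 2 :=
  supSq_le fun x => by
    rw [EuclideanSpace.real_norm_sq_eq]
    exact Finset.single_le_sum (f := fun x => v x ^ 2) (fun _ _ => sq_nonneg _) (Finset.mem_univ x)

lemma continuous_supSq : Continuous (supSq (n := n)) := by
  have : supSq (n := n) = fun v => Finset.univ.sup' Finset.univ_nonempty fun x => |v x| ^ 2 := by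
    funext v
    rw [Finset.sup'_univ_eq_ciSup, supSq]
  rw [this]
  exact Continuous.finset_sup'_apply _ fun x _ => by fun_prop

/-- The bound of the integral over one dyadic time window. -/
noncomputable def windowConst (γ γ' τ K₀ κ : ℝ) : ℝ :=
  4 * energyConst (2 * γ) κ (2 * K₀ + 2 * τ ^ 2) (τ ^ 2) / (2 * γ)
    + 256 * derivConst (2 * γ) (2 * γ + 2 * γ') κ (2 * K₀ + 2 * τ ^ 2) (τ ^ 2)
      (initDerivConst γ γ' τ K₀) / κ

lemma IsMeanChain.init_le (τ : ℝ) {L : ℝ} (hL : 1 ≤ L) (h0 : ‖r 0‖ ^ 2 + ‖p 0‖ ^ 2 ≤ K₀) :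
    ‖r 0 - layer n τ L‖ ^ 2 + ‖p 0‖ ^ 2 ≤ (2 * K₀ + 2 * τ ^ 2) * L := by
  have h1 := norm_sq_layer_le (n := n) τ (by linarith : 0 < L)
  have h2 : ‖r 0 - layer n τ L‖ ^ 2 ≤ 2 * ‖r 0‖ ^ 2 + 2 * ‖layer n τ L‖ ^ 2 := by
    have := norm_sub_le (r 0) (layer n τ L)
    calc _ ≤ (‖r 0‖ + ‖layer n τ L‖) ^ 2 := by gcongr
      _ ≤ _ := by nlinarith [sq_nonneg (‖r 0‖ - ‖layer n τ L‖)]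
  have h3 : 0 ≤ K₀ := le_trans (by positivity) h0
  nlinarith [sq_nonneg ‖p 0‖, mul_nonneg h3 (sub_nonneg.2 hL)]

/-- The integral of the largest squared momentum grows at most logarithmically in time. -/
theorem IsMeanChain.integral_supSq_le (h : IsMeanChain n γ γ' τ r p) (hγ : 0 < γ) (hγ' : 0 < γ')
    (hκ : 0 < κ) (h0 : ‖r 0‖ ^ 2 + ‖p 0‖ ^ 2 ≤ K₀) (k : ℕ) :
    ∀ L : ℝ, 1 ≤ L → L ≤ (n : ℝ) + 1 → L ≤ 2 ^ k →
      ∫ s in (0 : ℝ)..(κ * L ^ 2 / 2), supSq (p s) ≤ windowConst γ γ' τ K₀ κ * (k + 1) := by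
  have hK₀ : 0 ≤ K₀ := le_trans (by positivity) h0
  have hK₁ : 0 ≤ initDerivConst γ γ' τ K₀ := by unfold initDerivConst; positivity
  set c := energyConst (2 * γ) κ (2 * K₀ + 2 * τ ^ 2) (τ ^ 2) with hc
  set d := derivConst (2 * γ) (2 * γ + 2 * γ') κ (2 * K₀ + 2 * τ ^ 2) (τ ^ 2)
    (initDerivConst γ γ' τ K₀) with hd
  have hc0 : 0 ≤ c := by rw [hc]; unfold energyConst; positivity
  have hd0 : 0 ≤ d := by
    rw [hd]
    unfold derivConst crossConst energyConst
    positivity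
  have hC : windowConst γ γ' τ K₀ κ = 4 * c / (2 * γ) + 256 * d / κ := rfl
  have hcS : ContinuousOn (fun s => supSq (p s)) (Set.Ici 0) :=
    continuous_supSq.comp_continuousOn h.cont_p
  have hsub : ∀ {a b : ℝ}, 0 ≤ a → 0 ≤ b → Set.uIcc a b ⊆ Set.Ici (0 : ℝ) := fun ha hb x hx =>
    (le_min ha hb).trans hx.1
  have hint : ∀ {a b : ℝ}, 0 ≤ a → 0 ≤ b → IntervalIntegrable (fun s => supSq (p s)) volume a b :=
    fun ha hb => (hcS.mono (hsub ha hb)).intervalIntegrable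
  -- At bounded scales the maximum is controlled by `‖p‖²` and the energy inequality alone suffices.
  have hsmall : ∀ L : ℝ, 1 ≤ L → L ≤ (n : ℝ) + 1 → L ≤ 2 →
      ∫ s in (0 : ℝ)..(κ * L ^ 2 / 2), supSq (p s) ≤ windowConst γ γ' τ K₀ κ := by
    intro L hL hLn hL2
    have hL0 : 0 < L := by linarith
    have hw := h.isDampedWave hγ hγ' hL0 hLn
    have hT : 0 ≤ κ * L ^ 2 / 2 := by positivity
    have h1 := hw.energy_le_scale (κ := κ) hL rfl (IsMeanChain.init_le τ hL h0) (norm_sq_layerForce_le τ hL0)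
      (s := κ * L ^ 2 / 2) ⟨hT, by linarith⟩
    rw [← hc] at h1
    have h2 : ∫ s in (0 : ℝ)..(κ * L ^ 2 / 2), supSq (p s)
        ≤ ∫ s in (0 : ℝ)..(κ * L ^ 2 / 2), ‖p s‖ ^ 2 :=
      intervalIntegral.integral_mono_on hT (hint le_rfl hT)
        ((h.cont_p.norm.pow 2).mono (hsub le_rfl hT)).intervalIntegrable
        fun s _ => supSq_le_norm_sq _
    have h3 : ∫ s in (0 : ℝ)..(κ * L ^ 2 / 2), ‖p s‖ ^ 2 ≤ c * 2 / (2 * γ) := by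
      rw [le_div_iff₀ (by positivity), mul_comm]
      have : c * L ≤ c * 2 := by gcongr
      nlinarith [sq_nonneg ‖r (κ * L ^ 2 / 2) - layer n τ L‖, sq_nonneg ‖p (κ * L ^ 2 / 2)‖]
    have h4 : 0 ≤ 256 * d / κ := by positivity
    have h5 : c * 2 / (2 * γ) ≤ 4 * c / (2 * γ) :=
      div_le_div_of_nonneg_right (by linarith) (by positivity)
    rw [hC]
    linarith
  have hC0 : 0 ≤ windowConst γ γ' τ K₀ κ := by rw [hC]; positivity
  induction k with
  | zero =>
    intro L hL hLn hLk
    have := hsmall L hL hLn (by simp at hLk; linarith)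
    simpa using this
  | succ k ih =>
    intro L hL hLn hLk
    rcases le_total L 2 with hL2 | hL2
    · refine (hsmall L hL hLn hL2).trans (le_mul_of_one_le_right hC0 ?_)
      push_cast
      linarith [(Nat.cast_nonneg k : (0 : ℝ) ≤ k)]
    · have hL0 : 0 < L := by linarith
      -- Halving `L` divides the final time by four, so what remains is exactly the window `[T/8,
      -- T/2]` with `T = κ L²`.
      have h1 := ih (L / 2) (by linarith) (by linarith) (by rw [pow_succ] at hLk; linarith)
      have hw := h.isDampedWave hγ hγ' hL0 hLn
      have h2 := hw.integral_window_le hL hκ rfl (IsMeanChain.init_le τ hL h0)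
        (norm_sq_layerForce_le τ hL0) (sq_nonneg τ) hK₁
        (IsMeanChain.derivEnergy_zero_le hγ hγ' hL0 hLn h0)
      rw [← hc, ← hd] at h2
      have e : κ * (L / 2) ^ 2 / 2 = κ * L ^ 2 / 8 := by ring
      rw [e] at h1
      have hT8 : 0 ≤ κ * L ^ 2 / 8 := by positivity
      have hT2 : 0 ≤ κ * L ^ 2 / 2 := by positivity
      have h3 : ∫ s in (κ * L ^ 2 / 8)..(κ * L ^ 2 / 2), supSq (p s)
          ≤ ∫ s in (κ * L ^ 2 / 8)..(κ * L ^ 2 / 2),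
            (2 / L * ‖p s‖ ^ 2 + L * ‖grad n (p s)‖ ^ 2) := by
        have hcp := h.cont_p.mono (hsub hT8 hT2)
        exact intervalIntegral.integral_mono_on (by linarith) (hint hT8 hT2)
          (ContinuousOn.intervalIntegrable (by fun_prop))
          fun s _ => supSq_le fun x => sq_apply_le_scale (p s) x hL0 hLn
      rw [← intervalIntegral.integral_add_adjacent_intervals (hint le_rfl hT8) (hint hT8 hT2)]
      have h4 : 2 * c / (2 * γ) ≤ 4 * c / (2 * γ) :=
        div_le_div_of_nonneg_right (by linarith) (by positivity)
      push_cast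
      rw [hC] at h1 ⊢
      linarith

end Chain

/-! ### Parseval's identity for `dft` -/

section Parseval

variable {n : ℕ}

lemma sum_exp_mul_conj (x y : Fin (n + 1)) :
    ∑ j : Fin (n + 1),
      Complex.exp (-2 * Real.pi * Complex.I * ((x : ℕ) : ℂ) * (((j : ℕ) : ℂ) / ((n : ℂ) + 1)))
      * (starRingEnd ℂ) (Complex.exp
        (-2 * Real.pi * Complex.I * ((y : ℕ) : ℂ) * (((j : ℕ) : ℂ) / ((n : ℂ) + 1))))
      = if x = y then (n : ℂ) + 1 else 0 := by
  have hN : ((n : ℂ) + 1) ≠ 0 := by exact_mod_cast Nat.succ_ne_zero n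
  set ζ : ℂ := Complex.exp (2 * Real.pi * Complex.I / ((n + 1 : ℕ) : ℂ)) with hζ
  have hprim : IsPrimitiveRoot ζ (n + 1) := Complex.isPrimitiveRoot_exp (n + 1) n.succ_ne_zero
  have hζ0 : ζ ≠ 0 := Complex.exp_ne_zero _
  set z : ℂ := ζ ^ (y : ℕ) * (ζ ^ (x : ℕ))⁻¹ with hz
  have hterm : ∀ j : Fin (n + 1),
      Complex.exp (-2 * Real.pi * Complex.I * ((x : ℕ) : ℂ) * (((j : ℕ) : ℂ) / ((n : ℂ) + 1)))
      * (starRingEnd ℂ) (Complex.exp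
        (-2 * Real.pi * Complex.I * ((y : ℕ) : ℂ) * (((j : ℕ) : ℂ) / ((n : ℂ) + 1)))) = z ^ (j : ℕ) := by
    intro j
    rw [← Complex.exp_conj, ← Complex.exp_add, hz, hζ, ← Complex.exp_nat_mul, ← Complex.exp_nat_mul,
      ← Complex.exp_neg, ← Complex.exp_add, ← Complex.exp_nat_mul]
    congr 1
    have e2 : (starRingEnd ℂ) 2 = 2 := map_ofNat _ 2
    simp only [map_mul, map_div₀, map_add, map_neg, map_one, map_natCast, Complex.conj_ofReal,
      Complex.conj_I, e2]
    push_cast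
    field_simp
    ring
  simp only [hterm]
  rw [Fin.sum_univ_eq_sum_range (fun j => z ^ j) (n + 1)]
  split_ifs with hxy
  · subst hxy
    have : z = 1 := mul_inv_cancel₀ (pow_ne_zero _ hζ0)
    simp [this]
  · have hz1 : z ≠ 1 := by
      intro h1
      apply hxy
      rw [hz, mul_inv_eq_one₀ (pow_ne_zero _ hζ0)] at h1
      exact Fin.ext (hprim.pow_inj x.2 y.2 h1.symm)
    have hzN : z ^ (n + 1) = 1 := by
      rw [hz, mul_pow, inv_pow, ← pow_mul, ← pow_mul, mul_comm (y : ℕ), mul_comm (x : ℕ), pow_mul,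
        pow_mul, hprim.pow_eq_one]
      simp
    rw [geom_sum_eq hz1, hzN, sub_self, zero_div]

theorem sum_norm_sq_dft (f : Fin (n + 1) → ℝ) :
    ∑ j, ‖dft f j‖ ^ 2 = ((n : ℝ) + 1) * ∑ x, f x ^ 2 := by
  have key : ∑ j, (dft f j) * (starRingEnd ℂ) (dft f j) = ((n : ℂ) + 1) * ∑ x, (f x : ℂ) ^ 2 := by
    simp only [dft, map_sum, map_mul, Complex.conj_ofReal]
    simp only [Finset.sum_mul_sum]
    rw [Finset.sum_comm]
    rw [Finset.mul_sum]
    refine Finset.sum_congr rfl fun x _ => ?_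
    rw [Finset.sum_comm]
    have : ∀ y ∈ (Finset.univ : Finset (Fin (n + 1))), ∑ j : Fin (n + 1),
        ((f x : ℂ) * Complex.exp
          (-2 * Real.pi * Complex.I * ((x : ℕ) : ℂ) * (((j : ℕ) : ℂ) / ((n : ℂ) + 1)))
        * ((f y : ℂ) * (starRingEnd ℂ) (Complex.exp
          (-2 * Real.pi * Complex.I * ((y : ℕ) : ℂ) * (((j : ℕ) : ℂ) / ((n : ℂ) + 1))))))
        = if x = y then (f x : ℂ) * f y * ((n : ℂ) + 1) else 0 := by
      intro y _
      have h := congrArg (fun c => (f x : ℂ) * f y * c) (sum_exp_mul_conj x y)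
      simp only [mul_ite, mul_zero, Finset.mul_sum] at h
      rw [← h]
      exact Finset.sum_congr rfl fun j _ => by ring
    rw [Finset.sum_congr rfl this]
    simp
    ring
  have h2 : ∀ j, (dft f j) * (starRingEnd ℂ) (dft f j) = ((‖dft f j‖ ^ 2 : ℝ) : ℂ) := fun j => by
    rw [Complex.mul_conj, Complex.normSq_eq_norm_sq]
  simp only [h2] at key
  exact_mod_cast key

/-- The `n + 1` coefficients contribute at most `(n + 1) K²`, and Parseval's factor `n + 1` cancels.
-/
lemma sum_sq_le_of_dft_le {f : Fin (n + 1) → ℝ} {K : ℝ} (h : ∀ j, ‖dft f j‖ ≤ K) :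
    ∑ x, f x ^ 2 ≤ K ^ 2 := by
  have h1 := sum_norm_sq_dft f
  have h2 : ∑ j, ‖dft f j‖ ^ 2 ≤ ∑ _j : Fin (n + 1), K ^ 2 :=
    Finset.sum_le_sum fun j _ => by
      have := h j
      gcongr
  rw [h1] at h2
  simp only [Finset.sum_const, Finset.card_univ, Fintype.card_fin, nsmul_eq_mul] at h2
  push_cast at h2
  exact le_of_mul_le_mul_left h2 (by positivity)

end Parseval

/-! ### The means of the chain in microscopic time -/

section Assembly

variable {n : ℕ}

lemma linearGen_coordR (γ γ' τ : ℝ) (i : Fin n) (ω : Config n) :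
    linearGen γ γ' τ (coordR i) ω = (n : ℝ) ^ 2 * (ω.2 i.succ - ω.2 i.castSucc) := by
  simp [linearGen, Pi.single_apply]

lemma linearGen_coordP (γ γ' τ : ℝ) (x : Fin (n + 1)) (ω : Config n) :
    linearGen γ γ' τ (coordP x) ω
      = (n : ℝ) ^ 2 * (stretchNext τ ω x - stretch ω x - dampCoeff n γ γ' x * ω.2 x) := by
  simp only [linearGen, coordP_apply, dampCoeff, Pi.single_apply, Pi.zero_apply, mul_ite, mul_one,
    mul_zero, Finset.sum_const_zero, Finset.sum_ite_eq, Finset.mem_univ, if_true]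
  have h0 : (if x = 0 then ω.2 0 else 0) = (if x = 0 then 1 else 0) * ω.2 x := by
    split_ifs with h
    · rw [h, one_mul]
    · rw [zero_mul]
  have hl : (if x = Fin.last n then ω.2 (Fin.last n) else 0)
      = (if x = Fin.last n then 1 else 0) * ω.2 x := by
    split_ifs with h
    · rw [h, one_mul]
    · rw [zero_mul]
  rw [h0, hl]
  ring

lemma snoc_eq_snoc_zero_add_tension (r : Fin n → ℝ) (τ : ℝ) (x : Fin (n + 1)) :
    (Fin.snoc r τ : Fin (n + 1) → ℝ) x
      = (Fin.snoc r 0 : Fin (n + 1) → ℝ) x + tension n τ x := by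
  cases x using Fin.lastCases with
  | last => simp [tension]
  | cast i => simp [tension, Fin.castSucc_ne_last]

lemma hasDerivAt_toLp {ι : Type*} [Fintype ι] {φ : ℝ → ι → ℝ} {φ' : ι → ℝ} {s : ℝ}
    (h : ∀ i, HasDerivAt (fun u => φ u i) (φ' i) s) :
    HasDerivAt (fun u => (WithLp.toLp 2 (φ u) : EuclideanSpace ℝ ι)) (WithLp.toLp 2 φ') s :=
  (PiLp.hasFDerivAt_toLp (𝕜 := ℝ) 2 (φ s)).comp_hasDerivAt s (hasDerivAt_pi.2 h)

variable {Ω : Type*} {m : MeasurableSpace Ω} {P : Measure Ω} {ℱ : Filtration ℝ≥0 m}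
  {γ γ' Tm Tp τ : ℝ} {X : ℝ≥0 → Ω → Config n}

/-- The mean stretches in microscopic time. -/
noncomputable def microStretch (P : Measure Ω) (X : ℝ≥0 → Ω → Config n) (s : ℝ) :
    EuclideanSpace ℝ (Fin n) :=
  WithLp.toLp 2 (meanConfig P X (((n : ℝ) ^ 2)⁻¹ * s)).1

/-- The mean momenta in microscopic time. -/
noncomputable def microMomentum (P : Measure Ω) (X : ℝ≥0 → Ω → Config n) (s : ℝ) :
    EuclideanSpace ℝ (Fin (n + 1)) :=
  WithLp.toLp 2 (meanConfig P X (((n : ℝ) ^ 2)⁻¹ * s)).2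

theorem IsChainDynamics.isMeanChain [IsProbabilityMeasure P]
    (hX : IsChainDynamics P ℱ n γ γ' Tm Tp τ X) (hn : 1 ≤ n) (hγ' : 0 ≤ γ') (hTm : 0 ≤ Tm)
    (hTp : 0 ≤ Tp) (h0 : Integrable (fun ω => sqNorm (X 0 ω)) P) :
    IsMeanChain n γ γ' τ (microStretch P X) (microMomentum P X) := by
  have hn0 : (0 : ℝ) < (n : ℝ) ^ 2 := by positivity
  have hcont : ∀ ℓ : Config n →L[ℝ] ℝ,
      ContinuousOn (fun s => ℓ (meanConfig P X (((n : ℝ) ^ 2)⁻¹ * s))) (Set.Ici 0) := fun ℓ =>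
    (hX.continuousOn_clm_meanConfig hγ' hTm hTp h0 ℓ).comp (by fun_prop)
      fun s (hs : 0 ≤ s) => Set.mem_Ici.2 (by positivity)
  have hderiv : ∀ (ℓ : Config n →L[ℝ] ℝ) (s : ℝ), 0 < s →
      HasDerivAt (fun s => ℓ (meanConfig P X (((n : ℝ) ^ 2)⁻¹ * s)))
        (linearGen γ γ' τ ℓ (meanConfig P X (((n : ℝ) ^ 2)⁻¹ * s)) * ((n : ℝ) ^ 2)⁻¹) s := by
    intro ℓ s hs
    have h1 := hX.hasDerivAt_clm_meanConfig hγ' hTm hTp h0 ℓ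
      (by positivity : 0 < ((n : ℝ) ^ 2)⁻¹ * s)
    have h2 : HasDerivAt (fun s : ℝ => ((n : ℝ) ^ 2)⁻¹ * s) ((n : ℝ) ^ 2)⁻¹ s := by
      simpa using (hasDerivAt_id s).const_mul ((n : ℝ) ^ 2)⁻¹
    exact h1.comp s h2
  refine ⟨?_, ?_, fun s hs => ?_, fun s hs => ?_⟩
  · exact (PiLp.continuous_toLp 2 _).comp_continuousOn
      (continuousOn_pi.2 fun i => hcont (coordR i))
  · exact (PiLp.continuous_toLp 2 _).comp_continuousOn
      (continuousOn_pi.2 fun x => hcont (coordP x))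
  · refine (hasDerivAt_toLp fun i => hderiv (coordR i) s hs).congr_deriv ?_
    ext i
    simp only [linearGen_coordR, grad_apply, microMomentum]
    field_simp
  · refine (hasDerivAt_toLp fun x => hderiv (coordP x) s hs).congr_deriv ?_
    ext x
    simp only [linearGen_coordP, PiLp.sub_apply, gradAdj_apply, damp_apply, microMomentum,
      microStretch, stretchNext, stretch, snoc_eq_snoc_zero_add_tension _ τ]
    field_simp
    ring

lemma integrable_sqNorm_of_meanEnergy_lt_top (hX : Measurable (X 0))
    (h : ∀ x, meanEnergy P X 0 x < ∞) : Integrable (fun ω => sqNorm (X 0 ω)) P := by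
  have hcs : ∀ x : Fin (n + 1), Continuous fun ω : Config n => stretch ω x := fun x => by
    unfold stretch
    cases x using Fin.cases with
    | zero => simpa using continuous_const
    | succ i => exact (coordR i).continuous
  have hc : ∀ x : Fin (n + 1), Continuous fun ω : Config n => energy ω x := fun x => by
    have := hcs x
    unfold energy
    fun_prop
  have hi : ∀ x, Integrable (fun ω => energy (X 0 ω) x) P := fun x =>
    ⟨((hc x).measurable.comp hX).aestronglyMeasurable, (hasFiniteIntegral_iff_ofReal
      (Eventually.of_forall fun ω => by unfold energy; positivity)).2 (h x)⟩
  refine (integrable_finsetSum Finset.univ fun x _ => (hi x).const_mul 2).congr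
    (Eventually.of_forall fun ω => ?_)
  simp only [energy, sqNorm, mul_add, Finset.sum_add_distrib]
  rw [Fin.sum_univ_succ (fun x => 2 * (stretch (X 0 ω) x ^ 2 / 2)), add_comm]
  simp [stretch, mul_div_cancel₀]

lemma micro_init_le {K : ℝ} (hX : Integrable (X 0) P)
    (hK : (⨆ j, ‖dft (meanStretch P X 0) j‖) + (⨆ j, ‖dft (meanMomentum P X 0) j‖) ≤ K) :
    ‖microStretch P X 0‖ ^ 2 + ‖microMomentum P X 0‖ ^ 2 ≤ 2 * K ^ 2 := by
  have hX' : Integrable (X (0 : ℝ).toNNReal) P := by simpa using hX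
  have n1 : 0 ≤ ⨆ j, ‖dft (meanStretch P X 0) j‖ := Real.iSup_nonneg fun _ => norm_nonneg _
  have n2 : 0 ≤ ⨆ j, ‖dft (meanMomentum P X 0) j‖ := Real.iSup_nonneg fun _ => norm_nonneg _
  have b1 : ∀ j, ‖dft (meanStretch P X 0) j‖ ≤ K := fun j => by
    have := le_ciSup (f := fun j => ‖dft (meanStretch P X 0) j‖) (Set.finite_range _).bddAbove j
    linarith
  have b2 : ∀ j, ‖dft (meanMomentum P X 0) j‖ ≤ K := fun j => by
    have := le_ciSup (f := fun j => ‖dft (meanMomentum P X 0) j‖) (Set.finite_range _).bddAbove j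
    linarith
  have s1 := sum_sq_le_of_dft_le b1
  have s2 := sum_sq_le_of_dft_le b2
  have e1 : ‖microStretch P X 0‖ ^ 2 = ∑ x, meanStretch P X 0 x ^ 2 := by
    rw [EuclideanSpace.real_norm_sq_eq, Fin.sum_univ_succ]
    have : meanStretch P X 0 0 = 0 := by simp [meanStretch, stretch]
    rw [this]
    simp only [ne_eq, OfNat.ofNat_ne_zero, not_false_eq_true, zero_pow, zero_add]
    refine Finset.sum_congr rfl fun i _ => ?_
    have : microStretch P X 0 i = coordR i (meanConfig P X 0) := by simp [microStretch]
    rw [this, clm_meanConfig _ hX']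
    simp [meanStretch, stretch]
  have e2 : ‖microMomentum P X 0‖ ^ 2 = ∑ x, meanMomentum P X 0 x ^ 2 := by
    rw [EuclideanSpace.real_norm_sq_eq]
    refine Finset.sum_congr rfl fun x _ => ?_
    have : microMomentum P X 0 x = coordP x (meanConfig P X 0) := by simp [microMomentum]
    rw [this, clm_meanConfig _ hX']
    simp [meanMomentum]
  rw [e1, e2]
  linarith

/-- The number of windows is of order `log (n + 1)`; the second logarithm is conceded through `log 2
≤ log (n + 1)`. -/
lemma log_two_sq_mul_le {n : ℕ} (hn : 1 ≤ n) :
    Real.log 2 ^ 2 * ((Nat.log 2 (n + 1) + 1 : ℕ) + 1 : ℝ) ≤ 3 * Real.log ((n : ℝ) + 1) ^ 2 := by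
  set k := Nat.log 2 (n + 1) with hk
  set l := Real.log ((n : ℝ) + 1) with hl
  have h2 : 0 < Real.log 2 := Real.log_pos (by norm_num)
  have h1 : Real.log 2 ≤ l := Real.log_le_log (by norm_num) (by
    have : (1 : ℝ) ≤ n := by exact_mod_cast hn
    linarith)
  have h3 : (k : ℝ) * Real.log 2 ≤ l := by
    rw [← Real.log_pow]
    refine Real.log_le_log (by positivity) ?_
    exact_mod_cast Nat.pow_log_le_self 2 n.succ_ne_zero
  push_cast
  have h4 : Real.log 2 * (k * Real.log 2) ≤ l * l := mul_le_mul h1 h3 (by positivity) (by linarith)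
  have h5 : Real.log 2 * Real.log 2 ≤ l * l := mul_self_le_mul_self h2.le h1
  nlinarith

end Assembly

end OpenChain

/-! ### The estimate in diffusive time. -/

theorem lemma5p4 (γ γ' Tm Tp τ : ℝ) (hγ : 0 < γ) (hγ' : 0 < γ') (hTm : 0 < Tm) (hTp : 0 < Tp)
    (Ω : ℕ → Type*) (m : ∀ n, MeasurableSpace (Ω n)) (P : ∀ n, Measure (Ω n))
    (hP : ∀ n, IsProbabilityMeasure (P n)) (ℱ : ∀ n, Filtration ℝ≥0 (m n))
    (X : ∀ n, ℝ≥0 → Ω n → OpenChain.Config n)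
    (hX : ∀ n, 1 ≤ n → OpenChain.IsChainDynamics (P n) (ℱ n) n γ γ' Tm Tp τ (X n))
    (hinit : OpenChain.InitialBounds P X) (t : ℝ) (ht : 0 < t) :
    ∃ C : ℝ, 0 < C ∧ ∀ n : ℕ, 1 ≤ n →
      (∀ (s : ℝ≥0) (x : Fin (n + 1)), Integrable (fun ω => (X n s ω).2 x) (P n)) ∧
      IntervalIntegrable
        (fun s : ℝ => ⨆ x : Fin (n + 1),
          |OpenChain.meanMomentum (P n) (X n) s.toNNReal x| ^ 2) volume 0 t ∧
      ∫ s in (0 : ℝ)..t, (⨆ x : Fin (n + 1),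
          |OpenChain.meanMomentum (P n) (X n) s.toNNReal x| ^ 2)
        ≤ C * (Real.log ((n : ℝ) + 1) ^ 2 / (n : ℝ) ^ 2) := by
  obtain ⟨K, hK⟩ := hinit.energy_bound
  obtain ⟨K', hK'⟩ := hinit.spectrum_bound
  -- With `κ ≥ 2 t`, the time `κ (n + 1)² / 2` reached at the scale `L = n + 1` covers the
  -- microscopic horizon `n² t`.
  set κ : ℝ := max 1 (2 * t) with hκdef
  have hκ : 0 < κ := lt_of_lt_of_le one_pos (le_max_left _ _)
  set W := OpenChain.windowConst γ γ' τ (2 * K' ^ 2) κ with hW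
  have hlog2 : 0 < Real.log 2 := Real.log_pos (by norm_num)
  refine ⟨3 * |W| / Real.log 2 ^ 2 + 1, by positivity, fun n hn => ?_⟩
  have := hP n
  have hXn := hX n hn
  have hn0 : (0 : ℝ) < (n : ℝ) ^ 2 := by positivity
  -- The energy assumption enters only through finiteness for each `n`; the uniform quantitative
  -- bound comes from the spectrum.
  have h0 : Integrable (fun ω => OpenChain.sqNorm (X n 0 ω)) (P n) := by
    refine OpenChain.integrable_sqNorm_of_meanEnergy_lt_top (hXn.measurable_apply 0) fun x => ?_
    have h1 : ∑ x : Fin (n + 1), OpenChain.meanEnergy (P n) (X n) 0 x < ∞ := by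
      by_contra! hc
      have h2 := hK n hn
      rw [top_le_iff.1 hc, ENNReal.mul_top (ENNReal.inv_ne_zero.2 (by simp))] at h2
      exact ENNReal.coe_ne_top (top_le_iff.1 h2)
    exact (Finset.single_le_sum (fun _ _ => zero_le) (Finset.mem_univ x)).trans_lt h1
  have hi : ∀ s : ℝ≥0, Integrable (X n s) (P n) := fun s => by
    have h1 := (hXn.integrable_sqNorm hγ'.le hTm.le hTp.le h0 s.coe_nonneg).1
    rw [Real.toNNReal_coe] at h1
    exact hXn.integrable_config h1
  have hchain := hXn.isMeanChain hn hγ'.le hTm.le hTp.le h0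
  have hinit0 := OpenChain.micro_init_le (hi 0) (hK' n hn)
  have hsup : (fun s : ℝ => ⨆ x : Fin (n + 1),
      |OpenChain.meanMomentum (P n) (X n) s.toNNReal x| ^ 2)
      = fun s => OpenChain.supSq (OpenChain.microMomentum (P n) (X n) ((n : ℝ) ^ 2 * s)) := by
    funext s
    simp only [OpenChain.supSq]
    congr 1
    funext x
    congr 2
    have : OpenChain.microMomentum (P n) (X n) ((n : ℝ) ^ 2 * s) x
        = OpenChain.coordP x (OpenChain.meanConfig (P n) (X n) s) := by
      simp [OpenChain.microMomentum, inv_mul_cancel_left₀ hn0.ne']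
    rw [this, OpenChain.clm_meanConfig _ (hi _)]
    rfl
  have hcS : ContinuousOn (fun s => OpenChain.supSq (OpenChain.microMomentum (P n) (X n) s))
      (Set.Ici 0) := OpenChain.continuous_supSq.comp_continuousOn hchain.cont_p
  have hint : ∀ {b : ℝ}, 0 ≤ b → IntervalIntegrable
      (fun s => OpenChain.supSq (OpenChain.microMomentum (P n) (X n) s)) volume 0 b := fun hb =>
    (hcS.mono (by rw [Set.uIcc_of_le hb]; exact Set.Icc_subset_Ici_self)).intervalIntegrable
  refine ⟨fun s x => (OpenChain.coordP x).integrable_comp (hi s), ?_, ?_⟩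
  · rw [hsup]
    refine ContinuousOn.intervalIntegrable (hcS.comp (by fun_prop) fun s hs => ?_)
    rw [Set.uIcc_of_le ht.le] at hs
    have := hs.1
    exact Set.mem_Ici.2 (by positivity)
  · rw [hsup, intervalIntegral.integral_comp_mul_left
      (fun s => OpenChain.supSq (OpenChain.microMomentum (P n) (X n) s)) hn0.ne', mul_zero,
      smul_eq_mul]
    -- The number of dyadic steps that reaches `L = n + 1`.
    set k := Nat.log 2 (n + 1) + 1 with hk
    have hpow : (n : ℝ) + 1 ≤ 2 ^ k := by
      exact_mod_cast (Nat.lt_pow_succ_log_self (by norm_num) (n + 1)).le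
    have hmain := hchain.integral_supSq_le hγ hγ' hκ hinit0 k ((n : ℝ) + 1)
      (by linarith [(Nat.cast_nonneg n : (0 : ℝ) ≤ n)]) le_rfl hpow
    rw [← hW] at hmain
    have htime : (n : ℝ) ^ 2 * t ≤ κ * ((n : ℝ) + 1) ^ 2 / 2 := by
      have h1 : 2 * t ≤ κ := le_max_right _ _
      have h2 : (n : ℝ) ^ 2 ≤ ((n : ℝ) + 1) ^ 2 := by gcongr; linarith
      calc (n : ℝ) ^ 2 * t = (2 * t) * (n : ℝ) ^ 2 / 2 := by ring
        _ ≤ κ * ((n : ℝ) + 1) ^ 2 / 2 := by gcongr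
    have hext : ∫ s in (0 : ℝ)..((n : ℝ) ^ 2 * t),
        OpenChain.supSq (OpenChain.microMomentum (P n) (X n) s)
        ≤ ∫ s in (0 : ℝ)..(κ * ((n : ℝ) + 1) ^ 2 / 2),
          OpenChain.supSq (OpenChain.microMomentum (P n) (X n) s) :=
      intervalIntegral.integral_mono_interval le_rfl (by positivity) htime
        (Eventually.of_forall fun s => OpenChain.supSq_nonneg _) (hint (by positivity))
    have hlog := OpenChain.log_two_sq_mul_le hn
    rw [← hk] at hlog
    have hbound : ∫ s in (0 : ℝ)..((n : ℝ) ^ 2 * t),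
        OpenChain.supSq (OpenChain.microMomentum (P n) (X n) s)
        ≤ (3 * |W| / Real.log 2 ^ 2 + 1) * Real.log ((n : ℝ) + 1) ^ 2 := by
      calc _ ≤ W * ((k : ℝ) + 1) := hext.trans hmain
        _ ≤ |W| * ((k : ℝ) + 1) := by gcongr; exact le_abs_self W
        _ = |W| / Real.log 2 ^ 2 * (Real.log 2 ^ 2 * ((k : ℝ) + 1)) := by field_simp
        _ ≤ |W| / Real.log 2 ^ 2 * (3 * Real.log ((n : ℝ) + 1) ^ 2) := by gcongr
        _ = 3 * |W| / Real.log 2 ^ 2 * Real.log ((n : ℝ) + 1) ^ 2 := by ring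
        _ ≤ _ := by
          rw [add_mul, one_mul]
          exact le_add_of_nonneg_right (sq_nonneg _)
    calc _ ≤ ((n : ℝ) ^ 2)⁻¹ * ((3 * |W| / Real.log 2 ^ 2 + 1) * Real.log ((n : ℝ) + 1) ^ 2) := by
          gcongr
      _ = _ := by ring
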